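/- Let $\mathsf K=\mathrm{SU}(3)$, with simple roots $\Sigma=\{\alpha_1,\alpha_2\}$ and simple root vectors $X_1=E_{12}$, $X_2=E_{23}$ and $Y_i=X_i^{\mathsf T}$ in $\mathfrak{sl}(3,\mathbb C)=\mathfrak{su}(3)_{\mathbb C}$. For $S\subseteq\Sigma$ let $\mathsf K_S\le\mathsf K$ be the following subgroup: $\mathsf K_\Sigma=\mathsf K$; $\mathsf K_{\{\alpha_1\}}$ and $\mathsf K_{\{\alpha_2\}}$ are the subgroups of block diagonal matrices with blocks of sizes $(2,1)$ and $(1,2)$ respectively; $\mathsf K_\emptyset$ is the diagonal torus. For a (strongly continuous) unitary representation of $\mathsf K$ on a Hilbert space $\mathcal H$ and an irreducible representation class $\sigma\in\widehat{\mathsf K_S}$, let $p_\sigma$ be the orthogonal projection of $\mathcal H$ onto the $\sigma$-isotypical subspace of its restriction to $\mathsf K_S$. A bounded operator $A:\mathcal H\to\mathcal H'$ between unitary $\mathsf K$-representations is called $\mathsf K_S$-harmonically proper if the matrix $(p_{\sigma'}Ap_\sigma)_{\sigma',\sigma\in\widehat{\mathsf K_S}}$ is row- and column-finite, and $\mathsf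 K_S$-harmonically finite if this matrix has only finitely many nonzero entries. Let $\mathcal A_S(\mathcal H,\mathcal H')$, respectively $\mathcal K_S(\mathcal H,\mathcal H')$, be the operator-norm closure of the set of $\mathsf K_S$-harmonically proper, respectively $\mathsf K_S$-harmonically finite, operators, and put $\mathcal A(\mathcal H)=\bigcap_{S\subseteq\Sigma}\mathcal A_S(\mathcal H,\mathcal H)$. Let $\mathsf K$ act unitarily on a Hilbert space $\mathcal H$. For $Z\in\{X_1,X_2,Y_1,Y_2\}$ denote also by $Z$ the closure of the infinitesimal action of $Z$ on the smooth vectors of $\mathcal H$, a closed densely defined operator, and let $\operatorname{Ph}Z$ be its phase, i.e. the unique partial isometry with $\ker \operatorname{Ph}Z=\ker Z$ and $Z=(\operatorname{Ph}Z)\,|Z|$, where $|Z|=(Z^*Z)^{1/2}$. **Theorem.** For $i=1,2$ the operators $\operatorname{Ph}X_i$ and $\operatorname{Ph}Y_i$ exist and belong to $\mathcal A(\mathcal H)$. In addition, for every $S\subseteq\Sigma$ (in particular for $S=\{\alpha_1\}$ and $S=\{\alpha_2\}$) they are two-sided multipliers of $\mathcal K_S$: if $V$ is one of these operators, then $VT\in\mathcal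 K_S(\mathcal H',\mathcal H)$ for all $T\in\mathcal K_S(\mathcal H',\mathcal H)$ and $TV\in\mathcal K_S(\mathcal H,\mathcal H')$ for all $T\in\mathcal K_S(\mathcal H,\mathcal H')$, for every unitary $\mathsf K$-representation $\mathcal H'$. -/

import Mathlib

universe u v

noncomputable section

namespace HarmonicSU3

open Matrix

/-! ### Unitary representations, their irreducible types and isotypical projections -/

/-- A strongly continuous unitary representation of a topological group `G` on a complex
inner product space `H`. -/
structure UnitaryRep (G : Type*) [Group G] [TopologicalSpace G]
    (H : Type*) [NormedAddCommGroup H] [InnerProductSpace ℂ H] where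
  toHom : G →* (H ≃ₗᵢ[ℂ] H)
  continuous_orbit : ∀ v : H, Continuous fun g => toHom g v

namespace UnitaryRep

variable {G : Type*} [Group G] [TopologicalSpace G]
variable {H : Type*} [NormedAddCommGroup H] [InnerProductSpace ℂ H]

/-- Restriction of a unitary representation to a subgroup. -/
def restrict (π : UnitaryRep G H) (L : Subgroup G) : UnitaryRep L H where
  toHom := π.toHom.comp L.subtype
  continuous_orbit v := (π.continuous_orbit v).comp continuous_subtype_val

/-- The underlying linear representation. -/
def toRepresentation (π : UnitaryRep G H) : Representation ℂ G H where
  toFun g := (π.toHom g).toLinearEquiv.toLinearMap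
  map_one' := by ext v; simp
  map_mul' g h := by ext v; simp

end UnitaryRep

/-- A concrete irreducible unitary representation of `G` on some `ℂⁿ`. (For a compact group
every irreducible unitary representation is unitarily equivalent to one of these.) -/
def ConcreteIrrep (G : Type*) [Group G] [TopologicalSpace G] : Type _ :=
  Σ n : ℕ, {ρ : UnitaryRep G (EuclideanSpace ℂ (Fin n)) // ρ.toRepresentation.IsIrreducible}

/-- Unitary equivalence of irreducible representations. -/
instance irrepSetoid (G : Type*) [Group G] [TopologicalSpace G] : Setoid (ConcreteIrrep G) where
  r ρ₁ ρ₂ := ∃ U : EuclideanSpace ℂ (Fin ρ₁.1) ≃ₗᵢ[ℂ] EuclideanSpace ℂ (Fin ρ₂.1),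
    ∀ g v, U (ρ₁.2.1.toHom g v) = ρ₂.2.1.toHom g (U v)
  iseqv :=
    { refl := fun _ => ⟨LinearIsometryEquiv.refl ℂ _, fun _ _ => rfl⟩
      symm := by
        rintro ρ₁ ρ₂ ⟨U, hU⟩
        refine ⟨U.symm, fun g v => ?_⟩
        apply U.injective
        rw [hU]
        simp
      trans := by
        rintro ρ₁ ρ₂ ρ₃ ⟨U, hU⟩ ⟨W, hW⟩
        exact ⟨U.trans W, fun g v => by simp [hU, hW]⟩ }

/-- The set of `G`-types: equivalence classes of irreducible unitary representations. -/
def Types (G : Type*) [Group G] [TopologicalSpace G] : Type _ :=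
  Quotient (irrepSetoid G)

namespace UnitaryRep

variable {G : Type*} [Group G] [TopologicalSpace G]
variable {H : Type*} [NormedAddCommGroup H] [InnerProductSpace ℂ H]

/-- The `σ`-isotypical subspace: the closed linear span of the images of all intertwining maps
into `H` from representations of class `σ`. -/
def isotypic (π : UnitaryRep G H) (σ : Types G) : Submodule ℂ H :=
  (Submodule.span ℂ {v : H | ∃ ρ : ConcreteIrrep G, Quotient.mk (irrepSetoid G) ρ = σ ∧
    ∃ T : EuclideanSpace ℂ (Fin ρ.1) →L[ℂ] H,
      (∀ g x, T (ρ.2.1.toHom g x) = π.toHom g (T x)) ∧ ∃ x, T x = v}).topologicalClosure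

/-- The orthogonal projection `p_σ` onto the `σ`-isotypical subspace. -/
def proj [CompleteSpace H] (π : UnitaryRep G H) (σ : Types G) : H →L[ℂ] H :=
  haveI : CompleteSpace (π.isotypic σ) :=
    (Submodule.isClosed_topologicalClosure _).completeSpace_coe
  (π.isotypic σ).starProjection

end UnitaryRep

/-! ### Harmonically proper and harmonically finite operators -/

section Harmonic

variable {G : Type*} [Group G] [TopologicalSpace G]
variable {H : Type*} [NormedAddCommGroup H] [InnerProductSpace ℂ H] [CompleteSpace H]
variable {H' : Type*} [NormedAddCommGroup H'] [InnerProductSpace ℂ H'] [CompleteSpace H']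

/-- The matrix entry `A_{σ'σ} = p_{σ'} A p_σ`. -/
def matrixEntry (π : UnitaryRep G H) (π' : UnitaryRep G H') (A : H →L[ℂ] H')
    (σ' σ : Types G) : H →L[ℂ] H' :=
  π'.proj σ' ∘L A ∘L π.proj σ

/-- The matrix `(A_{σ'σ})` is row- and column-finite. -/
def HarmonicallyProper (π : UnitaryRep G H) (π' : UnitaryRep G H') (A : H →L[ℂ] H') : Prop :=
  ∀ σ : Types G,
    {σ' : Types G | matrixEntry π π' A σ' σ ≠ 0 ∨ matrixEntry π π' A σ σ' ≠ 0}.Finite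

/-- The matrix `(A_{σ'σ})` has only finitely many nonzero entries. -/
def HarmonicallyFinite (π : UnitaryRep G H) (π' : UnitaryRep G H') (A : H →L[ℂ] H') : Prop :=
  {s : Types G × Types G | matrixEntry π π' A s.1 s.2 ≠ 0}.Finite

end Harmonic

/-! ### The group `SU(3)` and its subgroups `K_S` -/

/-- The compact group `K = SU(3)`. -/
abbrev SU3 : Type := Matrix.specialUnitaryGroup (Fin 3) ℂ

/-- The simple roots `α₁, α₂` are indexed by `0, 1 : Fin 2`. Indices `a, b` of matrix entries lie
in the same block for `S` if every simple root between them belongs to `S`. -/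
def SameBlock (S : Set (Fin 2)) (a b : Fin 3) : Prop :=
  ∀ i : Fin 2, min (a : ℕ) b ≤ i → (i : ℕ) < max (a : ℕ) b → i ∈ S

theorem SameBlock.symm {S : Set (Fin 2)} {a b : Fin 3} (h : SameBlock S a b) :
    SameBlock S b a := by
  intro i h1 h2
  exact h i (by rwa [min_comm]) (by rwa [max_comm])

theorem SameBlock.trans {S : Set (Fin 2)} {a b c : Fin 3} (h : SameBlock S a b)
    (h' : SameBlock S b c) : SameBlock S a c := by
  intro i h1 h2
  by_cases hi : min (a : ℕ) b ≤ i ∧ (i : ℕ) < max (a : ℕ) b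
  · exact h i hi.1 hi.2
  · exact h' i (by omega) (by omega)

/-- The subgroup `K_S` of `K = SU(3)` of matrices that are block diagonal for the blocks of `S`:
`K_∅` is the diagonal torus `M`, `K_{α₁}` and `K_{α₂}` are the two copies of `S(U(2) × U(1))` and
`S(U(1) × U(2))`, and `K_Σ` is `K`. -/
def KS (S : Set (Fin 2)) : Subgroup SU3 where
  carrier := {k | ∀ a b, ¬ SameBlock S a b → (k : Matrix (Fin 3) (Fin 3) ℂ) a b = 0}
  one_mem' := by
    intro a b h
    have hab : a ≠ b := by
      rintro rfl
      exact h fun i h1 h2 => by omega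
    simp [Matrix.one_apply_ne hab]
  mul_mem' := by
    intro k l hk hl a b h
    change ((k : Matrix (Fin 3) (Fin 3) ℂ) * (l : Matrix (Fin 3) (Fin 3) ℂ)) a b = 0
    rw [Matrix.mul_apply]
    refine Finset.sum_eq_zero fun c _ => ?_
    by_cases hac : SameBlock S a c
    · rw [hl c b fun hcb => h (hac.trans hcb), mul_zero]
    · rw [hk a c hac, zero_mul]
  inv_mem' := by
    intro k hk a b h
    change (star (k : Matrix (Fin 3) (Fin 3) ℂ)) a b = 0
    rw [Matrix.star_apply, hk b a fun hba => h hba.symm, star_zero]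

section Categories

variable {H : Type*} [NormedAddCommGroup H] [InnerProductSpace ℂ H] [CompleteSpace H]
variable {H' : Type*} [NormedAddCommGroup H'] [InnerProductSpace ℂ H'] [CompleteSpace H']

/-- `𝒜_S(H, H')`: the norm closure of the `K_S`-harmonically proper operators. -/
def opAS (S : Set (Fin 2)) (π : UnitaryRep SU3 H) (π' : UnitaryRep SU3 H') :
    Set (H →L[ℂ] H') :=
  closure {A | HarmonicallyProper (π.restrict (KS S)) (π'.restrict (KS S)) A}

/-- `𝒦_S(H, H')`: the norm closure of the `K_S`-harmonically finite operators. -/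
def opKS (S : Set (Fin 2)) (π : UnitaryRep SU3 H) (π' : UnitaryRep SU3 H') :
    Set (H →L[ℂ] H') :=
  closure {A | HarmonicallyFinite (π.restrict (KS S)) (π'.restrict (KS S)) A}

/-- `𝒜(H, H')`: the intersection of `𝒜_S(H, H')` over all sets `S` of simple roots. -/
def opA (π : UnitaryRep SU3 H) (π' : UnitaryRep SU3 H') : Set (H →L[ℂ] H') :=
  ⋂ S : Set (Fin 2), opAS S π π'

end Categories

/-! ### The infinitesimal action -/

/-- The Lie algebra `𝔰𝔲(3)` of traceless skew-Hermitian matrices. -/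
def su3 : Submodule ℝ (Matrix (Fin 3) (Fin 3) ℂ) where
  carrier := {A | Aᴴ = -A ∧ A.trace = 0}
  zero_mem' := by simp
  add_mem' := by
    rintro A B ⟨h1, h2⟩ ⟨h3, h4⟩
    exact ⟨by rw [conjTranspose_add, h1, h3, neg_add], by rw [trace_add, h2, h4, add_zero]⟩
  smul_mem' := by
    rintro c A ⟨h1, h2⟩
    exact ⟨by rw [conjTranspose_smul, h1, star_trivial, smul_neg],
      by rw [trace_smul, h2, smul_zero]⟩

theorem det_exp_of_skew {A : Matrix (Fin 3) (Fin 3) ℂ} (h : Aᴴ = -A) :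
    (NormedSpace.exp A).det = Complex.exp A.trace := by
  have hB : (Complex.I • A).IsHermitian := by
    rw [IsHermitian, conjTranspose_smul, h]
    simp
  have hA : A = (-Complex.I) • (Complex.I • A) := by
    rw [smul_smul]; simp
  obtain ⟨U, d, hU, hAd⟩ : ∃ (U : Matrix (Fin 3) (Fin 3) ℂ) (d : Fin 3 → ℂ), IsUnit U ∧
      A = U * diagonal d * U⁻¹ := by
    let U : Matrix (Fin 3) (Fin 3) ℂ := hB.eigenvectorUnitary
    have hUU : U * star U = 1 := Unitary.coe_mul_star_self hB.eigenvectorUnitary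
    have hinv : U⁻¹ = star U := Matrix.inv_eq_right_inv hUU
    refine ⟨U, (-Complex.I) • (fun i => (hB.eigenvalues i : ℂ)), ?_, ?_⟩
    · exact IsUnit.of_mul_eq_one _ hUU
    · rw [hinv]
      conv_lhs => rw [hA, hB.spectral_theorem]
      rw [Unitary.conjStarAlgAut_apply, diagonal_smul, Matrix.mul_smul, Matrix.smul_mul]
      rfl
  have hdet : IsUnit U.det := (Matrix.isUnit_iff_isUnit_det U).1 hU
  have hconj : ∀ D : Matrix (Fin 3) (Fin 3) ℂ, (U * D * U⁻¹).det = D.det := by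
    intro D
    rw [det_mul, det_mul, mul_right_comm, ← det_mul, Matrix.mul_nonsing_inv _ hdet, det_one,
      one_mul]
  rw [hAd, Matrix.exp_conj _ _ hU, hconj, Matrix.exp_diagonal, det_diagonal, trace_mul_comm,
    ← mul_assoc, Matrix.nonsing_inv_mul _ hdet, one_mul, trace_diagonal, Complex.exp_sum]
  refine Finset.prod_congr rfl fun i _ => ?_
  rw [Pi.coe_exp, Complex.exp_eq_exp_ℂ]

/-- The exponential map `𝔰𝔲(3) → SU(3)`. -/
def expSU (A : su3) : SU3 :=
  ⟨NormedSpace.exp (A : Matrix (Fin 3) (Fin 3) ℂ), by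
    have hA : (A : Matrix (Fin 3) (Fin 3) ℂ)ᴴ = -A := A.2.1
    have htr : (A : Matrix (Fin 3) (Fin 3) ℂ).trace = 0 := A.2.2
    refine Matrix.mem_specialUnitaryGroup_iff.2 ⟨?_, ?_⟩
    · rw [Matrix.mem_unitaryGroup_iff, Matrix.star_eq_conjTranspose, ← Matrix.exp_conjTranspose,
        hA, Matrix.exp_neg]
      exact Matrix.mul_nonsing_inv _
        ((Matrix.isUnit_iff_isUnit_det _).1 (Matrix.isUnit_exp _))
    · rw [det_exp_of_skew hA, htr, Complex.exp_zero]⟩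

section Infinitesimal

variable {H : Type*} [NormedAddCommGroup H] [InnerProductSpace ℂ H]

/-- `w` is the derivative of `t ↦ π(exp(tA)) v` at `t = 0`. -/
def UnitaryRep.HasLieDeriv (π : UnitaryRep SU3 H) (A : su3) (v w : H) : Prop :=
  HasDerivAt (fun t : ℝ => π.toHom (expSU (t • A)) v) w 0

/-- The space of smooth vectors: the largest subspace on which all one-parameter subgroups can be
differentiated arbitrarily often. -/
def UnitaryRep.smoothVectors (π : UnitaryRep SU3 H) : Submodule ℂ H :=
  sSup {W : Submodule ℂ H | ∀ A : su3, ∀ v ∈ W, ∃ w ∈ W, π.HasLieDeriv A v w}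

theorem UnitaryRep.HasLieDeriv.add {π : UnitaryRep SU3 H} {A : su3} {v w v' w' : H}
    (h : π.HasLieDeriv A v w) (h' : π.HasLieDeriv A v' w') :
    π.HasLieDeriv A (v + v') (w + w') := by
  unfold HasLieDeriv at *
  simpa only [map_add] using h.fun_add h'

theorem UnitaryRep.HasLieDeriv.smul {π : UnitaryRep SU3 H} {A : su3} {v w : H} (c : ℂ)
    (h : π.HasLieDeriv A v w) : π.HasLieDeriv A (c • v) (c • w) := by
  unfold HasLieDeriv at *
  simpa only [map_smul] using h.fun_const_smul c

theorem UnitaryRep.exists_hasLieDeriv (π : UnitaryRep SU3 H) (A : su3) {v : H}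
    (hv : v ∈ π.smoothVectors) : ∃ w ∈ π.smoothVectors, π.HasLieDeriv A v w := by
  unfold smoothVectors at hv
  rw [sSup_eq_iSup'] at hv
  induction hv using Submodule.iSup_induction' with
  | mem W v hv =>
    obtain ⟨w, hw, h⟩ := W.2 A v hv
    exact ⟨w, le_sSup W.2 hw, h⟩
  | zero =>
    refine ⟨0, zero_mem _, ?_⟩
    unfold HasLieDeriv
    simpa only [map_zero] using hasDerivAt_const (0 : ℝ) (0 : H)
  | add v v' _ _ ih ih' =>
    obtain ⟨w, hw, h⟩ := ih
    obtain ⟨w', hw', h'⟩ := ih'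
    exact ⟨w + w', add_mem hw hw', h.add h'⟩

/-- `dπ(A)` on smooth vectors, for `A ∈ 𝔰𝔲(3)`. -/
def UnitaryRep.lieAction (π : UnitaryRep SU3 H) (A : su3) : π.smoothVectors →ₗ[ℂ] H where
  toFun v := deriv (fun t : ℝ => π.toHom (expSU (t • A)) (v : H)) 0
  map_add' v v' := by
    obtain ⟨w, -, h⟩ := π.exists_hasLieDeriv A v.2
    obtain ⟨w', -, h'⟩ := π.exists_hasLieDeriv A v'.2
    have h'' := h.add h'
    unfold HasLieDeriv at h h' h''
    rw [h.deriv, h'.deriv, ← h''.deriv]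
    rfl
  map_smul' c v := by
    obtain ⟨w, -, h⟩ := π.exists_hasLieDeriv A v.2
    have h'' := h.smul c
    unfold HasLieDeriv at h h''
    rw [RingHom.id_apply, h.deriv, ← h''.deriv]
    rfl

/-- The element `(Z - Z*)/2` of `𝔰𝔲(3)`, for a traceless matrix `Z`. -/
def skewPart (Z : Matrix (Fin 3) (Fin 3) ℂ) (hZ : Z.trace = 0) : su3 :=
  ⟨(1 / 2 : ℂ) • (Z - Zᴴ), by
    refine ⟨?_, ?_⟩
    · rw [conjTranspose_smul, conjTranspose_sub, conjTranspose_conjTranspose, ← smul_neg, neg_sub]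
      simp
    · rw [trace_smul, trace_sub, trace_conjTranspose, hZ]
      simp⟩

/-- The element `(Z + Z*)/(2i)` of `𝔰𝔲(3)`, so that `Z = skewPart Z + i • skewPart' Z`. -/
def skewPart' (Z : Matrix (Fin 3) (Fin 3) ℂ) (hZ : Z.trace = 0) : su3 :=
  ⟨(-Complex.I / 2 : ℂ) • (Z + Zᴴ), by
    refine ⟨?_, ?_⟩
    · rw [conjTranspose_smul, conjTranspose_add, conjTranspose_conjTranspose, ← neg_smul, add_comm]
      simp [neg_div]
    · rw [trace_smul, trace_add, trace_conjTranspose, hZ]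
      simp⟩

theorem skewPart_add (Z : Matrix (Fin 3) (Fin 3) ℂ) (hZ : Z.trace = 0) :
    (skewPart Z hZ : Matrix (Fin 3) (Fin 3) ℂ) + Complex.I • (skewPart' Z hZ).1 = Z := by
  simp only [skewPart, skewPart', smul_smul]
  have : Complex.I * (-Complex.I / 2) = 1 / 2 := by
    rw [mul_div_assoc', mul_neg, Complex.I_mul_I, neg_neg]
  rw [this, ← smul_add, sub_add_add_cancel, ← two_smul ℂ Z, smul_smul]
  simp

/-- The complexified infinitesimal action of `Z ∈ 𝔰𝔩(3, ℂ) = 𝔰𝔲(3)_ℂ`, as an unbounded operator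
whose domain is the space of smooth vectors. -/
def UnitaryRep.smoothOp (π : UnitaryRep SU3 H) (Z : Matrix (Fin 3) (Fin 3) ℂ)
    (hZ : Z.trace = 0) : H →ₗ.[ℂ] H where
  domain := π.smoothVectors
  toFun := π.lieAction (skewPart Z hZ) + Complex.I • π.lieAction (skewPart' Z hZ)

/-- The unbounded operator on `H` defined by `Z`: the closure of the infinitesimal action on
smooth vectors. -/
def UnitaryRep.closedOp (π : UnitaryRep SU3 H) (Z : Matrix (Fin 3) (Fin 3) ℂ)
    (hZ : Z.trace = 0) : H →ₗ.[ℂ] H :=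
  (π.smoothOp Z hZ).closure

end Infinitesimal

/-- The simple root vectors: `X₁ = E₁₂` and `X₂ = E₂₃`. -/
def rootX (i : Fin 2) : Matrix (Fin 3) (Fin 3) ℂ := Matrix.single i.castSucc i.succ 1

/-- The transposes `Y₁ = E₂₁` and `Y₂ = E₃₂`. -/
def rootY (i : Fin 2) : Matrix (Fin 3) (Fin 3) ℂ := (rootX i)ᵀ

theorem trace_rootX (i : Fin 2) : (rootX i).trace = 0 :=
  Matrix.trace_single_eq_of_ne _ _ _ (Fin.castSucc_lt_succ (i := i)).ne

theorem trace_rootY (i : Fin 2) : (rootY i).trace = 0 := by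
  rw [rootY, Matrix.trace_transpose, trace_rootX]

/-! ### Polar decomposition of an unbounded operator -/

section Polar

variable {H : Type*} [NormedAddCommGroup H] [InnerProductSpace ℂ H]

/-- Composition `g ∘ f` of unbounded operators, with domain `{x ∈ dom f | f x ∈ dom g}`. -/
def pcomp (g f : H →ₗ.[ℂ] H) : H →ₗ.[ℂ] H :=
  g.comp (f.domRestrict ((g.domain.comap f.toFun).map f.domain.subtype)) (by
    rintro ⟨x, ⟨y, hy, hyx⟩, hx⟩
    have : f.domRestrict ((g.domain.comap f.toFun).map f.domain.subtype)
        ⟨x, ⟨y, hy, hyx⟩, hx⟩ = f y := LinearPMap.domRestrict_apply hyx.symm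
    rw [this]
    exact hy)

variable [CompleteSpace H]

/-- `P = |T|`: the positive self-adjoint operator whose square is `T* T`. -/
def IsModulus (T P : H →ₗ.[ℂ] H) : Prop :=
  IsSelfAdjoint P ∧ (∀ x : P.domain, 0 ≤ (inner ℂ (P x) (x : H)).re) ∧
    pcomp P P = pcomp T.adjoint T

/-- `V = Ph T`: the phase in the polar decomposition `T = V |T|` of a closed, densely defined
operator, i.e. the partial isometry `V` with the same kernel as `T` that satisfies this
equation. -/
def IsPhase (T : H →ₗ.[ℂ] H) (V : H →L[ℂ] H) : Prop :=
  T.IsClosed ∧ Dense (T.domain : Set H) ∧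
  (∃ P : H →ₗ.[ℂ] H, IsModulus T P ∧ T = (V : H →ₗ[ℂ] H).compPMap P) ∧
  (∀ v : H, V v = 0 ↔ ∃ x : T.domain, (x : H) = v ∧ T x = 0) ∧
  ∀ v ∈ (LinearMap.ker (V : H →ₗ[ℂ] H))ᗮ, ‖V v‖ = ‖v‖

end Polar

/-- `V` is a two-sided multiplier of `𝒦_S`: compositions of `V` with elements of `𝒦_S` into and out
of its space, from and to any unitary representation of `K`, are again in `𝒦_S`. -/
def IsMultiplier {H : Type u} [NormedAddCommGroup H] [InnerProductSpace ℂ H]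
    [CompleteSpace H] (S : Set (Fin 2)) (π : UnitaryRep SU3 H) (V : H →L[ℂ] H) : Prop :=
  ∀ (H' : Type v) [NormedAddCommGroup H'] [InnerProductSpace ℂ H'] [CompleteSpace H']
    (π' : UnitaryRep SU3 H'),
    (∀ T ∈ opKS S π' π, V ∘L T ∈ opKS S π' π) ∧ (∀ T ∈ opKS S π π', T ∘L V ∈ opKS S π π')

end HarmonicSU3

end

open HarmonicSU3

/-! Averaging rank one operators over the compact group splits `H` into an orthogonal Hilbert sum of
finite-dimensional irreducible blocks. The closed operator of `Z` is the maximal operator acting on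
each block by the Lie algebra action of `Z`. Its phase `V` is therefore the direct sum of the
finite-dimensional phases `Z (Z* Z)^(-1/2)`, and every statement about domains becomes a statement
about graphs tested block by block (`UnitaryRep.closedOp_eq_pmap`, `Blocks.isPhase_pmap`,
`Blocks.eq_of_isPhase_pmap`). Harmonically proper operators multiply harmonically finite ones into
harmonically finite ones, so after passing to closures the multiplier property follows from `V ∈
opAS S π π`.

Let `Z` belong to the root `±α_i`. If `α_i ∈ S`, then `V` commutes with all isotypical projections
of `K_S`. If `S` is empty, then `V` transforms under the torus by a character, so its matrix is
column-finite, and so is that of its adjoint. The substantial case is `S = {α_j}` with `j ≠ i`. By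
`mem_closure_harmonicallyProper` it is enough to approximate `V p_σ` and `V* p_σ`, for each single
type `σ`, by `B p_σ` with `B` column-finite.

The approximants come from the Casimir eigenvalue `κ` of a block. The operators `κ^(-1/2) E_ab` are
contractions, and together they form a finite-dimensional family that is equivariant for the adjoint
action, so they are column-finite for every subgroup. The same holds for `U g(U* U)` with `U =
κ^(-1/2) Z` and `g` a polynomial. If `g(u)` is close to `max(u, δ)^(-1/2)` on `[0, 1]`, this is
close to the phase except on the spectral part `0 < Z* Z < δ κ`, where the error is only bounded.

That part is harmless for two reasons. For `κ < κ₀` it is empty once `δ = 1/κ₀`, because the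
eigenvalues of `Z* Z` are integers by `𝔰𝔩₂` theory (`UnitaryRep.one_le_of_eigen`). For `κ ≥ κ₀`,
vectors of a fixed `K_S`-type carry little mass there (`exists_concentration`). To see this put `X₁
= E_sp`, `X₂ = E_pr`, `X₃ = [X₁, X₂]`, `Y_i = X_i*`, with `X₂` and `Y₂` in the block of `S`, hence
bounded on the type `σ`. On such vectors the Casimir operator gives `κ = 2 Y₁X₁ + 2 Y₃X₃ + O(1)`, so
a vector near the kernel of `X₁` must be carried by `Y₃X₃`. But `X₂` rotates `X₁` into `X₃`. With `R
= (Y₁X₁ + d)⁻¹` and `d = e² κ`, the commutator of `X₂` with `Y₃X₁R` produces `d Y₃X₃R²` up to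
controlled terms, and the expectation of a commutator with `X₂` in a vector of type `σ` is small
compared with the norms involved. This is `mass_estimate`, which gives `‖d R v‖² ≤ (4e² + 4Me +
o(1)) ‖v‖²` as `κ → ∞`. -/

noncomputable section

namespace HarmonicSU3

open Matrix

/-! ### Intertwining operators and isotypical subspaces -/

namespace UnitaryRep

section Intertwines

variable {G : Type*} [Group G] [TopologicalSpace G]
variable {H : Type*} [NormedAddCommGroup H] [InnerProductSpace ℂ H]
variable {H' : Type*} [NormedAddCommGroup H'] [InnerProductSpace ℂ H']
variable {H'' : Type*} [NormedAddCommGroup H''] [InnerProductSpace ℂ H'']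

theorem toHom_mul_apply (π : UnitaryRep G H) (g h : G) (v : H) :
    π.toHom (g * h) v = π.toHom g (π.toHom h v) := by
  rw [map_mul]; rfl

theorem toHom_one_apply (π : UnitaryRep G H) (v : H) : π.toHom 1 v = v := by
  rw [map_one]; rfl

theorem toHom_inv_apply_self (π : UnitaryRep G H) (g : G) (v : H) :
    π.toHom g⁻¹ (π.toHom g v) = v := by
  rw [← toHom_mul_apply, inv_mul_cancel, toHom_one_apply]

theorem toHom_self_inv_apply (π : UnitaryRep G H) (g : G) (v : H) :
    π.toHom g (π.toHom g⁻¹ v) = v := by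
  rw [← toHom_mul_apply, mul_inv_cancel, toHom_one_apply]

theorem inner_toHom_left (π : UnitaryRep G H) (g : G) (v w : H) :
    inner ℂ (π.toHom g v) w = inner ℂ v (π.toHom g⁻¹ w) := by
  rw [← (π.toHom g).inner_map_map v, toHom_self_inv_apply]

theorem inner_toHom_right (π : UnitaryRep G H) (g : G) (v w : H) :
    inner ℂ v (π.toHom g w) = inner ℂ (π.toHom g⁻¹ v) w := by
  rw [inner_toHom_left, inv_inv]

/-- The operator `T` intertwines `π` and `π'`. -/
def Intertwines (π : UnitaryRep G H) (π' : UnitaryRep G H') (T : H →L[ℂ] H') : Prop :=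
  ∀ g x, T (π.toHom g x) = π'.toHom g (T x)

theorem Intertwines.comp {π : UnitaryRep G H} {π' : UnitaryRep G H'} {π'' : UnitaryRep G H''}
    {S : H' →L[ℂ] H''} {T : H →L[ℂ] H'} (hS : Intertwines π' π'' S) (hT : Intertwines π π' T) :
    Intertwines π π'' (S ∘L T) := fun g x => by
  rw [ContinuousLinearMap.comp_apply, hT, hS]; rfl

theorem Intertwines.adjoint [CompleteSpace H] [CompleteSpace H'] {π : UnitaryRep G H}
    {π' : UnitaryRep G H'} {T : H →L[ℂ] H'} (hT : Intertwines π π' T) :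
    Intertwines π' π (ContinuousLinearMap.adjoint T) := fun g x => by
  refine ext_inner_left ℂ fun y => ?_
  rw [ContinuousLinearMap.adjoint_inner_right, inner_toHom_right, inner_toHom_right, ← hT,
    ContinuousLinearMap.adjoint_inner_right]

/-- A subspace invariant under the group. -/
def IsInvariant (π : UnitaryRep G H) (W : Submodule ℂ H) : Prop :=
  ∀ g, ∀ v ∈ W, π.toHom g v ∈ W

theorem IsInvariant.orthogonal {π : UnitaryRep G H} {W : Submodule ℂ H} (hW : π.IsInvariant W) :
    π.IsInvariant Wᗮ := fun g v hv => by
  rw [Submodule.mem_orthogonal] at hv ⊢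
  intro u hu
  rw [inner_toHom_right]
  exact hv _ (hW _ _ hu)

theorem IsInvariant.inf {π : UnitaryRep G H} {W W' : Submodule ℂ H} (hW : π.IsInvariant W)
    (hW' : π.IsInvariant W') : π.IsInvariant (W ⊓ W') := fun g v hv =>
  ⟨hW g v hv.1, hW' g v hv.2⟩

theorem IsInvariant.restrict {π : UnitaryRep G H} {W : Submodule ℂ H} (hW : π.IsInvariant W)
    (L : Subgroup G) : (π.restrict L).IsInvariant W := fun g v hv => hW g v hv

/-- The subrepresentation on an invariant subspace. -/
def sub (π : UnitaryRep G H) (W : Submodule ℂ H) (hW : π.IsInvariant W) : UnitaryRep G W where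
  toHom :=
    { toFun := fun g =>
        { toFun := fun v => ⟨π.toHom g v, hW g v v.2⟩
          invFun := fun v => ⟨π.toHom g⁻¹ v, hW g⁻¹ v v.2⟩
          left_inv := fun v => Subtype.ext (π.toHom_inv_apply_self g v)
          right_inv := fun v => Subtype.ext (π.toHom_self_inv_apply g v)
          map_add' := fun v w => Subtype.ext (by simp)
          map_smul' := fun c v => Subtype.ext (by simp)
          norm_map' := fun v => by simp }
      map_one' := by ext v; simp
      map_mul' := fun g h => by ext v; simp }
  continuous_orbit v := by
    rw [continuous_induced_rng]
    exact π.continuous_orbit v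

theorem Intertwines.starProjection {π : UnitaryRep G H} {W : Submodule ℂ H}
    [W.HasOrthogonalProjection] (hW : π.IsInvariant W) : Intertwines π π W.starProjection := by
  intro g x
  apply Submodule.eq_starProjection_of_mem_orthogonal
  · exact hW _ _ (Submodule.starProjection_apply_mem _ _)
  · rw [← map_sub]
    exact hW.orthogonal _ _ (Submodule.sub_starProjection_mem_orthogonal _)

theorem Intertwines.map_isotypic {π : UnitaryRep G H} {π' : UnitaryRep G H'} {T : H →L[ℂ] H'}
    (hT : Intertwines π π' T) {σ : Types G} {x : H} (hx : x ∈ π.isotypic σ) :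
    T x ∈ π'.isotypic σ := by
  have hle : π.isotypic σ ≤ (π'.isotypic σ).comap (T : H →ₗ[ℂ] H') := by
    refine Submodule.topologicalClosure_minimal _ ?_ ?_
    · rw [Submodule.span_le]
      rintro _ ⟨ρ, hρ, A, hA, y, rfl⟩
      refine Submodule.le_topologicalClosure _ (Submodule.subset_span ?_)
      exact ⟨ρ, hρ, T ∘L A, fun g x => by simp [hA, hT g], y, rfl⟩
    · exact (Submodule.isClosed_topologicalClosure _).preimage T.continuous
  exact hle hx

theorem isInvariant_isotypic (π : UnitaryRep G H) (σ : Types G) : π.IsInvariant (π.isotypic σ) := by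
  intro g
  have hle : π.isotypic σ ≤
      (π.isotypic σ).comap ((π.toHom g).toContinuousLinearEquiv : H →L[ℂ] H).toLinearMap := by
    refine Submodule.topologicalClosure_minimal _ ?_ ?_
    · rw [Submodule.span_le]
      rintro _ ⟨ρ, hρ, A, hA, y, rfl⟩
      refine Submodule.le_topologicalClosure _ (Submodule.subset_span ?_)
      exact ⟨ρ, hρ, A, hA, _, hA g y⟩
    · exact (Submodule.isClosed_topologicalClosure _).preimage
        ((π.toHom g).toContinuousLinearEquiv : H →L[ℂ] H).continuous
  exact hle

/-- A continuous linear map vanishing on the image of every intertwiner from a representation of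
class `σ` vanishes on the isotypical subspace. -/
theorem eq_zero_of_mem_isotypic {E : Type*} [NormedAddCommGroup E] [NormedSpace ℂ E]
    {π : UnitaryRep G H} {σ : Types G} (f : H →L[ℂ] E)
    (hf : ∀ (ρ : ConcreteIrrep G), Quotient.mk (irrepSetoid G) ρ = σ →
      ∀ T : EuclideanSpace ℂ (Fin ρ.1) →L[ℂ] H, Intertwines ρ.2.1 π T → ∀ x, f (T x) = 0)
    {v : H} (hv : v ∈ π.isotypic σ) : f v = 0 := by
  have hle : π.isotypic σ ≤ LinearMap.ker (f : H →ₗ[ℂ] E) := by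
    refine Submodule.topologicalClosure_minimal _ ?_ (ContinuousLinearMap.isClosed_ker f)
    rw [Submodule.span_le]
    rintro _ ⟨ρ, hρ, A, hA, y, rfl⟩
    exact hf ρ hρ A hA y
  exact hle hv

/-- A nonzero intertwiner between irreducible representations is a multiple of a unitary. -/
theorem equiv_of_intertwines_ne_zero {ρ₁ ρ₂ : ConcreteIrrep G}
    {T : EuclideanSpace ℂ (Fin ρ₁.1) →L[ℂ] EuclideanSpace ℂ (Fin ρ₂.1)}
    (hT : Intertwines ρ₁.2.1 ρ₂.2.1 T) (h0 : T ≠ 0) :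
    Quotient.mk (irrepSetoid G) ρ₁ = Quotient.mk (irrepSetoid G) ρ₂ := by
  have := ρ₁.2.2
  have := ρ₂.2.2
  let f : Representation.IntertwiningMap ρ₁.2.1.toRepresentation ρ₂.2.1.toRepresentation :=
    LinearMap.intertwiningMap_of_isIntertwiningMap _ _ T.toLinearMap fun g v => hT g v
  have hbij : Function.Bijective T := by
    refine (Representation.IsIrreducible.bijective_or_eq_zero f).resolve_right fun h => h0 ?_
    ext1 x
    exact congrArg (fun k : Representation.IntertwiningMap _ _ => k x) h
  -- Schur's lemma makes `T* T` a scalar `c`. Then `c = r²` with `r` the common dilation factor of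
  -- `T`, and `r⁻¹ T` is the unitary equivalence.
  let S := ContinuousLinearMap.adjoint T ∘L T
  have hS : Intertwines ρ₁.2.1 ρ₁.2.1 S := hT.adjoint.comp hT
  let s : Representation.IntertwiningMap ρ₁.2.1.toRepresentation ρ₁.2.1.toRepresentation :=
    LinearMap.intertwiningMap_of_isIntertwiningMap _ _ S.toLinearMap fun g v => hS g v
  obtain ⟨c, hc⟩ := (Representation.IsIrreducible.algebraMap_intertwiningMap_bijective_of_isAlgClosed
    (ρ := ρ₁.2.1.toRepresentation)).2 s
  have hSc : ∀ x, S x = c • x := fun x => by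
    have := congrArg (fun k : Representation.IntertwiningMap _ _ => k x) hc
    exact this.symm
  have hnorm : ∀ x, ((‖T x‖ ^ 2 : ℝ) : ℂ) = c * (‖x‖ ^ 2 : ℝ) := fun x => by
    have h1 : inner ℂ x (S x) = inner ℂ (T x) (T x) :=
      ContinuousLinearMap.adjoint_inner_right T x (T x)
    rw [hSc, inner_smul_right, inner_self_eq_norm_sq_to_K, inner_self_eq_norm_sq_to_K] at h1
    push_cast
    exact h1.symm
  obtain ⟨x, hx⟩ : ∃ x, T x ≠ 0 := by
    by_contra! h
    exact h0 (ContinuousLinearMap.ext h)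
  have hx0 : x ≠ 0 := fun h => hx (by simp [h])
  have hxn : 0 < ‖x‖ := norm_pos_iff.2 hx0
  set r : ℝ := ‖T x‖ / ‖x‖ with hr
  have hrpos : 0 < r := div_pos (norm_pos_iff.2 hx) hxn
  have hcr : c = (r ^ 2 : ℝ) := by
    have := hnorm x
    rw [hr, div_pow]
    push_cast at this ⊢
    rw [this]
    have : (‖x‖ : ℂ) ≠ 0 := by exact_mod_cast hxn.ne'
    field_simp
  have hTr : ∀ y, ‖T y‖ = r * ‖y‖ := fun y => by
    have := hnorm y
    rw [hcr] at this
    have h2 : ‖T y‖ ^ 2 = (r * ‖y‖) ^ 2 := by rw [mul_pow]; exact_mod_cast this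
    exact (pow_left_inj₀ (norm_nonneg _) (by positivity) two_ne_zero).1 h2
  have hrC : (r : ℂ) ≠ 0 := by exact_mod_cast hrpos.ne'
  let U₀ : EuclideanSpace ℂ (Fin ρ₁.1) →ₗᵢ[ℂ] EuclideanSpace ℂ (Fin ρ₂.1) :=
    ⟨((r : ℂ)⁻¹ • T : _ →L[ℂ] _), fun y => by
      change ‖(r : ℂ)⁻¹ • T y‖ = ‖y‖
      rw [norm_smul, norm_inv, Complex.norm_real, hTr, Real.norm_of_nonneg hrpos.le,
        inv_mul_cancel_left₀ hrpos.ne']⟩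
  have hU₀ : ∀ y, U₀ y = (r : ℂ)⁻¹ • T y := fun _ => rfl
  have hsurj : Function.Surjective U₀ := fun z => by
    obtain ⟨y, hy⟩ := hbij.2 ((r : ℂ) • z)
    exact ⟨y, by rw [hU₀, hy, smul_smul, inv_mul_cancel₀ hrC, one_smul]⟩
  refine Quotient.sound ⟨LinearIsometryEquiv.ofSurjective U₀ hsurj, fun g y => ?_⟩
  change U₀ _ = ρ₂.2.1.toHom g (U₀ y)
  rw [hU₀, hU₀, hT g, map_smul]

end Intertwines

/-! ### Isotypical projections and their orthogonality. -/

section Proj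

variable {G : Type*} [Group G] [TopologicalSpace G]
variable {H : Type*} [NormedAddCommGroup H] [InnerProductSpace ℂ H] [CompleteSpace H]
variable {H' : Type*} [NormedAddCommGroup H'] [InnerProductSpace ℂ H'] [CompleteSpace H']

theorem completeSpace_isotypic (π : UnitaryRep G H) (σ : Types G) :
    CompleteSpace (π.isotypic σ) :=
  (Submodule.isClosed_topologicalClosure _).completeSpace_coe

theorem proj_mem (π : UnitaryRep G H) (σ : Types G) (x : H) : π.proj σ x ∈ π.isotypic σ :=
  haveI := π.completeSpace_isotypic σ
  Submodule.starProjection_apply_mem _ _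

theorem proj_apply_of_mem (π : UnitaryRep G H) {σ : Types G} {x : H} (hx : x ∈ π.isotypic σ) :
    π.proj σ x = x :=
  haveI := π.completeSpace_isotypic σ
  Submodule.starProjection_eq_self_iff.2 hx

theorem proj_apply_of_mem_orthogonal (π : UnitaryRep G H) {σ : Types G} {x : H}
    (hx : x ∈ (π.isotypic σ)ᗮ) : π.proj σ x = 0 :=
  haveI := π.completeSpace_isotypic σ
  (Submodule.starProjection_apply_eq_zero_iff _).2 hx

theorem adjoint_proj (π : UnitaryRep G H) (σ : Types G) :
    ContinuousLinearMap.adjoint (π.proj σ) = π.proj σ :=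
  haveI := π.completeSpace_isotypic σ
  (isSelfAdjoint_starProjection (π.isotypic σ)).adjoint_eq

theorem proj_comp_self (π : UnitaryRep G H) (σ : Types G) : π.proj σ ∘L π.proj σ = π.proj σ := by
  ext x
  exact π.proj_apply_of_mem (π.proj_mem σ x)

theorem norm_proj_apply_le (π : UnitaryRep G H) (σ : Types G) (x : H) : ‖π.proj σ x‖ ≤ ‖x‖ :=
  haveI := π.completeSpace_isotypic σ
  Submodule.norm_starProjection_apply_le _ _

theorem intertwines_proj (π : UnitaryRep G H) (σ : Types G) : Intertwines π π (π.proj σ) :=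
  haveI := π.completeSpace_isotypic σ
  Intertwines.starProjection (π.isInvariant_isotypic σ)

/-- For intertwiners `T`, `T'` from irreducibles of classes `σ`, `τ`, the composite `T'* T`
intertwines two irreducibles, so it vanishes unless the classes agree. -/
theorem isotypic_le_orthogonal (π : UnitaryRep G H) {σ τ : Types G} (h : σ ≠ τ) :
    π.isotypic σ ≤ (π.isotypic τ)ᗮ := by
  intro v hv
  rw [Submodule.mem_orthogonal]
  intro w hw
  refine eq_zero_of_mem_isotypic (innerSL ℂ w) (fun ρ hρ T hT x => ?_) hv
  rw [innerSL_apply_apply, ← inner_conj_symm, map_eq_zero]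
  refine eq_zero_of_mem_isotypic (innerSL ℂ (T x)) (fun ρ' hρ' T' hT' y => ?_) hw
  rw [innerSL_apply_apply, ← ContinuousLinearMap.adjoint_inner_left]
  by_contra hne
  refine h ?_
  rw [← hρ, ← hρ']
  refine equiv_of_intertwines_ne_zero (hT'.adjoint.comp hT) fun h0 => hne ?_
  have := congrArg (fun k => k x) h0
  rw [show ContinuousLinearMap.adjoint T' (T x) = 0 from this, inner_zero_left]

theorem proj_apply_of_mem_ne (π : UnitaryRep G H) {σ τ : Types G} (h : σ ≠ τ) {x : H}
    (hx : x ∈ π.isotypic τ) : π.proj σ x = 0 :=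
  π.proj_apply_of_mem_orthogonal (π.isotypic_le_orthogonal h.symm hx)

theorem proj_comp_proj_of_ne (π : UnitaryRep G H) {σ τ : Types G} (h : σ ≠ τ) :
    π.proj σ ∘L π.proj τ = 0 := by
  ext x
  exact π.proj_apply_of_mem_ne h (π.proj_mem τ x)

/-- Intertwiners commute with the isotypical projections. -/
theorem Intertwines.proj_comm {π : UnitaryRep G H} {π' : UnitaryRep G H'} {T : H →L[ℂ] H'}
    (hT : Intertwines π π' T) (σ : Types G) (x : H) : T (π.proj σ x) = π'.proj σ (T x) := by
  have := π'.completeSpace_isotypic σ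
  have := π.completeSpace_isotypic σ
  symm
  refine Submodule.eq_starProjection_of_mem_orthogonal (K := π'.isotypic σ)
    (hT.map_isotypic (π.proj_mem σ x)) ?_
  rw [← map_sub, Submodule.mem_orthogonal]
  intro u hu
  rw [← ContinuousLinearMap.adjoint_inner_left]
  exact (Submodule.mem_orthogonal _ _).1
    (Submodule.sub_starProjection_mem_orthogonal (K := π.isotypic σ) x) _
      (hT.adjoint.map_isotypic hu)

end Proj

end UnitaryRep

end HarmonicSU3
end

noncomputable section

namespace HarmonicSU3

open Matrix

/-! ### Finite-dimensional invariant subspaces -/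

namespace UnitaryRep

section FiniteDimensional

variable {G : Type*} [Group G] [TopologicalSpace G]
variable {H : Type*} [NormedAddCommGroup H] [InnerProductSpace ℂ H]
variable {H' : Type*} [NormedAddCommGroup H'] [InnerProductSpace ℂ H']

/-- Transport of a representation along a unitary. -/
def transport (π : UnitaryRep G H) (e : H ≃ₗᵢ[ℂ] H') : UnitaryRep G H' where
  toHom :=
    { toFun := fun g => e.symm.trans ((π.toHom g).trans e)
      map_one' := by ext v; simp
      map_mul' := fun g h => by ext v; simp }
  continuous_orbit v := e.continuous.comp (π.continuous_orbit (e.symm v))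

/-- A minimal nonzero invariant subspace. -/
structure IsMinimalInvariant (π : UnitaryRep G H) (U : Submodule ℂ H) : Prop where
  ne_bot : U ≠ ⊥
  invariant : π.IsInvariant U
  eq_of_le : ∀ U' ≤ U, π.IsInvariant U' → U' ≠ ⊥ → U' = U

theorem exists_isMinimalInvariant (π : UnitaryRep G H) {W : Submodule ℂ H}
    [FiniteDimensional ℂ W] (hW : π.IsInvariant W) (h0 : W ≠ ⊥) :
    ∃ U ≤ W, π.IsMinimalInvariant U := by
  classical
  have hex : ∃ n, ∃ U ≤ W, π.IsInvariant U ∧ U ≠ ⊥ ∧ Module.finrank ℂ U = n :=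
    ⟨_, W, le_rfl, hW, h0, rfl⟩
  obtain ⟨U, hUW, hU, hU0, hn⟩ := Nat.find_spec hex
  refine ⟨U, hUW, hU0, hU, fun U' hle hU' hU'0 => ?_⟩
  have : FiniteDimensional ℂ U := Submodule.finiteDimensional_of_le hUW
  refine Submodule.eq_of_le_of_finrank_le hle ?_
  rw [hn]
  exact Nat.find_min' hex ⟨U', hle.trans hUW, hU', hU'0, rfl⟩

/-- Types are classes of representations on some `ℂⁿ`, so an orthonormal basis of `U` is used to
transport the action to coordinates. Minimality of `U` becomes irreducibility there, and the
inclusion of `U` is the required intertwiner. -/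
theorem IsMinimalInvariant.exists_le_isotypic {π : UnitaryRep G H} {U : Submodule ℂ H}
    [FiniteDimensional ℂ U] (hU : π.IsMinimalInvariant U) : ∃ σ, U ≤ π.isotypic σ := by
  let e : U ≃ₗᵢ[ℂ] EuclideanSpace ℂ (Fin (Module.finrank ℂ U)) := (stdOrthonormalBasis ℂ U).repr
  let ρ := (π.sub U hU.invariant).transport e
  let j : EuclideanSpace ℂ (Fin (Module.finrank ℂ U)) →L[ℂ] H :=
    U.subtypeL ∘L (e.symm.toContinuousLinearEquiv : _ →L[ℂ] _)
  have hj : Intertwines ρ π j := fun g x => by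
    change ((e.symm (e ((π.sub U hU.invariant).toHom g (e.symm x))) : U) : H) = _
    rw [LinearIsometryEquiv.symm_apply_apply]
    rfl
  have hjinj : Function.Injective j := fun x y h =>
    e.symm.injective (Subtype.ext h)
  have hjrange : ∀ v ∈ U, ∃ x, j x = v := fun v hv => ⟨e ⟨v, hv⟩, by
    change ((e.symm (e ⟨v, hv⟩) : U) : H) = v
    rw [LinearIsometryEquiv.symm_apply_apply]⟩
  have hirr : ρ.toRepresentation.IsIrreducible := by
    have hnt : Nontrivial (Subrepresentation ρ.toRepresentation) := by
      refine ⟨⟨⊥, ⊤, fun h => hU.ne_bot ?_⟩⟩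
      rw [Submodule.eq_bot_iff]
      intro v hv
      obtain ⟨x, rfl⟩ := hjrange v hv
      have hx : x ∈ (⊤ : Subrepresentation ρ.toRepresentation).toSubmodule := trivial
      rw [← h] at hx
      have hx0 : x = 0 := hx
      rw [hx0, map_zero]
    refine { hnt with eq_bot_or_eq_top := fun P => ?_ }
    by_cases hP : P.toSubmodule.map j.toLinearMap = ⊥
    · left
      apply Subrepresentation.toSubmodule_injective
      refine (Submodule.eq_bot_iff _).2 fun x hx => hjinj ?_
      rw [map_zero]
      exact (Submodule.eq_bot_iff _).1 hP _ ⟨x, hx, rfl⟩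
    · right
      have := hU.eq_of_le (P.toSubmodule.map j.toLinearMap) (by
        rintro _ ⟨x, -, rfl⟩
        exact (e.symm x).2) (by
        rintro g _ ⟨x, hx, rfl⟩
        exact ⟨ρ.toHom g x, P.apply_mem_toSubmodule g hx, hj g x⟩) hP
      apply Subrepresentation.toSubmodule_injective
      refine (Submodule.eq_top_iff').2 fun x => ?_
      have hx : j x ∈ P.toSubmodule.map j.toLinearMap := by
        rw [this]; exact (e.symm x).2
      obtain ⟨y, hy, hyx⟩ := hx
      rwa [← hjinj hyx]
  refine ⟨Quotient.mk (irrepSetoid G) ⟨_, ρ, hirr⟩, fun v hv => ?_⟩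
  obtain ⟨x, rfl⟩ := hjrange v hv
  exact Submodule.le_topologicalClosure _ (Submodule.subset_span ⟨_, rfl, j, hj, x, rfl⟩)

/-- A finite-dimensional invariant subspace meets only finitely many types. -/
theorem exists_finset_types (π : UnitaryRep G H) (W : Submodule ℂ H) [FiniteDimensional ℂ W]
    (hW : π.IsInvariant W) : ∃ F : Finset (Types G), W ≤ ⨆ σ ∈ F, π.isotypic σ := by
  classical
  induction hn : Module.finrank ℂ W using Nat.strong_induction_on generalizing W with
  | _ n ih =>
  by_cases h0 : W = ⊥
  · exact ⟨∅, by simp [h0]⟩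
  obtain ⟨U, hUW, hU⟩ := π.exists_isMinimalInvariant hW h0
  have hUfd : FiniteDimensional ℂ U := Submodule.finiteDimensional_of_le hUW
  obtain ⟨σ, hσ⟩ := hU.exists_le_isotypic
  have hlt : Uᗮ ⊓ W < W := by
    refine lt_of_le_of_ne inf_le_right fun h => hU.ne_bot ?_
    rw [Submodule.eq_bot_iff]
    intro v hv
    have hv' : v ∈ Uᗮ ⊓ W := by rw [h]; exact hUW hv
    exact inner_self_eq_zero.1 ((Submodule.mem_orthogonal _ _).1 hv'.1 v hv)
  have hfd : FiniteDimensional ℂ (Uᗮ ⊓ W : Submodule ℂ H) :=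
    Submodule.finiteDimensional_of_le inf_le_right
  obtain ⟨F, hF⟩ := ih _ (hn ▸ Submodule.finrank_lt_finrank_of_lt hlt) (Uᗮ ⊓ W)
    (hU.invariant.orthogonal.inf hW) rfl
  refine ⟨insert σ F, ?_⟩
  rw [← Submodule.sup_orthogonal_inf_of_hasOrthogonalProjection hUW, Finset.iSup_insert]
  exact sup_le_sup hσ hF

/-- The tensor product of two unitary representations. -/
def tensor (π : UnitaryRep G H) (π' : UnitaryRep G H') :
    UnitaryRep G (TensorProduct ℂ H H') where
  toHom :=
    { toFun := fun g => TensorProduct.congrIsometry (π.toHom g) (π'.toHom g)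
      map_one' := by
        ext x
        induction x using TensorProduct.induction_on with
        | zero => simp
        | tmul x y => simp; rfl
        | add x y hx hy => rw [map_add, hx, hy, map_add]
      map_mul' := fun g h => by
        ext x
        induction x using TensorProduct.induction_on with
        | zero => simp
        | tmul x y => simp; rfl
        | add x y hx hy => rw [map_add, hx, hy, map_add] }
  continuous_orbit v := by
    change Continuous fun g => TensorProduct.congrIsometry (π.toHom g) (π'.toHom g) v
    induction v using TensorProduct.induction_on with
    | zero => simpa using continuous_const
    | tmul x y =>
      have h1 := π.continuous_orbit x
      have h2 := π'.continuous_orbit y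
      simp only [TensorProduct.congrIsometry_apply, TensorProduct.congr_tmul]
      exact TensorProduct.continuous_tmul.comp (h1.prodMk h2)
    | add x y hx hy =>
      simp only [map_add]
      exact hx.add hy

theorem tensor_tmul (π : UnitaryRep G H) (π' : UnitaryRep G H') (g : G) (x : H) (y : H') :
    (π.tensor π').toHom g (x ⊗ₜ y) = π.toHom g x ⊗ₜ π'.toHom g y := by
  change TensorProduct.congrIsometry (π.toHom g) (π'.toHom g) (x ⊗ₜ y) = _
  simp

end FiniteDimensional

/-! ### Density of the isotypical subspaces. -/

section Columns

variable {G : Type*} [Group G] [TopologicalSpace G]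
variable {H : Type*} [NormedAddCommGroup H] [InnerProductSpace ℂ H] [CompleteSpace H]
variable {H' : Type*} [NormedAddCommGroup H'] [InnerProductSpace ℂ H'] [CompleteSpace H']
variable {H'' : Type*} [NormedAddCommGroup H''] [InnerProductSpace ℂ H''] [CompleteSpace H'']

/-- The isotypical subspaces span a dense subspace. -/
def IsComplete (π : UnitaryRep G H) : Prop := ∀ x, (∀ σ, π.proj σ x = 0) → x = 0

theorem proj_eq_zero_of_mem_iSup (π : UnitaryRep G H) {F : Finset (Types G)} {σ : Types G}
    (hσ : σ ∉ F) {x : H} (hx : x ∈ ⨆ τ ∈ F, π.isotypic τ) : π.proj σ x = 0 := by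
  have hle : ⨆ τ ∈ F, π.isotypic τ ≤ LinearMap.ker (π.proj σ : H →ₗ[ℂ] H) := by
    refine iSup₂_le fun τ hτ y hy => ?_
    exact π.proj_apply_of_mem_ne (fun h : σ = τ => hσ (h ▸ hτ)) hy
  exact hle hx

/-- Each `W i` lies in a finite sum of isotypical subspaces, so a vector with no isotypical
component is orthogonal to all the `W i`. -/
theorem isComplete_of_forall_finiteDimensional (π : UnitaryRep G H) {ι : Type*}
    (W : ι → Submodule ℂ H) [∀ i, FiniteDimensional ℂ (W i)] (hW : ∀ i, π.IsInvariant (W i))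
    (hd : (⨆ i, W i)ᗮ = ⊥) : π.IsComplete := by
  intro x hx
  have : x ∈ (⨆ i, W i)ᗮ := by
    rw [Submodule.mem_orthogonal]
    intro u hu
    have hle : ⨆ i, W i ≤ (ℂ ∙ x)ᗮ := by
      refine iSup_le fun i => ?_
      obtain ⟨F, hF⟩ := π.exists_finset_types (W i) (hW i)
      refine hF.trans (iSup₂_le fun σ _ y hy => ?_)
      rw [Submodule.mem_orthogonal_singleton_iff_inner_right, ← π.proj_apply_of_mem hy,
        ← ContinuousLinearMap.adjoint_inner_left, π.adjoint_proj, hx, inner_zero_left]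
    exact Submodule.mem_orthogonal_singleton_iff_inner_left.1 (hle hu)
  rw [hd] at this
  exact this

theorem proj_eq_zero_of_inner_eq_zero (π : UnitaryRep G H) {σ : Types G} {x : H}
    (hx : inner ℂ (π.proj σ x) x = 0) : π.proj σ x = 0 := by
  have h : inner ℂ (π.proj σ x) (π.proj σ x) = inner ℂ (π.proj σ x) x := by
    rw [← ContinuousLinearMap.adjoint_inner_left, π.adjoint_proj,
      π.proj_apply_of_mem (π.proj_mem σ x)]
  exact inner_self_eq_zero.1 (h.trans hx)

/-- A continuous linear map that does not vanish at `y` does not vanish at some isotypical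
component of `y`. -/
theorem IsComplete.exists_proj_ne_zero {π : UnitaryRep G H} (hπ : π.IsComplete) {E : Type*}
    [NormedAddCommGroup E] [NormedSpace ℂ E] (f : H →L[ℂ] E) {y : H} (hy : f y ≠ 0) :
    ∃ σ, f (π.proj σ y) ≠ 0 := by
  by_contra! h
  -- No expansion of `y` as a sum over types is needed: it suffices that `y` lies in the closed span
  -- `K` of its own isotypical components, on which `f` vanishes.
  obtain ⟨K, hK⟩ : ∃ K : Submodule ℂ H,
    K = (Submodule.span ℂ (Set.range fun σ => π.proj σ y)).topologicalClosure := ⟨_, rfl⟩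
  have hKc : IsClosed (K : Set H) := hK ▸ Submodule.isClosed_topologicalClosure _
  have : CompleteSpace K := hKc.completeSpace_coe
  have hmem : ∀ σ, π.proj σ y ∈ K := fun σ =>
    hK ▸ Submodule.le_topologicalClosure _ (Submodule.subset_span ⟨σ, rfl⟩)
  have hKf : K ≤ LinearMap.ker (f : H →ₗ[ℂ] E) := by
    rw [hK]
    refine Submodule.topologicalClosure_minimal _ ?_ (ContinuousLinearMap.isClosed_ker f)
    rw [Submodule.span_le]
    rintro _ ⟨σ, rfl⟩
    exact h σ
  have hKmap : ∀ P : H →L[ℂ] H, (∀ τ, P (π.proj τ y) ∈ K) → ∀ x ∈ K, P x ∈ K := fun P hP => by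
    have hle : K ≤ K.comap (P : H →ₗ[ℂ] H) := by
      conv_lhs => rw [hK]
      refine Submodule.topologicalClosure_minimal _ ?_ (hKc.preimage P.continuous)
      rw [Submodule.span_le]
      rintro _ ⟨τ, rfl⟩
      exact hP τ
    exact hle
  have hKinv : ∀ σ, ∀ x ∈ K, π.proj σ x ∈ K := fun σ => by
    refine hKmap _ fun τ => ?_
    by_cases hστ : σ = τ
    · subst hστ
      rw [π.proj_apply_of_mem (π.proj_mem σ y)]
      exact hmem σ
    · rw [π.proj_apply_of_mem_ne hστ (π.proj_mem τ y)]
      exact K.zero_mem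
  -- `K` is stable under every `π.proj σ`, so each component of `y - P_K y` lies in `K` while `y -
  -- P_K y` is orthogonal to `K`. All components vanish, and completeness applies.
  have hz : y - K.starProjection y = 0 := by
    refine hπ _ fun σ => ?_
    have h1 : π.proj σ (y - K.starProjection y) ∈ K := by
      rw [map_sub]
      exact K.sub_mem (hmem σ) (hKinv σ _ (Submodule.starProjection_apply_mem _ _))
    have h2 := (Submodule.mem_orthogonal _ _).1
      (Submodule.sub_starProjection_mem_orthogonal (K := K) y) _ h1
    exact π.proj_eq_zero_of_inner_eq_zero h2
  have hyK : y ∈ K := by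
    rw [sub_eq_zero.1 hz]
    exact Submodule.starProjection_apply_mem _ _
  exact hy (hKf hyK)

end Columns

end UnitaryRep

/-! ### Column-finite matrices and the multiplier property. -/

section Columns

variable {G : Type*} [Group G] [TopologicalSpace G]
variable {H : Type*} [NormedAddCommGroup H] [InnerProductSpace ℂ H] [CompleteSpace H]
variable {H' : Type*} [NormedAddCommGroup H'] [InnerProductSpace ℂ H'] [CompleteSpace H']
variable {H'' : Type*} [NormedAddCommGroup H''] [InnerProductSpace ℂ H''] [CompleteSpace H'']
variable {π : UnitaryRep G H} {π' : UnitaryRep G H'} {π'' : UnitaryRep G H''}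

open UnitaryRep ContinuousLinearMap

theorem matrixEntry_apply (A : H →L[ℂ] H') (σ' σ : Types G) (x : H) :
    matrixEntry π π' A σ' σ x = π'.proj σ' (A (π.proj σ x)) := rfl

theorem adjoint_matrixEntry (A : H →L[ℂ] H') (σ' σ : Types G) :
    adjoint (matrixEntry π π' A σ' σ) = matrixEntry π' π (adjoint A) σ σ' := by
  rw [matrixEntry, matrixEntry, adjoint_comp, adjoint_comp, adjoint_proj, adjoint_proj, comp_assoc]

/-- The matrix of `A` is column-finite. -/
def ColumnFinite (π : UnitaryRep G H) (π' : UnitaryRep G H') (A : H →L[ℂ] H') : Prop :=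
  ∀ σ : Types G, {σ' : Types G | matrixEntry π π' A σ' σ ≠ 0}.Finite

/-- Rows of `A` are columns of its adjoint, so all finiteness arguments can be made for columns
only. -/
theorem harmonicallyProper_iff {A : H →L[ℂ] H'} :
    HarmonicallyProper π π' A ↔ ColumnFinite π π' A ∧ ColumnFinite π' π (adjoint A) := by
  have h : ∀ σ σ', matrixEntry π' π (adjoint A) σ' σ ≠ 0 ↔ matrixEntry π π' A σ σ' ≠ 0 := by
    intro σ σ'
    rw [← adjoint_matrixEntry, ne_eq, map_eq_zero_iff _ (LinearIsometryEquiv.injective _)]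
  simp only [HarmonicallyProper, ColumnFinite, h, Set.ofPred_or, Set.finite_union, forall_and]

theorem HarmonicallyProper.columnFinite {A : H →L[ℂ] H'} (hA : HarmonicallyProper π π' A) :
    ColumnFinite π π' A := (harmonicallyProper_iff.1 hA).1

theorem HarmonicallyProper.adjoint {A : H →L[ℂ] H'} (hA : HarmonicallyProper π π' A) :
    HarmonicallyProper π' π (adjoint A) := by
  rw [harmonicallyProper_iff] at hA ⊢
  rw [adjoint_adjoint]
  exact hA.symm

theorem ColumnFinite.add {A B : H →L[ℂ] H'} (hA : ColumnFinite π π' A)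
    (hB : ColumnFinite π π' B) : ColumnFinite π π' (A + B) := fun σ => by
  refine ((hA σ).union (hB σ)).subset fun σ' h => ?_
  by_contra hn
  rw [Set.mem_union, not_or, Set.mem_ofPred, Set.mem_ofPred, not_not, not_not] at hn
  refine h ?_
  have : matrixEntry π π' (A + B) σ' σ = matrixEntry π π' A σ' σ + matrixEntry π π' B σ' σ := by
    ext x
    simp [matrixEntry_apply]
  rw [this, hn.1, hn.2, add_zero]

theorem ColumnFinite.smul (c : ℂ) {A : H →L[ℂ] H'} (hA : ColumnFinite π π' A) :
    ColumnFinite π π' (c • A) := fun σ => by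
  refine (hA σ).subset fun σ' h h0 => h ?_
  have : matrixEntry π π' (c • A) σ' σ = c • matrixEntry π π' A σ' σ := by
    ext x
    simp [matrixEntry_apply]
  rw [this, h0, smul_zero]

/-- This is matrix multiplication. Completeness of the middle representation supplies an
intermediate type `τ` at which both factors are nonzero. -/
theorem ColumnFinite.comp (hπ' : π'.IsComplete) {B : H' →L[ℂ] H''} {A : H →L[ℂ] H'}
    (hB : ColumnFinite π' π'' B) (hA : ColumnFinite π π' A) : ColumnFinite π π'' (B ∘L A) := by
  intro σ
  refine ((hA σ).biUnion fun τ _ => hB τ).subset fun σ' h => ?_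
  obtain ⟨x, hx⟩ : ∃ x, matrixEntry π π'' (B ∘L A) σ' σ x ≠ 0 := by
    by_contra! h'
    exact h (ContinuousLinearMap.ext h')
  obtain ⟨τ, hτ⟩ := hπ'.exists_proj_ne_zero (π''.proj σ' ∘L B) (y := A (π.proj σ x)) hx
  refine Set.mem_biUnion (x := τ) (fun h0 => hτ ?_) (fun h0 => hτ ?_)
  · have := congrArg (fun k => k x) h0
    rw [show π'.proj τ (A (π.proj σ x)) = 0 from this, map_zero]
  · have := congrArg (fun k => k (A (π.proj σ x))) h0
    exact this

/-- An operator that commutes with all isotypical projections is harmonically proper. -/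
theorem harmonicallyProper_of_forall_commute {A : H →L[ℂ] H}
    (hA : ∀ σ x, A (π.proj σ x) = π.proj σ (A x)) : HarmonicallyProper π π A := by
  have key : ∀ σ' σ, σ' ≠ σ → matrixEntry π π A σ' σ = 0 := fun σ' σ h => by
    ext x
    rw [matrixEntry_apply, ← hA, ← comp_apply (π.proj σ'), π.proj_comp_proj_of_ne h]
    simp
  intro σ
  refine (Set.finite_singleton σ).subset fun σ' h => ?_
  by_contra hne
  exact h.elim (fun h => h (key _ _ hne)) fun h => h (key _ _ (Ne.symm hne))

/-- An operator belonging to a finite-dimensional equivariant family of operators has a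
column-finite matrix. -/
theorem columnFinite_of_equivariant {E : Type*} [NormedAddCommGroup E] [InnerProductSpace ℂ E]
    [FiniteDimensional ℂ E] (ε : UnitaryRep G E) (Φ : E →ₗ[ℂ] (H →L[ℂ] H'))
    (hΦ : ∀ g e x, Φ (ε.toHom g e) (π.toHom g x) = π'.toHom g (Φ e x)) (e : E) :
    ColumnFinite π π' (Φ e) := by
  intro σ
  obtain ⟨ρ, hρ⟩ := Quotient.exists_rep σ
  -- The column `σ` meets only types occurring in the finite-dimensional representation `ε ⊗ ρ`: the
  -- map `a ⊗ x ↦ Φ a (T x)` is an intertwiner for every intertwiner `T` out of `ρ`.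
  have hInv : (ε.tensor ρ.2.1).IsInvariant ⊤ := fun _ _ _ => trivial
  obtain ⟨F, hF⟩ := (ε.tensor ρ.2.1).exists_finset_types ⊤ hInv
  refine F.finite_toSet.subset fun σ' h => ?_
  by_contra hσ'
  refine h ?_
  ext x
  rw [matrixEntry_apply]
  refine eq_zero_of_mem_isotypic (π'.proj σ' ∘L Φ e) (fun ρ' hρ' T' hT' y => ?_) (π.proj_mem σ x)
  -- The finite set `F` was chosen for one representative `ρ` of `σ`; an intertwiner from another
  -- representative is precomposed with a unitary equivalence.
  obtain ⟨U, hU⟩ := Quotient.exact (hρ.trans hρ'.symm)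
  let T : EuclideanSpace ℂ (Fin ρ.1) →L[ℂ] H := T' ∘L (U.toContinuousLinearEquiv : _ →L[ℂ] _)
  have hT : Intertwines ρ.2.1 π T := fun g x => by
    change T' (U (ρ.2.1.toHom g x)) = π.toHom g (T' (U x))
    rw [hU, hT']
  let S₀ : TensorProduct ℂ E (EuclideanSpace ℂ (Fin ρ.1)) →ₗ[ℂ] H' :=
    TensorProduct.lift (LinearMap.mk₂ ℂ (fun e x => Φ e (T x))
      (fun a b x => by simp) (fun c a x => by simp) (fun a x y => by simp)
      (fun c a x => by simp))
  let S := LinearMap.toContinuousLinearMap S₀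
  have hS : ∀ a x, S (a ⊗ₜ x) = Φ a (T x) := fun a x => by
    change S₀ (a ⊗ₜ x) = _
    simp [S₀]
  have hSint : Intertwines (ε.tensor ρ.2.1) π' S := fun g z => by
    induction z using TensorProduct.induction_on with
    | zero => simp
    | tmul a x => rw [tensor_tmul, hS, hS, hT, hΦ]
    | add x y hx hy => rw [map_add, map_add, hx, hy, map_add, map_add]
  have hmem : ∀ z, S z ∈ ⨆ τ ∈ F, π'.isotypic τ := fun z => by
    have hle : ⨆ τ ∈ F, (ε.tensor ρ.2.1).isotypic τ ≤
        (⨆ τ ∈ F, π'.isotypic τ).comap S.toLinearMap := by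
      refine iSup₂_le fun τ hτ z hz => ?_
      exact (le_iSup₂ (f := fun τ (_ : τ ∈ F) => π'.isotypic τ) τ hτ) (hSint.map_isotypic hz)
    exact hle (hF trivial)
  have := hmem (e ⊗ₜ U.symm y)
  rw [hS] at this
  have hTy : T (U.symm y) = T' y := by
    change T' (U (U.symm y)) = T' y
    rw [LinearIsometryEquiv.apply_symm_apply]
  rw [hTy] at this
  exact π'.proj_eq_zero_of_mem_iSup hσ' this

/-- Harmonically proper operators are left multipliers of the harmonically finite ones. -/
theorem HarmonicallyFinite.comp_left (hπ' : π'.IsComplete) {B : H' →L[ℂ] H''} {A : H →L[ℂ] H'}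
    (hB : HarmonicallyProper π' π'' B) (hA : HarmonicallyFinite π π' A) :
    HarmonicallyFinite π π'' (B ∘L A) := by
  refine (hA.biUnion fun s _ => (hB.columnFinite s.1).image fun σ' => (σ', s.2)).subset
    fun s h => ?_
  obtain ⟨x, hx⟩ : ∃ x, matrixEntry π π'' (B ∘L A) s.1 s.2 x ≠ 0 := by
    by_contra! h'
    exact h (ContinuousLinearMap.ext h')
  obtain ⟨τ, hτ⟩ := hπ'.exists_proj_ne_zero (π''.proj s.1 ∘L B) (y := A (π.proj s.2 x)) hx
  refine Set.mem_biUnion (x := (τ, s.2)) (fun h0 => hτ ?_) ⟨s.1, fun h0 => hτ ?_, rfl⟩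
  · have := congrArg (fun k => k x) h0
    rw [show π'.proj τ (A (π.proj s.2 x)) = 0 from this, map_zero]
  · have := congrArg (fun k => k (A (π.proj s.2 x))) h0
    exact this

theorem HarmonicallyFinite.adjoint {A : H →L[ℂ] H'} (hA : HarmonicallyFinite π π' A) :
    HarmonicallyFinite π' π (adjoint A) := by
  refine (hA.image Prod.swap).subset fun s h => ⟨s.swap, fun h0 => h ?_, Prod.swap_swap s⟩
  rw [← adjoint_matrixEntry]
  exact (congrArg _ h0).trans (map_zero _)

theorem HarmonicallyFinite.comp_right (hπ' : π'.IsComplete) {B : H' →L[ℂ] H''} {A : H →L[ℂ] H'}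
    (hB : HarmonicallyFinite π' π'' B) (hA : HarmonicallyProper π π' A) :
    HarmonicallyFinite π π'' (B ∘L A) := by
  have := (HarmonicallyFinite.comp_left hπ' hA.adjoint hB.adjoint).adjoint
  rwa [adjoint_comp, adjoint_adjoint, adjoint_adjoint] at this

end Columns

end HarmonicSU3
end

noncomputable section

namespace HarmonicSU3

/-! ### Norm limits of harmonically proper operators -/

section Criterion

variable {G : Type*} [Group G] [TopologicalSpace G]
variable {H : Type*} [NormedAddCommGroup H] [InnerProductSpace ℂ H] [CompleteSpace H]
variable {π : UnitaryRep G H}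

open UnitaryRep ContinuousLinearMap

theorem norm_sub_sum_proj_le (π : UnitaryRep G H) (N : Finset (Types G)) (x : H) :
    ‖x - ∑ σ ∈ N, π.proj σ x‖ ≤ ‖x‖ := by
  classical
  have horth : ∀ τ ∈ N, inner ℂ (x - ∑ σ ∈ N, π.proj σ x) (π.proj τ x) = 0 := fun τ hτ => by
    have h1 : π.proj τ (x - ∑ σ ∈ N, π.proj σ x) = 0 := by
      rw [map_sub, map_sum, Finset.sum_eq_single τ, π.proj_apply_of_mem (π.proj_mem τ x), sub_self]
      · exact fun σ _ hσ => π.proj_apply_of_mem_ne hσ.symm (π.proj_mem σ x)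
      · exact fun h => absurd hτ h
    rw [← adjoint_inner_left, π.adjoint_proj, h1, inner_zero_left]
  have h0 : inner ℂ (x - ∑ σ ∈ N, π.proj σ x) (∑ σ ∈ N, π.proj σ x) = 0 := by
    rw [inner_sum]
    exact Finset.sum_eq_zero horth
  have h := norm_add_sq_eq_norm_sq_add_norm_sq_of_inner_eq_zero _ _ h0
  rw [sub_add_cancel] at h
  nlinarith [norm_nonneg x, norm_nonneg (x - ∑ σ ∈ N, π.proj σ x),
    norm_nonneg (∑ σ ∈ N, π.proj σ x)]

/-- Given bounded operators `D σ` of summable norm, the operator `∑ D σ p_σ`. -/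
theorem exists_sum_comp_proj {w : Types G → ℝ} {c : ℝ} (hw : HasSum w c)
    (D : Types G → H →L[ℂ] H) (hD : ∀ σ, ‖D σ ∘L π.proj σ‖ ≤ w σ) :
    ∃ E : H →L[ℂ] H, ‖E‖ ≤ c ∧ (∀ σ, E ∘L π.proj σ = D σ ∘L π.proj σ) ∧
      HasSum (fun σ => D σ ∘L π.proj σ) E := by
  have hs : Summable fun σ => D σ ∘L π.proj σ := Summable.of_norm_bounded hw.summable hD
  refine ⟨∑' σ, D σ ∘L π.proj σ, ?_, fun τ => ?_, hs.hasSum⟩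
  · exact (tsum_of_norm_bounded hw hD)
  · ext x
    have h1 : HasSum (fun σ => (D σ ∘L π.proj σ) (π.proj τ x))
        ((∑' σ, D σ ∘L π.proj σ) (π.proj τ x)) :=
      hs.hasSum.mapL (ContinuousLinearMap.apply ℂ H (π.proj τ x))
    have h2 : HasSum (fun σ => (D σ ∘L π.proj σ) (π.proj τ x)) (D τ (π.proj τ x)) := by
      have := hasSum_single (f := fun σ => (D σ ∘L π.proj σ) (π.proj τ x)) τ fun σ hσ => by
        rw [ContinuousLinearMap.comp_apply, π.proj_apply_of_mem_ne hσ (π.proj_mem τ x), map_zero]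
      simpa [π.proj_apply_of_mem (π.proj_mem τ x)] using this
    exact h1.unique h2

/-- If every column and every row of `V` can be approximated by those of operators with
column-finite matrices, then `V` is a norm limit of harmonically proper operators. -/
theorem mem_closure_harmonicallyProper [Countable (Types G)] (hπ : π.IsComplete) {V : H →L[ℂ] H}
    (hcol : ∀ σ, ∀ ε > 0, ∃ B, ColumnFinite π π B ∧ ‖(V - B) ∘L π.proj σ‖ ≤ ε)
    (hrow : ∀ σ, ∀ ε > 0, ∃ B, ColumnFinite π π B ∧ ‖(adjoint V - B) ∘L π.proj σ‖ ≤ ε) :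
    V ∈ closure {A | HarmonicallyProper π π A} := by
  classical
  rw [Metric.mem_closure_iff]
  intro ε hε
  -- Countability of the types provides positive weights of total sum below `ε / 2`. They are spent
  -- twice, once on the columns and once on the rows.
  obtain ⟨w', hw'pos, c, hw', hc⟩ := NNReal.exists_pos_sum_of_countable
    (ε := (ε / 2).toNNReal) (by simpa using hε) (Types G)
  set w : Types G → ℝ := fun σ => w' σ with hw
  have hwpos : ∀ σ, 0 < w σ := fun σ => hw'pos σ
  have hwsum : HasSum w c := NNReal.hasSum_coe.2 hw'
  have hcε : (c : ℝ) < ε / 2 := by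
    have := NNReal.coe_lt_coe.2 hc
    rwa [Real.coe_toNNReal _ (by positivity)] at this
  choose B hB hVB using fun σ => hcol σ (w σ) (hwpos σ)
  -- Column correction: in `V - D` the column `σ` is exactly that of `B σ`, hence finite.
  obtain ⟨D, hDn, hDp, hDs⟩ := exists_sum_comp_proj hwsum (fun σ => V - B σ) hVB
  have hA' : ∀ σ x, (V - D) (π.proj σ x) = B σ (π.proj σ x) := fun σ x => by
    have := congrArg (fun k => k x) (hDp σ)
    change D (π.proj σ x) = V (π.proj σ x) - B σ (π.proj σ x) at this
    rw [_root_.sub_apply, this, sub_sub_cancel]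
  -- Each row of `V - D` has a small tail. For `D` this is norm convergence of its defining series;
  -- for `V` it is the approximation of the column `σ'` of the adjoint by a column-finite operator.
  have hN : ∀ σ', ∃ N : Finset (Types G), ∀ x,
      ‖π.proj σ' ((V - D) (x - ∑ σ ∈ N, π.proj σ x))‖ ≤ w σ' * ‖x‖ := by
    intro σ'
    obtain ⟨B', hB', hVB'⟩ := hrow σ' (w σ' / 2) (half_pos (hwpos σ'))
    obtain ⟨N₂, hN₂⟩ := Metric.tendsto_atTop.1 hDs (w σ' / 2) (half_pos (hwpos σ'))
    refine ⟨N₂ ∪ (hB' σ').toFinset, fun x => ?_⟩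
    set N := N₂ ∪ (hB' σ').toFinset with hNdef
    set y := x - ∑ σ ∈ N, π.proj σ x with hy
    have hyx : ‖y‖ ≤ ‖x‖ := norm_sub_sum_proj_le π N x
    have hpy : ∀ τ ∈ N, π.proj τ y = 0 := fun τ hτ => by
      rw [hy, map_sub, map_sum, Finset.sum_eq_single τ, π.proj_apply_of_mem (π.proj_mem τ x),
        sub_self]
      · exact fun σ _ hσ => π.proj_apply_of_mem_ne hσ.symm (π.proj_mem σ x)
      · exact fun h => absurd hτ h
    have hDy : ‖D y‖ ≤ w σ' / 2 * ‖x‖ := by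
      have h1 : D y = -((∑ σ ∈ N, (V - B σ) ∘L π.proj σ - D) x) := by
        rw [hy, map_sub, map_sum, _root_.sub_apply, neg_sub]
        congr 1
        rw [_root_.sum_apply]
        exact Finset.sum_congr rfl fun σ _ => congrArg (fun k => k x) (hDp σ)
      rw [h1, norm_neg]
      refine (le_opNorm _ _).trans (mul_le_mul_of_nonneg_right ?_ (norm_nonneg _))
      have := hN₂ N Finset.subset_union_left
      rw [dist_eq_norm] at this
      exact this.le
    have hVy : ‖π.proj σ' (V y)‖ ≤ w σ' / 2 * ‖x‖ := by
      -- `B' p_σ' u` has components only at types in `N`, and `y` has none there, so `B'` can be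
      -- subtracted from the adjoint of `V` without changing the inner product.
      have hin : ∀ u, ‖inner ℂ u (π.proj σ' (V y))‖ ≤ w σ' / 2 * ‖x‖ * ‖u‖ := fun u => by
        have h0 : inner ℂ (B' (π.proj σ' u)) y = 0 := by
          rw [← inner_conj_symm, map_eq_zero]
          by_contra hne
          obtain ⟨τ, hτ⟩ := hπ.exists_proj_ne_zero (innerSL ℂ y) hne
          rw [innerSL_apply_apply] at hτ
          have hτN : τ ∈ N := by
            refine Finset.mem_union_right _ ((hB' σ').mem_toFinset.2 fun h0 => hτ ?_)
            rw [show π.proj τ (B' (π.proj σ' u)) = 0 from congrArg (fun k => k u) h0,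
              inner_zero_right]
          rw [← adjoint_inner_left, π.adjoint_proj, hpy τ hτN, inner_zero_left] at hτ
          exact hτ rfl
        have h1 : inner ℂ u (π.proj σ' (V y)) =
            inner ℂ (((adjoint V - B') ∘L π.proj σ') u) y := by
          rw [ContinuousLinearMap.comp_apply, _root_.sub_apply, inner_sub_left, h0, sub_zero,
            adjoint_inner_left, ← adjoint_inner_left (π.proj σ'), π.adjoint_proj]
        rw [h1]
        calc _ ≤ ‖((adjoint V - B') ∘L π.proj σ') u‖ * ‖y‖ := norm_inner_le_norm _ _
          _ ≤ (w σ' / 2 * ‖u‖) * ‖x‖ := by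
            gcongr
            exact (le_opNorm _ _).trans (mul_le_mul_of_nonneg_right hVB' (norm_nonneg _))
          _ = _ := by ring
      have h2 := hin (π.proj σ' (V y))
      rw [inner_self_eq_norm_sq_to_K, norm_pow, RCLike.norm_ofReal, abs_norm] at h2
      by_contra! hlt
      have hpos : 0 < ‖π.proj σ' (V y)‖ :=
        lt_of_le_of_lt (mul_nonneg (half_pos (hwpos σ')).le (norm_nonneg x)) hlt
      nlinarith
    rw [_root_.sub_apply, map_sub]
    have := norm_sub_le (π.proj σ' (V y)) (π.proj σ' (D y))
    have := π.norm_proj_apply_le σ' (D y)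
    linarith
  choose N hN using hN
  -- Row correction: subtracting `∑ R` cuts the row `σ'` down to the columns in `N σ'` and leaves
  -- the remaining entries untouched. Columns therefore stay finite while rows become finite.
  set R : Types G → H →L[ℂ] H := fun σ' =>
    π.proj σ' ∘L (V - D) ∘L (ContinuousLinearMap.id ℂ H - ∑ σ ∈ N σ', π.proj σ) with hR
  have hRapp : ∀ σ' x, R σ' x = π.proj σ' ((V - D) (x - ∑ σ ∈ N σ', π.proj σ x)) := fun σ' x => by
    simp only [hR, ContinuousLinearMap.comp_apply, _root_.sub_apply, _root_.sum_apply,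
      ContinuousLinearMap.id_apply]
  have hRn : ∀ σ', ‖R σ'‖ ≤ w σ' := fun σ' =>
    opNorm_le_bound _ (hwpos σ').le fun x => by rw [hRapp]; exact hN σ' x
  have hRs : Summable R := Summable.of_norm_bounded hwsum.summable hRn
  have hRp : ∀ σ' x, π.proj σ' ((∑' τ, R τ) x) = R σ' x := fun σ' x => by
    have h1 : HasSum (fun τ => π.proj σ' (R τ x)) (π.proj σ' ((∑' τ, R τ) x)) :=
      (hRs.hasSum.mapL (ContinuousLinearMap.apply ℂ H x)).mapL (π.proj σ')
    have h2 : HasSum (fun τ => π.proj σ' (R τ x)) (π.proj σ' (R σ' x)) :=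
      hasSum_single σ' fun τ hτ => by
        rw [hRapp, π.proj_apply_of_mem_ne hτ.symm (π.proj_mem τ _)]
    rw [h1.unique h2, hRapp, π.proj_apply_of_mem (π.proj_mem σ' _)]
  have hentry : ∀ σ' σ, matrixEntry π π (V - D - ∑' τ, R τ) σ' σ ≠ 0 →
      σ ∈ N σ' ∧ matrixEntry π π (B σ) σ' σ ≠ 0 := by
    intro σ' σ h
    have hsum : ∀ x, ∑ τ ∈ N σ', π.proj τ (π.proj σ x) = if σ ∈ N σ' then π.proj σ x else 0 := by
      intro x
      split_ifs with hσ
      · rw [Finset.sum_eq_single σ, π.proj_apply_of_mem (π.proj_mem σ x)]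
        · exact fun τ _ hτ => π.proj_apply_of_mem_ne hτ (π.proj_mem σ x)
        · exact fun h => absurd hσ h
      · exact Finset.sum_eq_zero fun τ hτ =>
          π.proj_apply_of_mem_ne (fun h : τ = σ => hσ (h ▸ hτ)) (π.proj_mem σ x)
    have hval : ∀ x, matrixEntry π π (V - D - ∑' τ, R τ) σ' σ x =
        if σ ∈ N σ' then matrixEntry π π (B σ) σ' σ x else 0 := by
      intro x
      rw [matrixEntry_apply, _root_.sub_apply, map_sub, hRp, hRapp, hsum]
      split_ifs with hσ
      · rw [sub_self, map_zero, map_zero, sub_zero, hA', matrixEntry_apply]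
      · rw [sub_zero, sub_self]
    by_cases hσ : σ ∈ N σ'
    · refine ⟨hσ, fun h0 => h ?_⟩
      ext x
      rw [hval, if_pos hσ, h0]
    · exact absurd (ContinuousLinearMap.ext fun x => by rw [hval, if_neg hσ]; rfl) h
  refine ⟨V - D - ∑' τ, R τ, fun σ => ?_, ?_⟩
  · refine ((hB σ σ).union (N σ).finite_toSet).subset fun σ' h => ?_
    rcases h with h | h
    · exact Or.inl (hentry _ _ h).2
    · exact Or.inr (hentry _ _ h).1
  · rw [dist_eq_norm, show V - (V - D - ∑' τ, R τ) = D + ∑' τ, R τ by abel]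
    have h1 := norm_add_le D (∑' τ, R τ)
    have h2 : ‖∑' τ, R τ‖ ≤ c := tsum_of_norm_bounded hwsum hRn
    linarith

end Criterion

/-! ### Passing the multiplier property to norm closures. -/

section Multiplier

/-- Composition is jointly continuous in norm, so the algebraic multiplier property of proper
operators extends to closures in both variables. Only the space on which `V` acts has to be complete
in the sense of `IsComplete`. -/
theorem comp_mem_closure_harmonicallyFinite {G : Type*} [Group G] [TopologicalSpace G]
    {H : Type*} [NormedAddCommGroup H] [InnerProductSpace ℂ H] [CompleteSpace H]
    {H' : Type*} [NormedAddCommGroup H'] [InnerProductSpace ℂ H'] [CompleteSpace H']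
    {π : UnitaryRep G H} {π' : UnitaryRep G H'} (hπ : π.IsComplete) {V : H →L[ℂ] H}
    (hV : V ∈ closure {A | HarmonicallyProper π π A}) :
    (∀ T ∈ closure {A | HarmonicallyFinite π' π A},
      V ∘L T ∈ closure {A | HarmonicallyFinite π' π A}) ∧
    ∀ T ∈ closure {A | HarmonicallyFinite π π' A},
      T ∘L V ∈ closure {A | HarmonicallyFinite π π' A} := by
  refine ⟨fun T hT => ?_, fun T hT => ?_⟩
  · exact map_mem_closure₂ (f := fun (V : H →L[ℂ] H) (T : H' →L[ℂ] H) => V ∘L T) (by fun_prop) hV hT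
      fun A hA B hB => HarmonicallyFinite.comp_left hπ hA hB
  · exact map_mem_closure₂ (f := fun (T : H →L[ℂ] H') (V : H →L[ℂ] H) => T ∘L V) (by fun_prop) hT hV
      fun A hA B hB => HarmonicallyFinite.comp_right hπ hA hB

end Multiplier

end HarmonicSU3
end

noncomputable section

namespace HarmonicSU3

/-! ### Representations of compact groups -/

section Compact

open UnitaryRep MeasureTheory

variable {G : Type*} [Group G] [TopologicalSpace G] [IsTopologicalGroup G] [CompactSpace G]

/-- Averaging a rank one operator over a compact group produces a compact intertwiner. -/
theorem exists_average [MeasurableSpace G] [BorelSpace G] (μ : Measure G) [μ.IsHaarMeasure]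
    [IsProbabilityMeasure μ]
    {H : Type*} [NormedAddCommGroup H] [InnerProductSpace ℂ H] [CompleteSpace H]
    {H' : Type*} [NormedAddCommGroup H'] [InnerProductSpace ℂ H'] [CompleteSpace H']
    (π : UnitaryRep G H) (π' : UnitaryRep G H') (v : H) (v' : H') :
    ∃ A : H →L[ℂ] H', Intertwines π π' A ∧ IsCompactOperator A ∧
      ∀ x y, inner ℂ y (A x) =
        ∫ g, inner ℂ (π.toHom g v) x * inner ℂ y (π'.toHom g v') ∂μ := by
  let Q : G → H →L[ℂ] H' := fun g => (innerSL ℂ (π.toHom g v)).smulRight (π'.toHom g v')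
  have hQc : Continuous Q := by
    have h1 : Continuous fun g => innerSL ℂ (π.toHom g v) :=
      (innerSL ℂ).continuous.comp (π.continuous_orbit v)
    have h2 := π'.continuous_orbit v'
    exact (ContinuousLinearMap.smulRightL ℂ H H').continuous₂.comp (h1.prodMk h2)
  have hQi : Integrable Q μ := hQc.integrable_of_hasCompactSupport (HasCompactSupport.of_compactSpace _)
  have happ : ∀ x, (∫ g, Q g ∂μ) x = ∫ g, inner ℂ (π.toHom g v) x • π'.toHom g v' ∂μ := fun x =>
    ContinuousLinearMap.integral_apply hQi x
  refine ⟨∫ g, Q g ∂μ, fun h x => ?_, ?_, fun x y => ?_⟩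
  · rw [happ, happ, ← integral_mul_left_eq_self _ h]
    have : ∀ F : G → H', π'.toHom h (∫ g, F g ∂μ) = ∫ g, π'.toHom h (F g) ∂μ := fun F =>
      ((π'.toHom h).toContinuousLinearEquiv.integral_comp_comm F).symm
    rw [this]
    congr 1
    ext g
    rw [map_smul, toHom_mul_apply, toHom_mul_apply, LinearIsometryEquiv.inner_map_map]
  · have hmem : ∀ g, IsCompactOperator (Q g) := fun g => by
      have h1 : IsCompactOperator (ContinuousLinearMap.toSpanSingleton ℂ (π'.toHom g v')) :=
        isCompactOperator_of_locallyCompactSpace_rng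
          (ContinuousLinearMap.toSpanSingleton ℂ (π'.toHom g v'))
      exact h1.comp_clm (innerSL ℂ (π.toHom g v))
    -- The compact operators form a closed convex set, so the average of the rank one operators over
    -- a probability measure stays in it.
    have hconv : Convex ℝ {A : H →L[ℂ] H' | IsCompactOperator A} := by
      intro A hA B hB a b _ _ _
      exact IsCompactOperator.add (hA.smul a) (hB.smul b)
    exact hconv.integral_mem isClosed_setOfPred_isCompactOperator
      (Filter.Eventually.of_forall hmem) hQi
  · have h1 := ContinuousLinearMap.integral_comp_comm (innerSL ℂ y)
      (ContinuousLinearMap.integrable_comp ((ContinuousLinearMap.apply ℂ H' x)) hQi)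
    have h2 : (∫ g, Q g ∂μ) x = ∫ g, (ContinuousLinearMap.apply ℂ H' x) (Q g) ∂μ :=
      ContinuousLinearMap.integral_apply hQi x
    rw [h2, ← innerSL_apply_apply, ← h1]
    congr 1
    ext g
    simp [Q]

variable (G) in
/-- The normalized Haar measure of a compact group. -/
theorem exists_isHaarMeasure_isProbabilityMeasure [MeasurableSpace G] [BorelSpace G] :
    ∃ μ : Measure G, μ.IsHaarMeasure ∧ IsProbabilityMeasure μ := by
  let K : TopologicalSpace.PositiveCompacts G := ⊤
  exact ⟨Measure.haarMeasure K, inferInstance, ⟨Measure.haarMeasure_self⟩⟩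

/-- A nonzero unitary representation of a compact group has a nonzero finite-dimensional invariant
subspace. -/
theorem exists_finiteDimensional_invariant
    {H : Type*} [NormedAddCommGroup H] [InnerProductSpace ℂ H] [CompleteSpace H] [Nontrivial H]
    (π : UnitaryRep G H) :
    ∃ W : Submodule ℂ H, FiniteDimensional ℂ W ∧ π.IsInvariant W ∧ W ≠ ⊥ := by
  borelize G
  obtain ⟨μ, _, _⟩ := exists_isHaarMeasure_isProbabilityMeasure G
  obtain ⟨v, hv⟩ := exists_ne (0 : H)
  obtain ⟨A, hA, hAc, hAi⟩ := exists_average μ π π v v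
  have hsymm : A.IsSymmetric := fun x y => by
    change inner ℂ (A x) y = inner ℂ x (A y)
    rw [← inner_conj_symm, hAi, hAi, ← integral_conj]
    congr 1
    ext g
    rw [map_mul, inner_conj_symm, inner_conj_symm, mul_comm]
  -- `⟨v, A v⟩` is the integral of `|⟨v, g v⟩|²`, a continuous nonnegative function that is positive
  -- at `g = 1`.
  have hA0 : A ≠ 0 := fun h0 => by
    have h1 := hAi v v
    rw [h0, _root_.zero_apply, inner_zero_right] at h1
    have h2 : ∀ g, inner ℂ (π.toHom g v) v * inner ℂ v (π.toHom g v) =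
        ((‖inner ℂ v (π.toHom g v)‖ ^ 2 : ℝ) : ℂ) := fun g => by
      rw [← inner_conj_symm (π.toHom g v) v, mul_comm, RCLike.mul_conj]
      norm_cast
    simp_rw [h2] at h1
    rw [integral_complex_ofReal] at h1
    have hc : Continuous fun g => ‖inner ℂ v (π.toHom g v)‖ ^ 2 :=
      ((continuous_const.inner (π.continuous_orbit v)).norm).pow 2
    have hpos := hc.integral_pos_of_hasCompactSupport_nonneg_nonzero (μ := μ) (x := 1)
      (HasCompactSupport.of_compactSpace _) (fun g => by positivity) (by
        rw [toHom_one_apply, inner_self_eq_norm_sq_to_K]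
        simp [hv])
    rw [← Complex.ofReal_zero] at h1
    exact hpos.ne (Complex.ofReal_injective h1)
  -- A nonzero compact self-adjoint operator has a nonzero eigenvalue. Its eigenspace is
  -- finite-dimensional, and it is invariant because `A` is an intertwiner.
  have hex := mt (ContinuousLinearMap.eq_zero_of_forall_hasEigenvalue_eq_zero hAc hsymm).1 hA0
  push Not at hex
  obtain ⟨c, hc, hc0⟩ := hex
  refine ⟨Module.End.eigenspace A.toLinearMap c,
    ContinuousLinearMap.finite_dimensional_eigenspace hAc c hc0, fun g x hx => ?_, hc⟩
  rw [Module.End.mem_eigenspace_iff] at hx ⊢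
  change A (π.toHom g x) = _
  rw [hA, show A x = c • x from hx, map_smul]

/-- Complete reducibility: a unitary representation of a compact group is a Hilbert sum of
finite-dimensional irreducible ones. -/
theorem exists_orthogonal_minimalInvariant {H : Type u} [NormedAddCommGroup H]
    [InnerProductSpace ℂ H] [CompleteSpace H] (π : UnitaryRep G H) :
    ∃ (ι : Type u) (W : ι → Submodule ℂ H), (∀ i, FiniteDimensional ℂ (W i)) ∧
      (∀ i, π.IsMinimalInvariant (W i)) ∧ (Pairwise fun i j => W i ⟂ W j) ∧ (⨆ i, W i)ᗮ = ⊥ := by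
  obtain ⟨s, hs⟩ := zorn_subset
    {s : Set (Submodule ℂ H) | (∀ U ∈ s, FiniteDimensional ℂ U ∧ π.IsMinimalInvariant U) ∧
      s.Pairwise fun U V => U ⟂ V} (by
    intro c hc hchain
    refine ⟨⋃₀ c, ⟨fun U hU => ?_, ?_⟩, fun s hs => Set.subset_sUnion_of_mem hs⟩
    · obtain ⟨t, ht, hU⟩ := hU
      exact (hc ht).1 U hU
    · exact (Set.pairwise_sUnion hchain.directedOn).2 fun t ht => (hc ht).2)
  have hfd : ∀ i : s, FiniteDimensional ℂ (i : Submodule ℂ H) := fun i => (hs.1.1 i i.2).1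
  refine ⟨s, fun i => i, hfd, fun i => (hs.1.1 i i.2).2,
    fun i j hij => hs.1.2 i.2 j.2 (Subtype.coe_injective.ne hij), ?_⟩
  -- If the maximal orthogonal family did not span a dense subspace, its orthogonal complement would
  -- contain a further minimal invariant subspace. That subspace would belong to the family and be
  -- orthogonal to itself.
  by_contra hne
  obtain ⟨K, hK⟩ : ∃ K : Submodule ℂ H, K = (⨆ i : s, (i : Submodule ℂ H))ᗮ := ⟨_, rfl⟩
  rw [← hK] at hne
  have hKc : CompleteSpace K := by rw [hK]; infer_instance
  have hKinv : π.IsInvariant K := by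
    rw [hK]
    refine IsInvariant.orthogonal fun g v hv => ?_
    have hle : (⨆ i : s, (i : Submodule ℂ H)) ≤
        (⨆ i : s, (i : Submodule ℂ H)).comap (π.toHom g).toLinearEquiv.toLinearMap :=
      iSup_le fun i x hx => (le_iSup (fun i : s => (i : Submodule ℂ H)) i)
        ((hs.1.1 i i.2).2.invariant g x hx)
    exact hle hv
  have : Nontrivial K := Submodule.nontrivial_iff_ne_bot.2 hne
  obtain ⟨W, hWfd, hW, hW0⟩ := exists_finiteDimensional_invariant (π.sub K hKinv)
  have hW'inv : π.IsInvariant (W.map K.subtype) := by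
    rintro g _ ⟨x, hx, rfl⟩
    exact ⟨_, hW g x hx, rfl⟩
  have hW'0 : W.map K.subtype ≠ ⊥ := fun h => hW0 <| by
    rw [Submodule.eq_bot_iff] at h ⊢
    exact fun x hx => Subtype.ext (h _ ⟨x, hx, rfl⟩)
  obtain ⟨U, hUW, hU⟩ := π.exists_isMinimalInvariant hW'inv hW'0
  have hUK : U ≤ K := hUW.trans (Submodule.map_subtype_le K W)
  have hUs : ∀ V ∈ s, U ⟂ V := fun V hV => by
    rw [Submodule.isOrtho_iff_le]
    refine hUK.trans ?_
    rw [hK]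
    exact Submodule.orthogonal_le (le_iSup (fun i : s => (i : Submodule ℂ H)) ⟨V, hV⟩)
  have hmem : U ∈ s := by
    refine hs.2 ⟨?_, ?_⟩ (Set.subset_insert U s) (Set.mem_insert U s)
    · rintro V (rfl | hV)
      · exact ⟨Submodule.finiteDimensional_of_le hUW, hU⟩
      · exact hs.1.1 V hV
    · exact hs.1.2.insert fun V hV _ => ⟨hUs V hV, (hUs V hV).symm⟩
  exact hU.ne_bot (Submodule.isOrtho_self.1 (hUs U hmem))

/-- A second countable compact group has countably many types. -/
instance countable_types [SecondCountableTopology G] : Countable (Types G) := by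
  borelize G
  obtain ⟨μ, _, _⟩ := exists_isHaarMeasure_isProbabilityMeasure G
  choose ρ hρ using fun σ : Types G => Quotient.exists_rep σ
  have hvec : ∀ σ, ∃ u : EuclideanSpace ℂ (Fin (ρ σ).1), u ≠ 0 := fun σ => by
    by_contra! h
    have := (ρ σ).2.2
    obtain ⟨P, Q, hPQ⟩ := exists_pair_ne (Subrepresentation (ρ σ).2.1.toRepresentation)
    refine hPQ (Subrepresentation.toSubmodule_injective ?_)
    ext x
    rw [h x]
    exact iff_of_true (Submodule.zero_mem _) (Submodule.zero_mem _)
  choose w hw using hvec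
  have hcont : ∀ σ, Continuous fun g => inner ℂ (w σ) ((ρ σ).2.1.toHom g (w σ)) := fun σ =>
    continuous_const.inner ((ρ σ).2.1.continuous_orbit (w σ))
  -- One diagonal matrix coefficient is chosen for each type. Schur orthogonality separates them in
  -- `L²`, hence in the supremum norm because the measure has total mass one.
  let φ : Types G → C(G, ℂ) := fun σ => ⟨_, hcont σ⟩
  have hintC : ∀ f : G → ℂ, Continuous f → Integrable f μ := fun f hf =>
    hf.integrable_of_hasCompactSupport (HasCompactSupport.of_compactSpace _)
  have hintR : ∀ f : G → ℝ, Continuous f → Integrable f μ := fun f hf =>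
    hf.integrable_of_hasCompactSupport (HasCompactSupport.of_compactSpace _)
  have horth : ∀ σ τ, σ ≠ τ → ∫ g, (starRingEnd ℂ) (φ σ g) * φ τ g ∂μ = 0 := fun σ τ h => by
    obtain ⟨A, hA, -, hAi⟩ := exists_average μ (ρ σ).2.1 (ρ τ).2.1 (w σ) (w τ)
    have h0 : A = 0 := by
      by_contra hne
      refine h ?_
      rw [← hρ σ, ← hρ τ]
      exact equiv_of_intertwines_ne_zero hA hne
    have h1 := hAi (w σ) (w τ)
    rw [h0, _root_.zero_apply, inner_zero_right] at h1
    rw [h1]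
    congr 1
    ext g
    change (starRingEnd ℂ) (inner ℂ (w σ) ((ρ σ).2.1.toHom g (w σ))) * _ = _
    rw [inner_conj_symm]
    rfl
  let R : Types G → ℝ := fun σ => ∫ g, ‖φ σ g‖ ^ 2 ∂μ
  have hRpos : ∀ σ, 0 < R σ := fun σ => by
    refine Continuous.integral_pos_of_hasCompactSupport_nonneg_nonzero (x := 1)
      ((φ σ).continuous.norm.pow 2) (HasCompactSupport.of_compactSpace _)
      (fun g => by positivity) ?_
    change ‖inner ℂ (w σ) ((ρ σ).2.1.toHom 1 (w σ))‖ ^ 2 ≠ 0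
    rw [toHom_one_apply, inner_self_eq_norm_sq_to_K]
    simp [hw σ]
  have hdist : ∀ σ τ, σ ≠ τ → R σ + R τ ≤ dist (φ σ) (φ τ) ^ 2 := fun σ τ h => by
    have h1 : ∫ g, ‖φ σ g - φ τ g‖ ^ 2 ∂μ = R σ + R τ := by
      have hre : ∀ g, ‖φ σ g - φ τ g‖ ^ 2 = ‖φ σ g‖ ^ 2 + ‖φ τ g‖ ^ 2
          - 2 * ((starRingEnd ℂ) (φ σ g) * φ τ g).re := fun g => by
        rw [← Complex.normSq_eq_norm_sq, ← Complex.normSq_eq_norm_sq, ← Complex.normSq_eq_norm_sq,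
          Complex.normSq_sub]
        simp only [Complex.mul_re, Complex.conj_re, Complex.conj_im]
        ring
      have hi := hintC _ ((Complex.continuous_conj.comp (φ σ).continuous).mul (φ τ).continuous)
      have hzero : ∫ g, ((starRingEnd ℂ) (φ σ g) * φ τ g).re ∂μ = 0 := by
        have h2 : ∫ g, ((starRingEnd ℂ) (φ σ g) * φ τ g).re ∂μ =
            (∫ g, (starRingEnd ℂ) (φ σ g) * φ τ g ∂μ).re := integral_re hi
        rw [h2, horth σ τ h, Complex.zero_re]
      simp_rw [hre]
      rw [integral_sub, integral_add, integral_const_mul, hzero, mul_zero, sub_zero]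
      · exact hintR _ ((φ σ).continuous.norm.pow 2)
      · exact hintR _ ((φ τ).continuous.norm.pow 2)
      · exact hintR _ (((φ σ).continuous.norm.pow 2).add ((φ τ).continuous.norm.pow 2))
      · exact hi.re.const_mul 2
    rw [← h1]
    have h2 : ∫ g, ‖φ σ g - φ τ g‖ ^ 2 ∂μ ≤ ∫ _, dist (φ σ) (φ τ) ^ 2 ∂μ := by
      refine integral_mono (hintR _ (((φ σ).continuous.sub (φ τ).continuous).norm.pow 2))
        (integrable_const _) fun g => ?_
      change ‖φ σ g - φ τ g‖ ^ 2 ≤ dist (φ σ) (φ τ) ^ 2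
      rw [← dist_eq_norm]
      exact pow_le_pow_left₀ dist_nonneg (ContinuousMap.dist_apply_le_dist g) 2
    simpa using h2
  -- In the separable space `C(G, ℂ)` disjoint open balls are countable in number. The radii `√R /
  -- 2` work because `((√R σ + √R τ) / 2)² ≤ R σ + R τ`.
  have hcount : (Set.univ : Set (Types G)).Countable := by
    refine Set.PairwiseDisjoint.countable_of_isOpen
      (s := fun σ => Metric.ball (φ σ) (√(R σ) / 2)) ?_ (fun _ _ => Metric.isOpen_ball)
      fun σ _ => ⟨φ σ, Metric.mem_ball_self (half_pos (Real.sqrt_pos.2 (hRpos σ)))⟩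
    intro σ _ τ _ h
    refine Metric.ball_disjoint_ball ?_
    have h1 := hdist σ τ h
    have h2 := Real.sq_sqrt (hRpos σ).le
    have h3 := Real.sq_sqrt (hRpos τ).le
    refine (abs_le_of_sq_le_sq' ?_ dist_nonneg).2
    nlinarith [sq_nonneg (√(R σ) - √(R τ))]
  exact Set.countable_univ_iff.1 hcount

end Compact

end HarmonicSU3
end

noncomputable section

namespace HarmonicSU3

/-! ### Topology of `SU(3)` and its subgroups -/

section Topology

instance : IsTopologicalGroup SU3 where
  continuous_mul := continuous_mul
  continuous_inv := by
    rw [continuous_induced_rng]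
    exact (continuous_subtype_val (p := fun A => A ∈ Matrix.specialUnitaryGroup (Fin 3) ℂ)).star

theorem coe_mul_SU3 (k l : SU3) :
    ((k * l : SU3) : Matrix (Fin 3) (Fin 3) ℂ) = (k : Matrix (Fin 3) (Fin 3) ℂ) * l := rfl

theorem coe_one_SU3 : ((1 : SU3) : Matrix (Fin 3) (Fin 3) ℂ) = 1 := rfl

theorem coe_inv_SU3 (k : SU3) :
    ((k⁻¹ : SU3) : Matrix (Fin 3) (Fin 3) ℂ) = star (k : Matrix (Fin 3) (Fin 3) ℂ) := rfl

theorem isClosed_specialUnitaryGroup :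
    IsClosed (Matrix.specialUnitaryGroup (Fin 3) ℂ : Set (Matrix (Fin 3) (Fin 3) ℂ)) := by
  have h : (Matrix.specialUnitaryGroup (Fin 3) ℂ : Set (Matrix (Fin 3) (Fin 3) ℂ)) =
      {A | A * star A = 1} ∩ {A | A.det = 1} := by
    ext A
    rw [SetLike.mem_coe, Matrix.mem_specialUnitaryGroup_iff, Matrix.mem_unitaryGroup_iff]
    rfl
  rw [h]
  exact (isClosed_eq (continuous_id.mul continuous_id.star) continuous_const).inter
    (isClosed_eq continuous_id.matrix_det continuous_const)

instance : CompactSpace SU3 := by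
  refine (isCompact_iff_compactSpace 
    (s := (Matrix.specialUnitaryGroup (Fin 3) ℂ : Set (Matrix (Fin 3) (Fin 3) ℂ)))).1 ?_
  have hK : IsCompact (Set.univ.pi fun _ : Fin 3 => Set.univ.pi fun _ : Fin 3 =>
      Metric.closedBall (0 : ℂ) 1) :=
    isCompact_univ_pi fun _ => isCompact_univ_pi fun _ => isCompact_closedBall _ _
  refine hK.of_isClosed_subset isClosed_specialUnitaryGroup fun A hA => ?_
  rw [Set.mem_univ_pi]
  intro i
  rw [Set.mem_univ_pi]
  intro j
  rw [mem_closedBall_zero_iff]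
  exact entry_norm_bound_of_unitary (Matrix.mem_specialUnitaryGroup_iff.1 hA).1 i j

instance : SecondCountableTopology SU3 :=
  haveI : SecondCountableTopology (Matrix (Fin 3) (Fin 3) ℂ) :=
    inferInstanceAs (SecondCountableTopology (Fin 3 → Fin 3 → ℂ))
  TopologicalSpace.Subtype.secondCountableTopology
    (Matrix.specialUnitaryGroup (Fin 3) ℂ : Set (Matrix (Fin 3) (Fin 3) ℂ))

theorem isClosed_KS (S : Set (Fin 2)) : IsClosed (KS S : Set SU3) := by
  have h : (KS S : Set SU3) = ⋂ a, ⋂ b, ⋂ _ : ¬ SameBlock S a b,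
      {k : SU3 | (k : Matrix (Fin 3) (Fin 3) ℂ) a b = 0} := by
    ext k
    simp only [Set.mem_iInter]
    exact Iff.rfl
  rw [h]
  refine isClosed_iInter fun a => isClosed_iInter fun b => isClosed_iInter fun _ => ?_
  exact isClosed_eq (continuous_subtype_val.matrix_elem a b) continuous_const

instance (S : Set (Fin 2)) : CompactSpace (KS S) :=
  isCompact_iff_compactSpace.1 (isClosed_KS S).isCompact

end Topology

/-! ### One-parameter groups -/

section OneParameter

open Filter Topology

/-- A continuous one-parameter group in a Banach algebra is differentiable. -/
theorem exists_hasDerivAt_of_oneParameter {𝔸 : Type*} [NormedRing 𝔸] [NormedAlgebra ℝ 𝔸]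
    [CompleteSpace 𝔸] {f : ℝ → 𝔸} (hf : Continuous f) (h0 : f 0 = 1)
    (hadd : ∀ s t, f (s + t) = f s * f t) : ∃ a, HasDerivAt f a 0 := by
  -- Smoothing by integration: `f t * Φ h = Φ (t + h) - Φ t`, and `Φ h` is invertible for small
  -- nonzero `h` because `h⁻¹ Φ h → 1`. Solving for `f t` exhibits it as differentiable.
  let Φ : ℝ → 𝔸 := fun t => ∫ s in (0 : ℝ)..t, f s
  have hΦ : ∀ t, HasDerivAt Φ (f t) t := fun t => hf.integral_hasStrictDerivAt 0 t |>.hasDerivAt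
  have hΦ0 : Φ 0 = 0 := intervalIntegral.integral_same
  have hlim : Tendsto (fun h : ℝ => h⁻¹ • Φ h) (𝓝[≠] 0) (𝓝 1) := by
    have := (hasDerivAt_iff_tendsto_slope_zero.1 (hΦ 0))
    simpa [hΦ0, h0] using this
  obtain ⟨h, hunit, hne⟩ : ∃ h : ℝ, IsUnit (h⁻¹ • Φ h) ∧ h ≠ 0 := by
    have h1 : ∀ᶠ x : 𝔸 in 𝓝 1, IsUnit x := Units.isOpen.mem_nhds isUnit_one
    obtain ⟨h, hh⟩ := ((hlim.eventually h1).and self_mem_nhdsWithin).exists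
    exact ⟨h, hh.1, hh.2⟩
  obtain ⟨J, hJ⟩ : IsUnit (Φ h) := by
    have := hunit.smul (Units.mk0 h hne)
    rwa [Units.smul_def, Units.val_mk0, smul_smul, mul_inv_cancel₀ hne, one_smul] at this
  have hshift : ∀ t, f t * Φ h = Φ (t + h) - Φ t := fun t => by
    have h1 : f t * Φ h = ∫ s in (0 : ℝ)..h, f (t + s) := by
      simp_rw [hadd]
      exact ((ContinuousLinearMap.mul ℝ 𝔸 (f t)).intervalIntegral_comp_comm
        (hf.intervalIntegrable _ _)).symm
    rw [h1, intervalIntegral.integral_comp_add_left, add_zero,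
      intervalIntegral.integral_interval_sub_left (hf.intervalIntegrable _ _)
        (hf.intervalIntegrable _ _)]
  have hform : f = fun t => (Φ (t + h) - Φ t) * (J⁻¹ : 𝔸ˣ) := by
    ext t
    rw [← hshift, ← hJ, Units.mul_inv_cancel_right]
  refine ⟨(f (0 + h) - f 0) * (J⁻¹ : 𝔸ˣ), ?_⟩
  rw [hform]
  refine HasDerivAt.mul_const (HasDerivAt.sub ?_ ?_) _
  · rw [← hform]
    exact (hΦ (0 + h)).comp_add_const 0 h
  · rw [← hform]
    exact hΦ 0

/-- Telescoping: for contractions, exchanging the factors one at a time costs `‖x - y‖` each. -/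
theorem norm_pow_sub_pow_le {𝔸 : Type*} [NormedRing 𝔸] (h1 : ‖(1 : 𝔸)‖ ≤ 1) {x y : 𝔸}
    (hx : ‖x‖ ≤ 1) (hy : ‖y‖ ≤ 1) (n : ℕ) : ‖x ^ n - y ^ n‖ ≤ n * ‖x - y‖ := by
  have hyn : ∀ n : ℕ, ‖y ^ n‖ ≤ 1 := fun n => by
    induction n with
    | zero => simpa using h1
    | succ n ih =>
      rw [pow_succ]
      exact (norm_mul_le _ _).trans (mul_le_one₀ ih (norm_nonneg _) hy)
  induction n with
  | zero => simp
  | succ n ih =>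
    have h : x ^ (n + 1) - y ^ (n + 1) = x * (x ^ n - y ^ n) + (x - y) * y ^ n := by
      rw [pow_succ', pow_succ']; noncomm_ring
    rw [h]
    have h2 := norm_add_le (x * (x ^ n - y ^ n)) ((x - y) * y ^ n)
    have h3 := norm_mul_le x (x ^ n - y ^ n)
    have h4 := norm_mul_le (x - y) (y ^ n)
    have h5 : ‖x‖ * ‖x ^ n - y ^ n‖ ≤ 1 * ‖x ^ n - y ^ n‖ :=
      mul_le_mul_of_nonneg_right hx (norm_nonneg _)
    have h6 : ‖x - y‖ * ‖y ^ n‖ ≤ ‖x - y‖ * 1 :=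
      mul_le_mul_of_nonneg_left (hyn n) (norm_nonneg _)
    push_cast
    linarith

/-- Two curves of contractions through `1` with the same derivative have asymptotically equal
product formulas. -/
theorem tendsto_pow_sub_pow {𝔸 : Type*} [NormedRing 𝔸] [NormedAlgebra ℝ 𝔸]
    (h1 : ‖(1 : 𝔸)‖ ≤ 1) {c d : ℝ → 𝔸} {a : 𝔸} (hc : HasDerivAt c a 0) (hd : HasDerivAt d a 0)
    (h0 : c 0 = d 0) (hcn : ∀ t, ‖c t‖ ≤ 1) (hdn : ∀ t, ‖d t‖ ≤ 1) :
    Tendsto (fun n : ℕ => c ((n + 1 : ℕ) : ℝ)⁻¹ ^ (n + 1) - d ((n + 1 : ℕ) : ℝ)⁻¹ ^ (n + 1)) atTop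
      (𝓝 0) := by
  have hlim : Tendsto (fun n : ℕ => ((n + 1 : ℕ) : ℝ)⁻¹) atTop (𝓝[≠] 0) := by
    refine tendsto_nhdsWithin_iff.2 ⟨?_, Eventually.of_forall fun n => ?_⟩
    · exact (tendsto_inv_atTop_nhds_zero_nat (𝕜 := ℝ)).comp (tendsto_add_atTop_nat 1)
    · exact inv_ne_zero (Nat.cast_ne_zero.2 n.succ_ne_zero)
  -- The telescoping bound `m ‖c (1/m) - d (1/m)‖`, with `m = n + 1`, is the norm of a difference
  -- quotient of `c - d`, whose derivative at `0` vanishes.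
  have hslope := (hasDerivAt_iff_tendsto_slope_zero.1 (hc.sub hd)).comp hlim
  simp only [sub_self] at hslope
  refine squeeze_zero_norm (fun n => norm_pow_sub_pow_le h1 (hcn _) (hdn _) (n + 1)) ?_
  have := hslope.norm
  rw [norm_zero] at this
  refine this.congr fun n => ?_
  simp only [Function.comp_apply, zero_add, Pi.sub_apply, h0, sub_self, sub_zero, inv_inv]
  rw [norm_smul, Real.norm_of_nonneg (by positivity)]

end OneParameter

end HarmonicSU3
end

noncomputable section

namespace HarmonicSU3

/-! ### The infinitesimal action in finite dimension -/

section ExpSU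

open scoped Matrix.Norms.L2Operator
open Filter Topology

theorem coe_expSU (A : su3) :
    (expSU A : Matrix (Fin 3) (Fin 3) ℂ) = NormedSpace.exp (A : Matrix (Fin 3) (Fin 3) ℂ) := rfl

theorem hasDerivAt_exp_smul (A : Matrix (Fin 3) (Fin 3) ℂ) :
    HasDerivAt (fun t : ℝ => NormedSpace.exp (t • A)) A 0 := by
  have := hasDerivAt_exp_smul_const (𝕂 := ℝ) A (0 : ℝ)
  simpa using this

theorem expSU_zero_smul (A : su3) : expSU ((0 : ℝ) • A) = 1 := by
  apply Subtype.ext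
  rw [coe_expSU, zero_smul]
  exact NormedSpace.exp_zero

theorem expSU_add_smul (s t : ℝ) (A : su3) :
    expSU ((s + t) • A) = expSU (s • A) * expSU (t • A) := by
  apply Subtype.ext
  rw [coe_mul_SU3, coe_expSU, coe_expSU, coe_expSU, add_smul]
  exact Matrix.exp_add_of_commute _ _ (((Commute.refl _).smul_left s).smul_right t)

theorem expSU_neg_smul (t : ℝ) (A : su3) : expSU ((-t) • A) = (expSU (t • A))⁻¹ := by
  rw [eq_inv_iff_mul_eq_one, ← expSU_add_smul, neg_add_cancel, expSU_zero_smul]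

theorem expSU_pow (A : su3) (n : ℕ) :
    expSU (((n + 1 : ℕ) : ℝ)⁻¹ • A) ^ (n + 1) = expSU A := by
  have h : ∀ (t : ℝ) (m : ℕ), expSU (t • A) ^ m = expSU (((m : ℝ) * t) • A) := fun t m => by
    induction m with
    | zero => rw [pow_zero, Nat.cast_zero, zero_mul, expSU_zero_smul]
    | succ m ih => rw [pow_succ, ih, ← expSU_add_smul]; congr 2; push_cast; ring
  rw [h, mul_inv_cancel₀ (Nat.cast_ne_zero.2 n.succ_ne_zero), one_smul]

theorem continuous_expSU_smul (A : su3) : Continuous fun t : ℝ => expSU (t • A) := by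
  rw [continuous_induced_rng]
  have : Continuous fun t : ℝ => NormedSpace.exp (t • (A : Matrix (Fin 3) (Fin 3) ℂ)) :=
    letI : NormedAlgebra ℚ (Matrix (Fin 3) (Fin 3) ℂ) := NormedAlgebra.restrictScalars ℚ ℝ _
    NormedSpace.exp_continuous.comp (continuous_id.smul continuous_const)
  exact this

theorem norm_coe_SU3_le (k : SU3) : ‖(k : Matrix (Fin 3) (Fin 3) ℂ)‖ ≤ 1 :=
  CStarRing.norm_of_mem_unitary (Matrix.mem_specialUnitaryGroup_iff.1 k.2).1 |>.le

/-- The product formula in `SU(3)`. -/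
theorem tendsto_expSU_mul_pow (A B : su3) :
    Tendsto (fun n : ℕ => (expSU (((n + 1 : ℕ) : ℝ)⁻¹ • A) * expSU (((n + 1 : ℕ) : ℝ)⁻¹ • B)) ^
      (n + 1)) atTop (𝓝 (expSU (A + B))) := by
  rw [tendsto_subtype_rng]
  have h1 : ‖(1 : Matrix (Fin 3) (Fin 3) ℂ)‖ ≤ 1 := norm_coe_SU3_le 1
  have hc : HasDerivAt (fun t : ℝ => ((expSU (t • A) * expSU (t • B) : SU3) :
      Matrix (Fin 3) (Fin 3) ℂ)) (A + B : Matrix (Fin 3) (Fin 3) ℂ) 0 := by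
    have := (hasDerivAt_exp_smul (A : Matrix (Fin 3) (Fin 3) ℂ)).fun_mul
      (hasDerivAt_exp_smul (B : Matrix (Fin 3) (Fin 3) ℂ))
    simp only [zero_smul, NormedSpace.exp_zero, mul_one, one_mul] at this
    exact this
  have hd : HasDerivAt (fun t : ℝ => (expSU (t • (A + B)) : Matrix (Fin 3) (Fin 3) ℂ))
      (A + B : Matrix (Fin 3) (Fin 3) ℂ) 0 :=
    hasDerivAt_exp_smul (A + B : Matrix (Fin 3) (Fin 3) ℂ)
  have := tendsto_pow_sub_pow h1 hc hd (by
    rw [expSU_zero_smul, expSU_zero_smul, expSU_zero_smul, mul_one]) (fun t => norm_coe_SU3_le _)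
    (fun t => norm_coe_SU3_le _)
  have h2 := this.add_const (expSU (A + B) : Matrix (Fin 3) (Fin 3) ℂ)
  rw [zero_add] at h2
  refine h2.congr fun n => ?_
  have h3 : ((expSU (((n + 1 : ℕ) : ℝ)⁻¹ • (A + B)) : Matrix (Fin 3) (Fin 3) ℂ)) ^ (n + 1) =
      expSU (A + B) := congrArg Subtype.val (expSU_pow (A + B) n)
  rw [h3, sub_add_cancel]
  rfl

theorem hasDerivAt_expSU_conj (A : su3) (Z : Matrix (Fin 3) (Fin 3) ℂ) :
    HasDerivAt (fun t : ℝ => (expSU (t • A) : Matrix (Fin 3) (Fin 3) ℂ) * Z *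
      (expSU (t • A))⁻¹) (A * Z - Z * A) 0 := by
  have h1 := hasDerivAt_exp_smul (A : Matrix (Fin 3) (Fin 3) ℂ)
  have h2 : HasDerivAt (fun t : ℝ => (((expSU (t • A))⁻¹ : SU3) : Matrix (Fin 3) (Fin 3) ℂ))
      (-A : Matrix (Fin 3) (Fin 3) ℂ) 0 := by
    have := hasDerivAt_exp_smul (-A : Matrix (Fin 3) (Fin 3) ℂ)
    refine this.congr_of_eventuallyEq (Eventually.of_forall fun t => ?_)
    dsimp only
    rw [← expSU_neg_smul, coe_expSU, smul_neg, ← neg_smul]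
    rfl
  have := (h1.mul_const Z).fun_mul h2
  rw [expSU_zero_smul, inv_one, coe_one_SU3, zero_smul, NormedSpace.exp_zero, one_mul, mul_one,
    mul_neg, ← sub_eq_add_neg] at this
  exact this

end ExpSU

section LieAction

open Filter Topology

variable {G : Type*} [Group G] [TopologicalSpace G]
variable {W : Type*} [NormedAddCommGroup W] [InnerProductSpace ℂ W]

/-- The bounded operator by which `g` acts. -/
def UnitaryRep.toCLM (ρ : UnitaryRep G W) (g : G) : W →L[ℂ] W :=
  ((ρ.toHom g).toContinuousLinearEquiv : W →L[ℂ] W)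

namespace UnitaryRep

@[simp] theorem toCLM_apply (ρ : UnitaryRep G W) (g : G) (x : W) : ρ.toCLM g x = ρ.toHom g x := rfl

theorem toCLM_mul (ρ : UnitaryRep G W) (g h : G) : ρ.toCLM (g * h) = ρ.toCLM g * ρ.toCLM h := by
  ext x
  exact ρ.toHom_mul_apply g h x

theorem toCLM_one (ρ : UnitaryRep G W) : ρ.toCLM 1 = 1 := by
  ext x
  exact ρ.toHom_one_apply x

theorem toCLM_inv_mul (ρ : UnitaryRep G W) (g : G) : ρ.toCLM g⁻¹ * ρ.toCLM g = 1 := by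
  rw [← toCLM_mul, inv_mul_cancel, toCLM_one]

theorem toCLM_pow (ρ : UnitaryRep G W) (g : G) (n : ℕ) : ρ.toCLM (g ^ n) = ρ.toCLM g ^ n := by
  induction n with
  | zero => rw [pow_zero, pow_zero, toCLM_one]
  | succ n ih => rw [pow_succ, pow_succ, toCLM_mul, ih]

theorem norm_toCLM_le (ρ : UnitaryRep G W) (g : G) : ‖ρ.toCLM g‖ ≤ 1 :=
  ContinuousLinearMap.opNorm_le_bound _ zero_le_one fun x => by simp

theorem star_toCLM [CompleteSpace W] (ρ : UnitaryRep G W) (g : G) :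
    star (ρ.toCLM g) = ρ.toCLM g⁻¹ := by
  rw [ContinuousLinearMap.star_eq_adjoint]
  symm
  rw [ContinuousLinearMap.eq_adjoint_iff]
  intro x y
  rw [toCLM_apply, toCLM_apply, inner_toHom_left, inv_inv]

variable [FiniteDimensional ℂ W]

theorem continuous_toCLM (ρ : UnitaryRep G W) : Continuous ρ.toCLM :=
  continuous_clm_apply.2 ρ.continuous_orbit

end UnitaryRep

variable [FiniteDimensional ℂ W]

namespace UnitaryRep

/-- A one-parameter group in a finite-dimensional representation is differentiable. -/
theorem exists_hasDerivAt_toCLM (ρ : UnitaryRep G W) {γ : ℝ → G} (hγ : Continuous γ)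
    (h0 : γ 0 = 1) (hadd : ∀ s t, γ (s + t) = γ s * γ t) :
    ∃ a, HasDerivAt (fun t => ρ.toCLM (γ t)) a 0 := by
  have := FiniteDimensional.complete ℂ W
  refine exists_hasDerivAt_of_oneParameter (ρ.continuous_toCLM.comp hγ) ?_ fun s t => ?_
  · rw [h0, toCLM_one]
  · rw [hadd, toCLM_mul]

/-- The infinitesimal action of `A ∈ 𝔰𝔲(3)` on a finite-dimensional representation. -/
def deriv (ρ : UnitaryRep SU3 W) (A : su3) : W →L[ℂ] W :=
  _root_.deriv (fun t : ℝ => ρ.toCLM (expSU (t • A))) 0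

theorem hasDerivAt (ρ : UnitaryRep SU3 W) (A : su3) :
    HasDerivAt (fun t : ℝ => ρ.toCLM (expSU (t • A))) (ρ.deriv A) 0 := by
  obtain ⟨a, ha⟩ := ρ.exists_hasDerivAt_toCLM (continuous_expSU_smul A) (expSU_zero_smul A)
    (fun s t => expSU_add_smul s t A)
  exact ha.differentiableAt.hasDerivAt

theorem hasLieDeriv (ρ : UnitaryRep SU3 W) (A : su3) (x : W) :
    ρ.HasLieDeriv A x (ρ.deriv A x) := by
  have h := ((ContinuousLinearMap.apply ℂ W x).restrictScalars ℝ).hasFDerivAt.comp_hasDerivAt 0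
    (ρ.hasDerivAt A)
  exact h

theorem star_deriv [CompleteSpace W] (ρ : UnitaryRep SU3 W) (A : su3) :
    star (ρ.deriv A) = -ρ.deriv A := by
  have h1 := (ρ.hasDerivAt A).star
  have h2 : HasDerivAt (fun t : ℝ => ρ.toCLM (expSU ((-t) • A))) (-ρ.deriv A) 0 := by
    have h3 : HasDerivAt (fun t : ℝ => ρ.toCLM (expSU (t • A))) (ρ.deriv A) (-0) := by
      rw [neg_zero]; exact ρ.hasDerivAt A
    have h4 := h3.scomp (0 : ℝ) (hasDerivAt_neg (0 : ℝ))
    rw [neg_one_smul] at h4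
    exact h4
  refine h1.unique (h2.congr_of_eventuallyEq (Eventually.of_forall fun t => ?_))
  dsimp only
  rw [star_toCLM, expSU_neg_smul]

theorem deriv_smul (ρ : UnitaryRep SU3 W) (c : ℝ) (A : su3) : ρ.deriv (c • A) = c • ρ.deriv A := by
  have h3 : HasDerivAt (fun t : ℝ => ρ.toCLM (expSU (t • A))) (ρ.deriv A) (0 * c) := by
    rw [zero_mul]; exact ρ.hasDerivAt A
  have h := h3.scomp (0 : ℝ) ((hasDerivAt_id (0 : ℝ)).mul_const c)
  rw [one_mul] at h
  refine (ρ.hasDerivAt (c • A)).unique (h.congr_of_eventuallyEq (Eventually.of_forall fun t => ?_))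
  simp [smul_smul]

/-- The product formula is used on both sides: `(exp(A/n) exp(B/n))^n` tends to `exp(A + B)` in the
group, while its image in the representation is compared with `exp((a + b)/n)^n`. The purpose is
additivity of `deriv`, which is defined one direction at a time. -/
theorem toCLM_expSU_add (ρ : UnitaryRep SU3 W) (A B : su3) :
    ρ.toCLM (expSU (A + B)) = NormedSpace.exp (ρ.deriv A + ρ.deriv B) := by
  have := FiniteDimensional.complete ℂ W
  let _ : NormedAlgebra ℚ (W →L[ℂ] W) := NormedAlgebra.restrictScalars ℚ ℝ _
  set a := ρ.deriv A + ρ.deriv B with ha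
  have hskew : ∀ t : ℝ, star (t • a) = -(t • a) := fun t => by
    rw [star_smul, ha, star_add, star_deriv, star_deriv, star_trivial, ← neg_add, smul_neg]
  -- The comparison of powers requires contractions; the exponential of a skew-adjoint operator is
  -- an isometry.
  have hdn : ∀ t : ℝ, ‖NormedSpace.exp (t • a)‖ ≤ 1 := fun t => by
    have h1 : star (NormedSpace.exp (t • a)) * NormedSpace.exp (t • a) = 1 := by
      rw [NormedSpace.star_exp, hskew, ← NormedSpace.exp_add_of_commute
        ((Commute.refl (t • a)).neg_left), neg_add_cancel, NormedSpace.exp_zero]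
    have h2 := CStarRing.norm_star_mul_self (x := NormedSpace.exp (t • a))
    rw [h1] at h2
    have h3 : ‖(1 : W →L[ℂ] W)‖ ≤ 1 := ContinuousLinearMap.norm_id_le
    nlinarith [norm_nonneg (NormedSpace.exp (t • a))]
  have hd : HasDerivAt (fun t : ℝ => NormedSpace.exp (t • a)) a 0 := by
    have := hasDerivAt_exp_smul_const (𝕂 := ℝ) a (0 : ℝ)
    simpa using this
  have hc : HasDerivAt (fun t : ℝ => ρ.toCLM (expSU (t • A) * expSU (t • B))) a 0 := by
    have h := (ρ.hasDerivAt A).mul (ρ.hasDerivAt B)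
    rw [expSU_zero_smul, expSU_zero_smul, toCLM_one, mul_one, one_mul] at h
    refine h.congr_of_eventuallyEq (Eventually.of_forall fun t => ?_)
    exact ρ.toCLM_mul _ _
  have hlim := tendsto_pow_sub_pow ContinuousLinearMap.norm_id_le hc hd
    (by
      rw [expSU_zero_smul, expSU_zero_smul, mul_one, toCLM_one, zero_smul, NormedSpace.exp_zero]) (fun t => ρ.norm_toCLM_le _) hdn
  have hlim' := ((ρ.continuous_toCLM.tendsto _).comp (tendsto_expSU_mul_pow A B)).sub hlim
  rw [sub_zero] at hlim'
  refine tendsto_nhds_unique hlim' (tendsto_const_nhds.congr fun n => ?_)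
  rw [Function.comp_apply, toCLM_pow, sub_sub_cancel, ← NormedSpace.exp_nsmul,
    ← Nat.cast_smul_eq_nsmul ℝ, smul_smul, mul_inv_cancel₀ (Nat.cast_ne_zero.2 n.succ_ne_zero),
    one_smul]

theorem deriv_add (ρ : UnitaryRep SU3 W) (A B : su3) :
    ρ.deriv (A + B) = ρ.deriv A + ρ.deriv B := by
  have := FiniteDimensional.complete ℂ W
  have hd := hasDerivAt_exp_smul_const (𝕂 := ℝ) (ρ.deriv A + ρ.deriv B) (0 : ℝ)
  simp only [zero_smul, NormedSpace.exp_zero, one_mul] at hd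
  refine (ρ.hasDerivAt (A + B)).unique
    (hd.congr_of_eventuallyEq (Eventually.of_forall fun t => ?_))
  dsimp only
  rw [smul_add, toCLM_expSU_add, deriv_smul, deriv_smul, smul_add]

end UnitaryRep

end LieAction

end HarmonicSU3
end

noncomputable section

namespace HarmonicSU3

/-! ### The action of `𝔤𝔩(3, ℂ)` through its traceless quotient -/

section ComplexAction

open Filter Topology

variable {W : Type*} [NormedAddCommGroup W] [InnerProductSpace ℂ W] [FiniteDimensional ℂ W]

/-- The traceless part of a matrix. -/
def traceless (Z : Matrix (Fin 3) (Fin 3) ℂ) : Matrix (Fin 3) (Fin 3) ℂ :=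
  Z - (Z.trace / 3) • (1 : Matrix (Fin 3) (Fin 3) ℂ)

theorem trace_traceless (Z : Matrix (Fin 3) (Fin 3) ℂ) : (traceless Z).trace = 0 := by
  simp [traceless, Matrix.trace_sub, Matrix.trace_smul]

theorem traceless_eq_self {Z : Matrix (Fin 3) (Fin 3) ℂ} (hZ : Z.trace = 0) : traceless Z = Z := by
  simp [traceless, hZ]

theorem traceless_add (Z Z' : Matrix (Fin 3) (Fin 3) ℂ) :
    traceless (Z + Z') = traceless Z + traceless Z' := by
  simp only [traceless, Matrix.trace_add, add_div, add_smul]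
  abel

theorem traceless_smul (c : ℂ) (Z : Matrix (Fin 3) (Fin 3) ℂ) :
    traceless (c • Z) = c • traceless Z := by
  simp only [traceless, Matrix.trace_smul, smul_sub, smul_smul, smul_eq_mul, mul_div_assoc]

theorem traceless_conjTranspose (Z : Matrix (Fin 3) (Fin 3) ℂ) :
    traceless Z.conjTranspose = (traceless Z).conjTranspose := by
  simp [traceless, Matrix.trace_conjTranspose]

theorem su3_neg_smul (t : ℝ) (A : su3) : (-t) • A = -(t • A) := by
  apply Subtype.ext
  rw [Submodule.coe_neg, Submodule.coe_smul, Submodule.coe_smul, neg_smul]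

theorem su3_smul_neg (t : ℝ) (A : su3) : t • (-A) = -(t • A) := by
  apply Subtype.ext
  rw [Submodule.coe_neg, Submodule.coe_smul, Submodule.coe_smul, Submodule.coe_neg, smul_neg]

theorem su3_neg_one_smul (A : su3) : (-1 : ℝ) • A = -A := by
  rw [su3_neg_smul, one_smul]

/-- The skew-Hermitian traceless part of a matrix. -/
def skew (Z : Matrix (Fin 3) (Fin 3) ℂ) : su3 := skewPart (traceless Z) (trace_traceless Z)

theorem coe_skew (Z : Matrix (Fin 3) (Fin 3) ℂ) :
    (skew Z : Matrix (Fin 3) (Fin 3) ℂ) = (1 / 2 : ℂ) • (traceless Z - (traceless Z).conjTranspose) :=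
  rfl

theorem skew_add (Z Z' : Matrix (Fin 3) (Fin 3) ℂ) : skew (Z + Z') = skew Z + skew Z' := by
  apply Subtype.ext
  rw [Submodule.coe_add, coe_skew, coe_skew, coe_skew, traceless_add, Matrix.conjTranspose_add,
    ← smul_add]
  congr 1
  abel

theorem skew_real_smul (c : ℝ) (Z : Matrix (Fin 3) (Fin 3) ℂ) :
    skew ((c : ℂ) • Z) = c • skew Z := by
  apply Subtype.ext
  rw [Submodule.coe_smul, coe_skew, coe_skew, traceless_smul, Matrix.conjTranspose_smul,
    Complex.star_def, Complex.conj_ofReal, ← smul_sub, smul_comm, Complex.coe_smul]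

theorem skew_coe (A : su3) : skew A = A := by
  apply Subtype.ext
  rw [coe_skew, traceless_eq_self A.2.2, A.2.1, sub_neg_eq_add, ← two_smul ℂ, smul_smul]
  norm_num

theorem skew_I_smul_coe (A : su3) : skew (Complex.I • (A : Matrix (Fin 3) (Fin 3) ℂ)) = 0 := by
  apply Subtype.ext
  rw [coe_skew, traceless_smul, traceless_eq_self A.2.2, Matrix.conjTranspose_smul, A.2.1]
  simp

theorem skew_conjTranspose (Z : Matrix (Fin 3) (Fin 3) ℂ) : skew Z.conjTranspose = -skew Z := by
  apply Subtype.ext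
  rw [Submodule.coe_neg, coe_skew, coe_skew, traceless_conjTranspose,
    Matrix.conjTranspose_conjTranspose, ← smul_neg, neg_sub]

/-- This replaces the second skew part by `skew (i Z)` up to sign, so that complexification reads `Z
= skew Z - i skew (i Z)` with a single real-linear map `skew`. -/
theorem skewPart'_eq_skew (Z : Matrix (Fin 3) (Fin 3) ℂ) (hZ : Z.trace = 0) :
    skewPart' Z hZ = -skew (Complex.I • Z) := by
  apply Subtype.ext
  rw [Submodule.coe_neg, coe_skew, traceless_smul, traceless_eq_self hZ,
    Matrix.conjTranspose_smul, Complex.star_def, Complex.conj_I, neg_smul, sub_neg_eq_add,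
    ← smul_add, smul_smul, ← neg_smul]
  change (-Complex.I / 2 : ℂ) • (Z + Z.conjTranspose) = _
  congr 1
  ring

theorem skewPart_eq_skew (Z : Matrix (Fin 3) (Fin 3) ℂ) (hZ : Z.trace = 0) :
    skewPart Z hZ = skew Z := by
  apply Subtype.ext
  rw [coe_skew, traceless_eq_self hZ]
  rfl

theorem skew_add_I_smul (Z : Matrix (Fin 3) (Fin 3) ℂ) :
    (skew Z : Matrix (Fin 3) (Fin 3) ℂ) - Complex.I • (skew (Complex.I • Z) : Matrix _ _ ℂ) =
      traceless Z := by
  have h := skewPart_add (traceless Z) (trace_traceless Z)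
  rw [skewPart'_eq_skew, skewPart_eq_skew] at h
  have h2 : ∀ Z : Matrix (Fin 3) (Fin 3) ℂ, skew (traceless Z) = skew Z := fun Z => by
    apply Subtype.ext
    rw [coe_skew, coe_skew, traceless_eq_self (trace_traceless Z)]
  rw [← traceless_smul, h2, h2, Submodule.coe_neg, smul_neg, ← sub_eq_add_neg] at h
  exact h

namespace UnitaryRep

/-- The complexified infinitesimal action of a matrix (through its traceless part) on a
finite-dimensional representation. -/
def op (ρ : UnitaryRep SU3 W) : Matrix (Fin 3) (Fin 3) ℂ →ₗ[ℂ] (W →L[ℂ] W) where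
  toFun Z := ρ.deriv (skew Z) - Complex.I • ρ.deriv (skew (Complex.I • Z))
  map_add' Z Z' := by
    rw [smul_add, skew_add, skew_add, deriv_add, deriv_add, smul_add]
    abel
  map_smul' c Z := by
    have hI : ∀ Z, skew (Complex.I • Complex.I • Z) = -skew Z := fun Z => by
      have := skew_real_smul (-1) Z
      rw [su3_neg_one_smul] at this
      rw [smul_smul, Complex.I_mul_I]
      simpa using this
    have h1 : skew (c • Z) = c.re • skew Z + c.im • skew (Complex.I • Z) := by
      rw [← skew_real_smul, ← skew_real_smul, ← skew_add]
      congr 1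
      rw [smul_smul, ← add_smul, Complex.re_add_im]
    have h2 : skew (Complex.I • c • Z) = c.re • skew (Complex.I • Z) - c.im • skew Z := by
      rw [sub_eq_add_neg, ← su3_smul_neg, ← hI, ← skew_real_smul, ← skew_real_smul, ← skew_add]
      congr 1
      simp only [smul_smul, ← add_smul]
      congr 1
      conv_lhs => rw [← Complex.re_add_im c]
      ring
    rw [h1, h2, sub_eq_add_neg (c.re • _), ← su3_neg_smul, deriv_add, deriv_add, deriv_smul, deriv_smul,
      deriv_smul, deriv_smul, RingHom.id_apply]
    simp only [← Complex.coe_smul, smul_add, smul_sub, smul_smul]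
    conv_rhs => rw [← Complex.re_add_im c]
    simp only [add_smul, add_mul, mul_assoc, Complex.I_mul_I, Complex.ofReal_neg]
    simp only [mul_neg, neg_mul, mul_one, neg_smul, mul_comm Complex.I]
    abel

theorem op_apply (ρ : UnitaryRep SU3 W) (Z : Matrix (Fin 3) (Fin 3) ℂ) :
    ρ.op Z = ρ.deriv (skew Z) - Complex.I • ρ.deriv (skew (Complex.I • Z)) := rfl

theorem deriv_zero (ρ : UnitaryRep SU3 W) : ρ.deriv 0 = 0 := by
  have := ρ.deriv_smul 0 0
  simpa using this

theorem deriv_neg (ρ : UnitaryRep SU3 W) (A : su3) : ρ.deriv (-A) = -ρ.deriv A := by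
  have := ρ.deriv_smul (-1) A
  rwa [su3_neg_one_smul, neg_one_smul] at this

theorem op_coe (ρ : UnitaryRep SU3 W) (A : su3) : ρ.op A = ρ.deriv A := by
  rw [op_apply, skew_coe, skew_I_smul_coe, deriv_zero, smul_zero, sub_zero]

theorem op_eq_of_trace_eq_zero (ρ : UnitaryRep SU3 W) (Z : Matrix (Fin 3) (Fin 3) ℂ)
    (hZ : Z.trace = 0) :
    ρ.op Z = ρ.deriv (skewPart Z hZ) + Complex.I • ρ.deriv (skewPart' Z hZ) := by
  rw [skewPart_eq_skew, skewPart'_eq_skew, deriv_neg, smul_neg, ← sub_eq_add_neg, op_apply]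

theorem star_op [CompleteSpace W] (ρ : UnitaryRep SU3 W) (Z : Matrix (Fin 3) (Fin 3) ℂ) :
    star (ρ.op Z) = ρ.op Z.conjTranspose := by
  have h : Complex.I • Z.conjTranspose = -(Complex.I • Z).conjTranspose := by
    rw [Matrix.conjTranspose_smul]
    simp
  have h2 : skew (-(Complex.I • Z).conjTranspose) = skew (Complex.I • Z) := by
    have := skew_real_smul (-1) (Complex.I • Z).conjTranspose
    rw [skew_conjTranspose, su3_neg_one_smul, neg_neg] at this
    simpa using this
  rw [op_apply, op_apply, h, h2, skew_conjTranspose, star_sub, star_smul, star_deriv, star_deriv,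
    deriv_neg, Complex.star_def, Complex.conj_I, smul_neg, neg_smul, neg_neg]

theorem toCLM_mul_deriv_mul (ρ : UnitaryRep SU3 W) (g : SU3) (A B : su3)
    (hB : (B : Matrix (Fin 3) (Fin 3) ℂ) = g * A * (g⁻¹ : SU3)) :
    ρ.toCLM g * ρ.deriv A * ρ.toCLM g⁻¹ = ρ.deriv B := by
  have h := ((ρ.hasDerivAt A).const_mul (ρ.toCLM g)).mul_const (ρ.toCLM g⁻¹)
  refine h.unique ((ρ.hasDerivAt B).congr_of_eventuallyEq (Eventually.of_forall fun t => ?_))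
  dsimp only
  rw [← toCLM_mul, ← toCLM_mul]
  congr 1
  apply Subtype.ext
  have hg : (g : Matrix (Fin 3) (Fin 3) ℂ) * ((g⁻¹ : SU3) : Matrix (Fin 3) (Fin 3) ℂ) = 1 := by
    rw [← coe_mul_SU3, mul_inv_cancel, coe_one_SU3]
  have hinv : (g : Matrix (Fin 3) (Fin 3) ℂ)⁻¹ = ((g⁻¹ : SU3) : Matrix (Fin 3) (Fin 3) ℂ) :=
    Matrix.inv_eq_right_inv hg
  rw [coe_mul_SU3, coe_mul_SU3, coe_expSU, coe_expSU, Submodule.coe_smul, Submodule.coe_smul, hB,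
    ← hinv, ← Matrix.exp_conj _ _ (IsUnit.of_mul_eq_one _ hg), Matrix.mul_smul, Matrix.smul_mul]

/-- The adjoint action. -/
theorem toCLM_mul_op_mul (ρ : UnitaryRep SU3 W) (g : SU3) (Z : Matrix (Fin 3) (Fin 3) ℂ) :
    ρ.toCLM g * ρ.op Z * ρ.toCLM g⁻¹ = ρ.op (g * Z * (g⁻¹ : SU3)) := by
  have hg : ((g⁻¹ : SU3) : Matrix (Fin 3) (Fin 3) ℂ) * (g : Matrix (Fin 3) (Fin 3) ℂ) = 1 := by
    rw [← coe_mul_SU3, inv_mul_cancel, coe_one_SU3]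
  have hg' : (g : Matrix (Fin 3) (Fin 3) ℂ) * ((g⁻¹ : SU3) : Matrix (Fin 3) (Fin 3) ℂ) = 1 := by
    rw [← coe_mul_SU3, mul_inv_cancel, coe_one_SU3]
  have hstar : ((g⁻¹ : SU3) : Matrix (Fin 3) (Fin 3) ℂ) =
      (g : Matrix (Fin 3) (Fin 3) ℂ).conjTranspose := rfl
  have htr : ∀ Z : Matrix (Fin 3) (Fin 3) ℂ, ((g : Matrix (Fin 3) (Fin 3) ℂ) * Z *
      ((g⁻¹ : SU3) : Matrix (Fin 3) (Fin 3) ℂ)).trace = Z.trace := fun Z => by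
    rw [Matrix.trace_mul_comm, ← mul_assoc, hg, one_mul]
  have htl : ∀ Z : Matrix (Fin 3) (Fin 3) ℂ, traceless ((g : Matrix (Fin 3) (Fin 3) ℂ) * Z *
      ((g⁻¹ : SU3) : Matrix (Fin 3) (Fin 3) ℂ)) = g * traceless Z * (g⁻¹ : SU3) := fun Z => by
    rw [traceless, traceless, htr, mul_sub, sub_mul, Matrix.mul_smul, Matrix.smul_mul, mul_one, hg']
  have hsk : ∀ Z : Matrix (Fin 3) (Fin 3) ℂ,
      (skew ((g : Matrix (Fin 3) (Fin 3) ℂ) * Z * ((g⁻¹ : SU3) : Matrix (Fin 3) (Fin 3) ℂ)) :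
        Matrix (Fin 3) (Fin 3) ℂ) = g * (skew Z) * (g⁻¹ : SU3) := fun Z => by
    rw [coe_skew, coe_skew, htl, hstar, Matrix.conjTranspose_mul, Matrix.conjTranspose_mul,
      Matrix.conjTranspose_conjTranspose, Matrix.mul_smul, Matrix.smul_mul, mul_sub, sub_mul,
      mul_assoc _ (traceless Z).conjTranspose]
  rw [op_apply, op_apply, mul_sub, sub_mul, mul_smul_comm, smul_mul_assoc,
    ρ.toCLM_mul_deriv_mul g _ _ (hsk Z), ρ.toCLM_mul_deriv_mul g _ _ (hsk (Complex.I • Z)),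
    Matrix.mul_smul, Matrix.smul_mul]

-- Differentiating the equivariance `ρ(g) Z ρ(g)⁻¹ = Ad(g) Z` along `g = exp(tA)` at `t = 0`.
open scoped Matrix.Norms.L2Operator in
theorem deriv_commutator (ρ : UnitaryRep SU3 W) (A : su3) (Z : Matrix (Fin 3) (Fin 3) ℂ) :
    ρ.deriv A * ρ.op Z - ρ.op Z * ρ.deriv A = ρ.op (A * Z - Z * A) := by
  have h1 : HasDerivAt (fun t : ℝ => ρ.toCLM (expSU (t • A)) * ρ.op Z * ρ.toCLM (expSU (t • A))⁻¹)
      (ρ.deriv A * ρ.op Z - ρ.op Z * ρ.deriv A) 0 := by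
    have h2 : HasDerivAt (fun t : ℝ => ρ.toCLM (expSU (t • A))⁻¹) (-ρ.deriv A) 0 := by
      have h3 := ρ.hasDerivAt (-A)
      rw [deriv_neg] at h3
      refine h3.congr_of_eventuallyEq (Eventually.of_forall fun t => ?_)
      dsimp only
      rw [← expSU_neg_smul, su3_smul_neg, su3_neg_smul]
    have h := ((ρ.hasDerivAt A).mul_const (ρ.op Z)).fun_mul h2
    rw [expSU_zero_smul, inv_one, toCLM_one, one_mul, mul_one, mul_neg, ← sub_eq_add_neg] at h
    exact h
  have h4 := ((LinearMap.toContinuousLinearMap ρ.op).restrictScalars ℝ).hasFDerivAt.comp_hasDerivAt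
    (0 : ℝ) (hasDerivAt_expSU_conj A Z)
  refine h1.unique (h4.congr_of_eventuallyEq (Eventually.of_forall fun t => ?_))
  exact ρ.toCLM_mul_op_mul _ Z

/-- A matrix is a scalar plus `A - i B` with `A`, `B` in `𝔰𝔲(3)`. The scalar part drops out of both
commutators, and the rest follows by linearity. -/
theorem op_commutator (ρ : UnitaryRep SU3 W) (Z Z' : Matrix (Fin 3) (Fin 3) ℂ) :
    ρ.op Z * ρ.op Z' - ρ.op Z' * ρ.op Z = ρ.op (Z * Z' - Z' * Z) := by
  have hZ : Z = (Z.trace / 3) • (1 : Matrix (Fin 3) (Fin 3) ℂ) +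
      ((skew Z : Matrix (Fin 3) (Fin 3) ℂ) - Complex.I • (skew (Complex.I • Z) : Matrix _ _ ℂ)) := by
    rw [skew_add_I_smul, traceless]; abel
  have h : ρ.op (Z * Z' - Z' * Z) = ρ.op ((skew Z) * Z' - Z' * (skew Z)) -
      Complex.I • ρ.op ((skew (Complex.I • Z)) * Z' - Z' * (skew (Complex.I • Z))) := by
    rw [← map_smul, ← map_sub]
    conv_lhs => rw [hZ]
    congr 1
    simp only [add_mul, sub_mul, mul_add, mul_sub, Matrix.smul_mul, Matrix.mul_smul, one_mul,
      mul_one, smul_sub]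
    abel
  rw [h, ← deriv_commutator, ← deriv_commutator, op_apply ρ Z]
  simp only [sub_mul, mul_sub, smul_mul_assoc, mul_smul_comm, smul_sub]
  abel

end UnitaryRep

end ComplexAction

end HarmonicSU3
end

noncomputable section

namespace HarmonicSU3

/-! ### Matrix units and the Casimir operator -/

section Casimir

variable {W : Type*} [NormedAddCommGroup W] [InnerProductSpace ℂ W] [FiniteDimensional ℂ W]

namespace UnitaryRep

/-- The action of the matrix unit `E_{ab}`. -/
def unit (ρ : UnitaryRep SU3 W) (a b : Fin 3) : W →L[ℂ] W := ρ.op (Matrix.single a b 1)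

theorem star_unit [CompleteSpace W] (ρ : UnitaryRep SU3 W) (a b : Fin 3) :
    star (ρ.unit a b) = ρ.unit b a := by
  rw [unit, star_op, Matrix.conjTranspose_single, star_one]
  rfl

theorem op_eq_sum_unit (ρ : UnitaryRep SU3 W) (Z : Matrix (Fin 3) (Fin 3) ℂ) :
    ρ.op Z = ∑ a, ∑ b, Z a b • ρ.unit a b := by
  conv_lhs => rw [Matrix.matrix_eq_sum_single Z]
  simp only [map_sum]
  refine Finset.sum_congr rfl fun a _ => Finset.sum_congr rfl fun b _ => ?_
  rw [unit, ← map_smul, Matrix.smul_single, smul_eq_mul, mul_one]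

/-- Since scalar matrices act by zero, the relations of `𝔤𝔩(3)` hold for all nine matrix units,
including the diagonal ones that are not traceless. -/
theorem unit_commutator (ρ : UnitaryRep SU3 W) (a b c d : Fin 3) :
    ρ.unit a b * ρ.unit c d - ρ.unit c d * ρ.unit a b =
      (if b = c then ρ.unit a d else 0) - (if d = a then ρ.unit c b else 0) := by
  rw [unit, unit, op_commutator, map_sub]
  congr 1
  · split_ifs with h
    · subst h; rw [Matrix.single_mul_single_same, mul_one]; rfl
    · rw [Matrix.single_mul_single_of_ne _ _ _ _ h, map_zero]
  · split_ifs with h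
    · subst h; rw [Matrix.single_mul_single_same, mul_one]; rfl
    · rw [Matrix.single_mul_single_of_ne _ _ _ _ h, map_zero]

/-- The Casimir operator. -/
def casimir (ρ : UnitaryRep SU3 W) : W →L[ℂ] W := ∑ a, ∑ b, ρ.unit a b * ρ.unit b a

theorem sum_smul_eq_of_mul_eq_one {M : Type*} [AddCommGroup M] [Module ℂ M]
    {g h : Matrix (Fin 3) (Fin 3) ℂ} (hgh : g * h = 1) (F : Fin 3 → Fin 3 → M) :
    ∑ a, ∑ c, ∑ f, (g c a * h a f) • F c f = ∑ c, F c c := by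
  rw [Finset.sum_comm]
  refine Finset.sum_congr rfl fun c _ => ?_
  rw [Finset.sum_comm]
  simp only [← Finset.sum_smul, ← Matrix.mul_apply, hgh, Matrix.one_apply, ite_smul, one_smul,
    zero_smul]
  simp

/-- Conjugation by `k` transforms the first index of `E_ab` by `k` and the second by `k⁻¹`. In `∑
E_ab E_ba` each summation index occurs once in each role, so the two matrices contract to the
identity. -/
theorem casimir_commute (ρ : UnitaryRep SU3 W) (k : SU3) :
    ρ.toCLM k * ρ.casimir = ρ.casimir * ρ.toCLM k := by
  obtain ⟨g, hg⟩ : ∃ g : Matrix (Fin 3) (Fin 3) ℂ, g = k.1 := ⟨_, rfl⟩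
  obtain ⟨h, hh⟩ : ∃ h : Matrix (Fin 3) (Fin 3) ℂ, h = (k⁻¹ : SU3).1 := ⟨_, rfl⟩
  have hgh : g * h = 1 := by rw [hg, hh, ← coe_mul_SU3, mul_inv_cancel, coe_one_SU3]
  have hconj : ∀ a b, ρ.toCLM k * ρ.unit a b * ρ.toCLM k⁻¹ =
      ∑ c, ∑ d, (g c a * h b d) • ρ.unit c d := fun a b => by
    rw [unit, toCLM_mul_op_mul, op_eq_sum_unit]
    refine Finset.sum_congr rfl fun c _ => Finset.sum_congr rfl fun d _ => ?_
    congr 1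
    rw [← hg, ← hh, Matrix.mul_apply, Finset.sum_eq_single b]
    · simp
    · intro x _ hx
      simp [hx]
    · simp
  have hprod : ∀ X Y : W →L[ℂ] W, ρ.toCLM k * (X * Y) * ρ.toCLM k⁻¹ =
      (ρ.toCLM k * X * ρ.toCLM k⁻¹) * (ρ.toCLM k * Y * ρ.toCLM k⁻¹) := fun X Y => by
    have := ρ.toCLM_inv_mul k
    calc _ = ρ.toCLM k * X * 1 * Y * ρ.toCLM k⁻¹ := by noncomm_ring
      _ = _ := by rw [← this]; noncomm_ring
  have hinv : ρ.toCLM k * ρ.casimir * ρ.toCLM k⁻¹ = ρ.casimir := by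
    rw [casimir]
    simp only [Finset.mul_sum, Finset.sum_mul]
    simp only [hprod, hconj]
    have h1 : ∀ a b, (∑ c, ∑ d, (g c a * h b d) • ρ.unit c d) *
        (∑ e, ∑ f, (g e b * h a f) • ρ.unit e f) =
        ∑ c, ∑ f, (g c a * h a f) • ((∑ d, h b d • ρ.unit c d) * (∑ e, g e b • ρ.unit e f)) := by
      intro a b
      have e1 : ∑ c, ∑ d, (g c a * h b d) • ρ.unit c d =
          ∑ c, g c a • ∑ d, h b d • ρ.unit c d := by
        simp only [mul_smul, Finset.smul_sum]
      have e2 : ∑ e, ∑ f, (g e b * h a f) • ρ.unit e f =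
          ∑ f, h a f • ∑ e, g e b • ρ.unit e f := by
        rw [Finset.sum_comm]
        simp only [mul_comm (g _ _), mul_smul, Finset.smul_sum]
      rw [e1, e2, Finset.sum_mul_sum]
      refine Finset.sum_congr rfl fun c _ => Finset.sum_congr rfl fun f _ => ?_
      rw [smul_mul_smul_comm]
    simp only [h1]
    rw [Finset.sum_comm]
    simp only [sum_smul_eq_of_mul_eq_one hgh]
    rw [Finset.sum_comm]
    refine Finset.sum_congr rfl fun c _ => ?_
    have h2 : ∀ b, (∑ d, h b d • ρ.unit c d) * (∑ e, g e b • ρ.unit e c) =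
        ∑ e, ∑ d, (g e b * h b d) • (ρ.unit c d * ρ.unit e c) := fun b => by
      rw [Finset.sum_mul_sum, Finset.sum_comm]
      refine Finset.sum_congr rfl fun e _ => Finset.sum_congr rfl fun d _ => ?_
      rw [smul_mul_smul_comm, mul_comm]
    simp only [h2]
    exact sum_smul_eq_of_mul_eq_one hgh fun e d => ρ.unit c d * ρ.unit e c
  calc ρ.toCLM k * ρ.casimir = ρ.toCLM k * ρ.casimir * (ρ.toCLM k⁻¹ * ρ.toCLM k) := by
        rw [toCLM_inv_mul, mul_one]
    _ = ρ.casimir * ρ.toCLM k := by rw [← mul_assoc, hinv]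

/-- The adjoint of `E_ab` is `E_ba`, so every summand of the Casimir operator has the form `T* T`.
This gives both the sign of its eigenvalue and a norm bound for all matrix units. -/
theorem inner_casimir [CompleteSpace W] (ρ : UnitaryRep SU3 W) (x : W) :
    inner ℂ x (ρ.casimir x) = ((∑ a, ∑ b, ‖ρ.unit b a x‖ ^ 2 : ℝ) : ℂ) := by
  rw [casimir, _root_.sum_apply, inner_sum, Complex.ofReal_sum]
  refine Finset.sum_congr rfl fun a _ => ?_
  rw [_root_.sum_apply, inner_sum, Complex.ofReal_sum]
  refine Finset.sum_congr rfl fun b _ => ?_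
  change inner ℂ x (ρ.unit a b (ρ.unit b a x)) = _
  rw [← ContinuousLinearMap.adjoint_inner_left,
    ← ContinuousLinearMap.star_eq_adjoint, star_unit, inner_self_eq_norm_sq_to_K,
    Complex.ofReal_pow]
  rfl

/-- The Casimir operator of an irreducible representation is a nonnegative scalar. -/
theorem exists_casimir_eq_smul [CompleteSpace W] (ρ : UnitaryRep SU3 W)
    (hρ : ρ.IsMinimalInvariant ⊤) : ∃ κ : ℝ, 0 ≤ κ ∧ ρ.casimir = (κ : ℂ) • 1 := by
  have : Nontrivial W := by
    by_contra h
    rw [not_nontrivial_iff_subsingleton] at h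
    exact hρ.ne_bot (Subsingleton.elim _ _)
  obtain ⟨c, hc⟩ := Module.End.exists_eigenvalue ρ.casimir.toLinearMap
  -- An eigenspace of an operator commuting with the group is invariant, hence everything by
  -- minimality.
  have htop : Module.End.eigenspace ρ.casimir.toLinearMap c = ⊤ := by
    refine hρ.eq_of_le _ le_top (fun g x hx => ?_) hc
    rw [Module.End.mem_eigenspace_iff] at hx ⊢
    change ρ.casimir (ρ.toCLM g x) = _
    have h1 := congrArg (fun k => k x) (ρ.casimir_commute g)
    change ρ.toCLM g (ρ.casimir x) = ρ.casimir (ρ.toCLM g x) at h1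
    rw [← h1, show ρ.casimir x = c • x from hx, map_smul]
    rfl
  have hcx : ∀ x, ρ.casimir x = c • x := fun x => by
    have : x ∈ Module.End.eigenspace ρ.casimir.toLinearMap c := by rw [htop]; trivial
    exact Module.End.mem_eigenspace_iff.1 this
  obtain ⟨x, hx⟩ := exists_ne (0 : W)
  have hxn : (0 : ℝ) < ‖x‖ ^ 2 := by positivity
  have h := ρ.inner_casimir x
  rw [hcx, inner_smul_right, inner_self_eq_norm_sq_to_K] at h
  have hck : c = ((∑ a, ∑ b, ‖ρ.unit b a x‖ ^ 2) / ‖x‖ ^ 2 : ℝ) := by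
    push_cast at h ⊢
    rw [← h]
    have : (‖x‖ : ℂ) ≠ 0 := by exact_mod_cast (norm_pos_iff.2 hx).ne'
    simp only [Complex.coe_algebraMap]
    field_simp
  refine ⟨(∑ a, ∑ b, ‖ρ.unit b a x‖ ^ 2) / ‖x‖ ^ 2, by positivity, ?_⟩
  ext y
  rw [hcx, hck]
  rfl

/-- `‖E_ab x‖²` is one of the nonnegative summands of `⟨x, C x⟩ = κ ‖x‖²`, where `C` is the Casimir
operator. Consequently `κ^(-1/2) E_ab` is bounded uniformly over all irreducible blocks. -/
theorem norm_unit_le [CompleteSpace W] {ρ : UnitaryRep SU3 W} {κ : ℝ}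
    (hκ : ρ.casimir = (κ : ℂ) • 1) (a b : Fin 3) : ‖ρ.unit a b‖ ≤ √κ := by
  refine ContinuousLinearMap.opNorm_le_bound _ (Real.sqrt_nonneg _) fun x => ?_
  have h := ρ.inner_casimir x
  rw [hκ, _root_.smul_apply, one_apply_eq_self, inner_smul_right,
    inner_self_eq_norm_sq_to_K] at h
  have h' : κ * ‖x‖ ^ 2 = ∑ a, ∑ b, ‖ρ.unit b a x‖ ^ 2 := by
    apply Complex.ofReal_injective
    rw [← h, Complex.ofReal_mul, Complex.ofReal_pow]
    rfl
  have hle : ‖ρ.unit a b x‖ ^ 2 ≤ κ * ‖x‖ ^ 2 := by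
    rw [h']
    refine le_trans ?_ (Finset.single_le_sum (f := fun b => ∑ a, ‖ρ.unit a b x‖ ^ 2)
      (fun _ _ => by positivity) (Finset.mem_univ b))
    exact Finset.single_le_sum (f := fun a => ‖ρ.unit a b x‖ ^ 2)
      (fun _ _ => by positivity) (Finset.mem_univ a)
  by_cases hx : x = 0
  · simp [hx]
  have hxn : 0 < ‖x‖ := norm_pos_iff.2 hx
  have hκ0 : 0 ≤ κ := by
    by_contra! hneg
    nlinarith [sq_nonneg ‖ρ.unit a b x‖, mul_pos hxn hxn]
  refine (abs_le_of_sq_le_sq' ?_ (by positivity)).2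
  rw [mul_pow, Real.sq_sqrt hκ0]
  exact hle

end UnitaryRep

theorem UnitaryRep.IsMinimalInvariant.sub {G : Type*} [Group G] [TopologicalSpace G] {H : Type*}
    [NormedAddCommGroup H] [InnerProductSpace ℂ H] {π : UnitaryRep G H} {U : Submodule ℂ H}
    (hU : π.IsMinimalInvariant U) : (π.sub U hU.invariant).IsMinimalInvariant ⊤ where
  ne_bot h := hU.ne_bot <| (Submodule.eq_bot_iff _).2 fun x hx => by
    have h1 : (⟨x, hx⟩ : U) ∈ (⊤ : Submodule ℂ U) := trivial
    rw [h] at h1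
    exact congrArg Subtype.val ((Submodule.mem_bot ℂ).1 h1)
  invariant _ _ _ := trivial
  eq_of_le P _ hP hP0 := by
    have h := hU.eq_of_le (P.map U.subtype) (Submodule.map_subtype_le U P) (by
      rintro g _ ⟨x, hx, rfl⟩
      exact ⟨_, hP g x hx, rfl⟩) (fun h => hP0 <| by
        rw [Submodule.eq_bot_iff] at h ⊢
        exact fun x hx => Subtype.ext (h _ ⟨x, hx, rfl⟩))
    refine Submodule.eq_top_iff'.2 fun x => ?_
    have hx : (x : H) ∈ P.map U.subtype := by rw [h]; exact x.2
    obtain ⟨y, hy, hyx⟩ := hx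
    rwa [← Subtype.ext hyx]

end Casimir

end HarmonicSU3
end

noncomputable section

namespace HarmonicSU3

/-! ### Functional calculus of `Z* Z` in finite dimension -/

section GramCalculus

set_option linter.unusedSectionVars false

variable {W : Type*} [NormedAddCommGroup W] [InnerProductSpace ℂ W] [FiniteDimensional ℂ W]
  [CompleteSpace W]

theorem isSymmetric_star_mul_self (Z : W →L[ℂ] W) :
    (star Z * Z : W →L[ℂ] W).toLinearMap.IsSymmetric :=
  (IsSelfAdjoint.star_mul_self Z).isSymmetric

/-- An orthonormal basis of eigenvectors of `Z* Z`. -/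
def gramBasis (Z : W →L[ℂ] W) :
    OrthonormalBasis (Fin (Module.finrank ℂ W)) ℂ W :=
  (isSymmetric_star_mul_self Z).eigenvectorBasis rfl

/-- The eigenvalues of `Z* Z`. -/
def gramValue (Z : W →L[ℂ] W) (k : Fin (Module.finrank ℂ W)) : ℝ :=
  (isSymmetric_star_mul_self Z).eigenvalues rfl k

/-- The operator `f(Z* Z)`. -/
def gramFun (Z : W →L[ℂ] W) (f : ℝ → ℝ) : W →L[ℂ] W :=
  ∑ k, (f (gramValue Z k) : ℂ) • InnerProductSpace.rankOne ℂ (gramBasis Z k) (gramBasis Z k)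

theorem star_mul_self_gramBasis (Z : W →L[ℂ] W) (k : Fin (Module.finrank ℂ W)) :
    (star Z * Z) (gramBasis Z k) = (gramValue Z k : ℂ) • gramBasis Z k :=
  (isSymmetric_star_mul_self Z).apply_eigenvectorBasis rfl k

theorem inner_star_mul_self (Z : W →L[ℂ] W) (x y : W) :
    inner ℂ x ((star Z * Z) y) = inner ℂ (Z x) (Z y) := by
  change inner ℂ x (star Z (Z y)) = _
  rw [ContinuousLinearMap.star_eq_adjoint, ContinuousLinearMap.adjoint_inner_right]

theorem nonneg_of_eigen {Z : W →L[ℂ] W} {μ : ℝ} {x : W} (h : (star Z * Z) x = (μ : ℂ) • x)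
    (hx : x ≠ 0) : 0 ≤ μ := by
  have h1 := inner_star_mul_self Z x x
  rw [h, inner_smul_right, inner_self_eq_norm_sq_to_K, inner_self_eq_norm_sq_to_K] at h1
  have h2 : μ * ‖x‖ ^ 2 = ‖Z x‖ ^ 2 := Complex.ofReal_injective (by
    rw [Complex.ofReal_mul, Complex.ofReal_pow, Complex.ofReal_pow]; exact h1)
  have h3 : 0 < ‖x‖ ^ 2 := by positivity
  by_contra! hneg
  nlinarith [sq_nonneg ‖Z x‖]

theorem gramBasis_ne_zero (Z : W →L[ℂ] W) (k : Fin (Module.finrank ℂ W)) :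
    gramBasis Z k ≠ 0 := (gramBasis Z).orthonormal.ne_zero k

theorem gramFun_gramBasis (Z : W →L[ℂ] W) (f : ℝ → ℝ) (k : Fin (Module.finrank ℂ W)) :
    gramFun Z f (gramBasis Z k) = (f (gramValue Z k) : ℂ) • gramBasis Z k := by
  rw [gramFun, _root_.sum_apply, Finset.sum_eq_single k]
  · simp
  · intro j _ hj
    simp [(gramBasis Z).inner_eq_zero hj]
  · simp

/-- Operators that agree on all eigenvectors of `Z* Z` are equal. -/
theorem eq_of_eigen {E : Type*} [NormedAddCommGroup E] [NormedSpace ℂ E] (Z : W →L[ℂ] W)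
    {S T : W →L[ℂ] E}
    (h : ∀ (μ : ℝ) (x : W), 0 ≤ μ → (star Z * Z) x = (μ : ℂ) • x → S x = T x) : S = T := by
  have : S.toLinearMap = T.toLinearMap := (gramBasis Z).toBasis.ext fun k => by
    have hk := star_mul_self_gramBasis Z k
    simpa using h _ _ (nonneg_of_eigen hk (gramBasis_ne_zero Z k)) hk
  exact ContinuousLinearMap.coe_injective this

/-- The formula holds on every eigenvector, not only on the chosen basis, because a basis vector not
orthogonal to `x` has the same eigenvalue. With `eq_of_eigen`, identities for `gramFun` reduce to
scalars. -/
theorem gramFun_apply {Z : W →L[ℂ] W} (f : ℝ → ℝ) {μ : ℝ} {x : W}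
    (h : (star Z * Z) x = (μ : ℂ) • x) : gramFun Z f x = (f μ : ℂ) • x := by
  have hk : ∀ k, (gramValue Z k : ℂ) * inner ℂ (gramBasis Z k) x
      = (μ : ℂ) * inner ℂ (gramBasis Z k) x := fun k => by
    have h1 : inner ℂ (gramBasis Z k) ((star Z * Z) x) =
        inner ℂ ((star Z * Z) (gramBasis Z k)) x :=
      ((isSymmetric_star_mul_self Z) (gramBasis Z k) x).symm
    rw [h, star_mul_self_gramBasis, inner_smul_left, inner_smul_right, Complex.conj_ofReal] at h1
    exact h1.symm
  rw [gramFun, _root_.sum_apply]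
  conv_rhs => rw [← (gramBasis Z).sum_repr' x, Finset.smul_sum]
  refine Finset.sum_congr rfl fun k _ => ?_
  rw [_root_.smul_apply, InnerProductSpace.rankOne_apply]
  rcases eq_or_ne (inner ℂ (gramBasis Z k) x) 0 with h0 | h0
  · rw [h0]; simp
  · have h2 : gramValue Z k = μ := by exact_mod_cast mul_right_cancel₀ h0 (hk k)
    rw [h2]

/-- `S` carries eigenvectors of `Z* Z` to eigenvectors of `Z'* Z'` with the same eigenvalue, or to
zero. -/
theorem gramFun_intertwine {Z Z' : W →L[ℂ] W} {S : W →L[ℂ] W}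
    (h : S * (star Z * Z) = (star Z' * Z') * S) (f : ℝ → ℝ) :
    S * gramFun Z f = gramFun Z' f * S := by
  refine eq_of_eigen Z fun μ x _ hx => ?_
  change S (gramFun Z f x) = gramFun Z' f (S x)
  have h1 : (star Z' * Z') (S x) = (μ : ℂ) • S x := by
    have := congrArg (fun T => T x) h
    change S ((star Z * Z) x) = (star Z' * Z') (S x) at this
    rw [← this, hx, map_smul]
  rw [gramFun_apply f hx, map_smul, gramFun_apply f h1]

theorem gramFun_mul (Z : W →L[ℂ] W) (f g : ℝ → ℝ) :
    gramFun Z f * gramFun Z g = gramFun Z (fun x => f x * g x) := by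
  refine eq_of_eigen Z fun μ x _ hx => ?_
  change gramFun Z f (gramFun Z g x) = _
  rw [gramFun_apply g hx, map_smul, gramFun_apply f hx, gramFun_apply _ hx, smul_smul]
  push_cast
  rw [mul_comm]

theorem gramFun_congr {Z : W →L[ℂ] W} {f g : ℝ → ℝ} (h : ∀ x, 0 ≤ x → f x = g x) :
    gramFun Z f = gramFun Z g :=
  eq_of_eigen Z fun μ x h0 hx => by rw [gramFun_apply f hx, gramFun_apply g hx, h μ h0]

theorem gramFun_add (Z : W →L[ℂ] W) (f g : ℝ → ℝ) :
    gramFun Z (fun x => f x + g x) = gramFun Z f + gramFun Z g :=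
  eq_of_eigen Z fun μ x _ hx => by
    rw [_root_.add_apply, gramFun_apply _ hx, gramFun_apply _ hx, gramFun_apply _ hx, ← add_smul]
    push_cast; rfl

theorem gramFun_sub (Z : W →L[ℂ] W) (f g : ℝ → ℝ) :
    gramFun Z (fun x => f x - g x) = gramFun Z f - gramFun Z g :=
  eq_of_eigen Z fun μ x _ hx => by
    rw [_root_.sub_apply, gramFun_apply _ hx, gramFun_apply _ hx, gramFun_apply _ hx, ← sub_smul]
    push_cast; rfl

theorem gramFun_const (Z : W →L[ℂ] W) (c : ℝ) : gramFun Z (fun _ => c) = (c : ℂ) • 1 :=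
  eq_of_eigen Z fun μ x _ hx => by rw [gramFun_apply _ hx]; rfl

theorem gramFun_const_mul (Z : W →L[ℂ] W) (c : ℝ) (f : ℝ → ℝ) :
    gramFun Z (fun x => c * f x) = (c : ℂ) • gramFun Z f :=
  eq_of_eigen Z fun μ x _ hx => by
    rw [_root_.smul_apply, gramFun_apply _ hx, gramFun_apply _ hx, smul_smul]; push_cast; rfl

theorem gramFun_id (Z : W →L[ℂ] W) : gramFun Z (fun x => x) = star Z * Z :=
  eq_of_eigen Z fun μ x _ hx => by rw [gramFun_apply _ hx, hx]

theorem star_gramFun (Z : W →L[ℂ] W) (f : ℝ → ℝ) : star (gramFun Z f) = gramFun Z f := by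
  rw [gramFun, star_sum]
  refine Finset.sum_congr rfl fun k _ => ?_
  rw [star_smul, ContinuousLinearMap.star_eq_adjoint, InnerProductSpace.adjoint_rankOne]
  simp

theorem norm_gramFun_apply_sq (Z : W →L[ℂ] W) (f : ℝ → ℝ) (x : W) :
    ‖gramFun Z f x‖ ^ 2 = ∑ k, f (gramValue Z k) ^ 2 * ‖inner ℂ (gramBasis Z k) x‖ ^ 2 := by
  rw [← (gramBasis Z).sum_sq_norm_inner_right (gramFun Z f x)]
  refine Finset.sum_congr rfl fun k _ => ?_
  have h1 : inner ℂ (gramBasis Z k) (gramFun Z f x) = inner ℂ (gramFun Z f (gramBasis Z k)) x := by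
    rw [← ContinuousLinearMap.adjoint_inner_left, ← ContinuousLinearMap.star_eq_adjoint,
      star_gramFun]
  rw [h1, gramFun_gramBasis, inner_smul_left, norm_mul, mul_pow, Complex.conj_ofReal,
    Complex.norm_real, Real.norm_eq_abs, sq_abs]

/-- Pointwise comparison on the eigenvalues of `Z* Z`. -/
theorem norm_gramFun_apply_le {Z : W →L[ℂ] W} {f g : ℝ → ℝ}
    (h : ∀ (μ : ℝ) (x : W), x ≠ 0 → (star Z * Z) x = (μ : ℂ) • x → |f μ| ≤ |g μ|) (x : W) :
    ‖gramFun Z f x‖ ≤ ‖gramFun Z g x‖ := by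
  refine (abs_le_of_sq_le_sq' ?_ (norm_nonneg _)).2
  rw [norm_gramFun_apply_sq, norm_gramFun_apply_sq]
  refine Finset.sum_le_sum fun k _ => ?_
  refine mul_le_mul_of_nonneg_right ?_ (by positivity)
  exact sq_le_sq.2 (h _ _ (gramBasis_ne_zero Z k) (star_mul_self_gramBasis Z k))

theorem norm_gramFun_apply_le_const {Z : W →L[ℂ] W} {f : ℝ → ℝ} {c : ℝ} (hc : 0 ≤ c)
    (h : ∀ (μ : ℝ) (x : W), x ≠ 0 → (star Z * Z) x = (μ : ℂ) • x → |f μ| ≤ c) (x : W) :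
    ‖gramFun Z f x‖ ≤ c * ‖x‖ := by
  have h1 := norm_gramFun_apply_le (Z := Z) (f := f) (g := fun _ => c)
    (fun μ x hx hμ => (h μ x hx hμ).trans (le_abs_self c)) x
  rwa [gramFun_const, _root_.smul_apply, norm_smul, Complex.norm_real, Real.norm_eq_abs,
    abs_of_nonneg hc, one_apply_eq_self] at h1

/-- The modulus `|Z|`. -/
def modulus (Z : W →L[ℂ] W) : W →L[ℂ] W := gramFun Z Real.sqrt

/-- The phase of `Z`. -/
def phase (Z : W →L[ℂ] W) : W →L[ℂ] W := Z * gramFun Z (fun x => (√x)⁻¹)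

theorem modulus_mul_self (Z : W →L[ℂ] W) : modulus Z * modulus Z = star Z * Z := by
  rw [modulus, gramFun_mul, ← gramFun_id]
  exact gramFun_congr fun x hx => Real.mul_self_sqrt hx

theorem star_modulus (Z : W →L[ℂ] W) : star (modulus Z) = modulus Z := star_gramFun _ _

theorem norm_modulus_apply (Z : W →L[ℂ] W) (x : W) : ‖modulus Z x‖ = ‖Z x‖ := by
  have h : ∀ T : W →L[ℂ] W, inner ℂ x ((star T * T) x) = ((‖T x‖ ^ 2 : ℝ) : ℂ) := fun T => by
    rw [inner_star_mul_self, inner_self_eq_norm_sq_to_K]; simp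
  have h1 := h (modulus Z)
  rw [star_modulus, modulus_mul_self, h Z] at h1
  have h2 : ‖Z x‖ ^ 2 = ‖modulus Z x‖ ^ 2 := by exact_mod_cast h1
  exact ((sq_eq_sq₀ (norm_nonneg _) (norm_nonneg _)).1 h2).symm

/-- Since `‖Z y‖ = ‖|Z| y‖`, norms of `Z f(Z* Z)` are governed by the scalar function `√x f(x)`. -/
theorem norm_mul_gramFun_apply (Z : W →L[ℂ] W) (f : ℝ → ℝ) (x : W) :
    ‖(Z * gramFun Z f) x‖ = ‖gramFun Z (fun x => √x * f x) x‖ := by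
  rw [← gramFun_mul]
  exact (norm_modulus_apply Z _).symm

theorem inner_modulus_nonneg (Z : W →L[ℂ] W) (x : W) : 0 ≤ (inner ℂ (modulus Z x) x).re := by
  have h : modulus Z = gramFun Z (fun x => √(√x)) * gramFun Z (fun x => √(√x)) := by
    rw [gramFun_mul]
    exact gramFun_congr fun x _ => (Real.mul_self_sqrt (Real.sqrt_nonneg x)).symm
  have h2 : inner ℂ (modulus Z x) x = inner ℂ (gramFun Z (fun x => √(√x)) x)
      (gramFun Z (fun x => √(√x)) x) := by
    rw [h, ← ContinuousLinearMap.adjoint_inner_left, ← ContinuousLinearMap.star_eq_adjoint,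
      star_gramFun]
    rfl
  rw [h2]
  exact inner_self_nonneg (𝕜 := ℂ)

/-- On the kernel of `Z` both sides vanish; the convention `0⁻¹ = 0` also makes `phase Z` vanish
there, so no case distinction enters its definition. -/
theorem phase_mul_modulus (Z : W →L[ℂ] W) : phase Z * modulus Z = Z := by
  refine eq_of_eigen Z fun μ x h0 hx => ?_
  change Z (gramFun Z (fun x => (√x)⁻¹) (gramFun Z Real.sqrt x)) = Z x
  rw [gramFun_apply _ hx, map_smul, gramFun_apply _ hx, smul_smul, map_smul]
  rcases h0.eq_or_lt with rfl | h
  · have : Z x = 0 := by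
      have h1 := inner_star_mul_self Z x x
      rw [hx] at h1
      simpa using h1.symm
    rw [this, smul_zero]
  · have : (√μ : ℂ) * ((√μ)⁻¹ : ℝ) = 1 := by
      rw [← Complex.ofReal_mul, mul_inv_cancel₀ (Real.sqrt_pos.2 h).ne', Complex.ofReal_one]
    rw [this, one_smul]

/-- `Z* f(Z Z*) = f(Z* Z) Z*`. Hence a statement proved for the phase of each of two opposite root
vectors covers rows as well as columns. -/
theorem star_phase (Z : W →L[ℂ] W) : star (phase Z) = phase (star Z) := by
  rw [phase, star_mul, star_gramFun, phase]
  refine (gramFun_intertwine ?_ _).symm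
  rw [star_star, mul_assoc]

theorem star_phase_mul (Z : W →L[ℂ] W) : star (phase Z) * Z = modulus Z := by
  rw [phase, star_mul, star_gramFun, mul_assoc, ← gramFun_id, gramFun_mul]
  exact gramFun_congr fun x hx => by
    rcases hx.eq_or_lt with rfl | h
    · simp
    · rw [inv_mul_eq_div, Real.div_sqrt]

theorem phase_mul_star_mul_phase (Z : W →L[ℂ] W) :
    phase Z * star (phase Z) * phase Z = phase Z := by
  have h : star (phase Z) * phase Z = gramFun Z (fun x => √x * (√x)⁻¹) := by
    rw [← gramFun_mul]
    conv_lhs => rw [show phase Z = Z * gramFun Z (fun x => (√x)⁻¹) from rfl]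
    rw [← mul_assoc]
    congr 1
    exact star_phase_mul Z
  rw [mul_assoc, h, phase, mul_assoc, gramFun_mul]
  congr 1
  exact gramFun_congr fun x hx => by
    rcases eq_or_ne (√x) 0 with h | h
    · simp [h]
    · field_simp

theorem norm_phase_apply_le (Z : W →L[ℂ] W) (x : W) : ‖phase Z x‖ ≤ ‖x‖ := by
  rw [phase, norm_mul_gramFun_apply]
  refine (norm_gramFun_apply_le_const zero_le_one (fun μ x hx hμ => ?_) x).trans (one_mul _).le
  rcases eq_or_ne (√μ) 0 with h | h
  · simp [h]
  · rw [mul_inv_cancel₀ h, abs_one]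

theorem phase_apply_eq_zero_iff (Z : W →L[ℂ] W) (x : W) : phase Z x = 0 ↔ Z x = 0 := by
  rw [← norm_eq_zero, phase, norm_mul_gramFun_apply, norm_eq_zero, ← norm_eq_zero (a := Z x),
    ← norm_modulus_apply, norm_eq_zero, modulus]
  constructor
  · intro h
    have h1 : gramFun Z Real.sqrt =
        gramFun Z Real.sqrt * gramFun Z (fun x => √x * (√x)⁻¹) := by
      rw [gramFun_mul]
      exact gramFun_congr fun x hx => by
        rcases eq_or_ne (√x) 0 with h | h
        · simp [h]
        · field_simp
    rw [h1]
    exact (congrArg (gramFun Z Real.sqrt) h).trans (map_zero _)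
  · intro h
    rw [show (fun x => √x * (√x)⁻¹) = fun x => (√x)⁻¹ * √x from funext fun x => mul_comm _ _,
      ← gramFun_mul]
    change gramFun Z _ (gramFun Z Real.sqrt x) = 0
    rw [h, map_zero]

end GramCalculus

end HarmonicSU3
end

noncomputable section

namespace HarmonicSU3

/-! ### Orthogonal decompositions into finite-dimensional blocks -/

section Blocks

set_option linter.unusedSectionVars false

/-- An orthogonal decomposition of a Hilbert space into finite-dimensional subspaces. -/
structure Blocks (H : Type u) [NormedAddCommGroup H] [InnerProductSpace ℂ H] where
  ι : Type u
  W : ι → Submodule ℂ H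
  finite : ∀ i, FiniteDimensional ℂ (W i)
  orth : Pairwise fun i j => W i ⟂ W j
  total : (⨆ i, W i)ᗮ = ⊥

variable {H : Type u} [NormedAddCommGroup H] [InnerProductSpace ℂ H]

namespace Blocks

instance instFiniteDimensional (D : Blocks H) (i : D.ι) : FiniteDimensional ℂ (D.W i) :=
  D.finite i

instance instCompleteSpace (D : Blocks H) (i : D.ι) : CompleteSpace (D.W i) :=
  FiniteDimensional.complete ℂ _

/-- The component of a vector in a block. -/
def comp (D : Blocks H) (i : D.ι) : H →L[ℂ] D.W i := (D.W i).orthogonalProjectionOnto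

theorem comp_coe (D : Blocks H) (i : D.ι) (x : D.W i) : D.comp i x = x :=
  Submodule.orthogonalProjectionOnto_mem_subspace_eq_self x

theorem comp_of_mem_orthogonal (D : Blocks H) (i : D.ι) {x : H} (hx : x ∈ (D.W i)ᗮ) :
    D.comp i x = 0 :=
  Submodule.orthogonalProjectionOnto_apply_of_mem_orthogonal hx

theorem comp_coe_of_ne (D : Blocks H) {i j : D.ι} (h : i ≠ j) (x : D.W j) :
    D.comp i (x : H) = 0 :=
  D.comp_of_mem_orthogonal i ((D.orth h.symm) x.2)

theorem inner_comp (D : Blocks H) (i : D.ι) (x : D.W i) (y : H) :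
    inner ℂ x (D.comp i y) = inner ℂ (x : H) y :=
  Submodule.inner_orthogonalProjectionOnto_eq_of_mem_left x y

variable [CompleteSpace H] (D : Blocks H)

theorem orthogonalFamily : OrthogonalFamily ℂ (fun i => D.W i) fun i => (D.W i).subtypeₗᵢ :=
  OrthogonalFamily.of_pairwise D.orth

theorem isHilbertSum : IsHilbertSum ℂ (fun i => D.W i) fun i => (D.W i).subtypeₗᵢ :=
  IsHilbertSum.mkInternal _ D.orthogonalFamily (by
    rw [← Submodule.orthogonal_orthogonal_eq_closure, D.total, Submodule.bot_orthogonal_eq_top])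

theorem comp_eq (x : H) (i : D.ι) : D.comp i x = D.isHilbertSum.linearIsometryEquiv x i := by
  have h := D.isHilbertSum.hasSum_linearIsometryEquiv_symm (D.isHilbertSum.linearIsometryEquiv x)
  rw [LinearIsometryEquiv.symm_apply_apply] at h
  have h1 := h.mapL (D.comp i)
  have h2 : HasSum (fun j => D.comp i (D.isHilbertSum.linearIsometryEquiv x j : H))
      (D.comp i (D.isHilbertSum.linearIsometryEquiv x i : H)) :=
    hasSum_single i fun j hj => D.comp_coe_of_ne hj.symm _
  rw [h1.unique h2, comp_coe]

theorem hasSum_comp (x : H) : HasSum (fun i => (D.comp i x : H)) x := by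
  have h := D.isHilbertSum.hasSum_linearIsometryEquiv_symm (D.isHilbertSum.linearIsometryEquiv x)
  rw [LinearIsometryEquiv.symm_apply_apply] at h
  simp only [comp_eq]
  exact h

theorem hasSum_inner_comp (x y : H) :
    HasSum (fun i => inner ℂ (D.comp i x) (D.comp i y)) (inner ℂ x y) := by
  have h := lp.hasSum_inner (𝕜 := ℂ) (D.isHilbertSum.linearIsometryEquiv x)
    (D.isHilbertSum.linearIsometryEquiv y)
  rw [LinearIsometryEquiv.inner_map_map] at h
  simpa only [comp_eq] using h

theorem hasSum_norm_comp (x : H) : HasSum (fun i => ‖D.comp i x‖ ^ 2) (‖x‖ ^ 2) := by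
  have h := (D.hasSum_inner_comp x x).mapL Complex.reCLM
  simpa only [Complex.reCLM_apply, inner_self_eq_norm_sq_to_K, ← Complex.ofReal_pow,
    Complex.coe_algebraMap, Complex.ofReal_re] using h

variable {D} in
theorem ext_comp {x y : H} (h : ∀ i, D.comp i x = D.comp i y) : x = y :=
  (D.hasSum_comp x).unique (by simpa only [h] using D.hasSum_comp y)

theorem exists_comp_eq (f : ∀ i, D.W i) (hf : Summable fun i => ‖f i‖ ^ 2) :
    ∃ x, ∀ i, D.comp i x = f i := by
  have h : Summable fun i => (f i : H) :=
    (D.orthogonalFamily.summable_iff_norm_sq_summable f).2 hf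
  refine ⟨∑' i, (f i : H), fun i => ?_⟩
  have h1 := h.hasSum.mapL (D.comp i)
  have h2 : HasSum (fun j => D.comp i (f j : H)) (D.comp i (f i : H)) :=
    hasSum_single i fun j hj => D.comp_coe_of_ne hj.symm _
  rw [h1.unique h2, comp_coe]

/-- `T` acts on the blocks by the operators `B i`. -/
def IsDiag (T : H →L[ℂ] H) (B : ∀ i, D.W i →L[ℂ] D.W i) : Prop :=
  ∀ x i, D.comp i (T x) = B i (D.comp i x)

variable {D}

theorem norm_apply_le_of_isDiag {T : H →L[ℂ] H} {B : ∀ i, D.W i →L[ℂ] D.W i}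
    (hT : D.IsDiag T B) {ε : ℝ} (hε : 0 ≤ ε) {x : H}
    (h : ∀ i, ‖B i (D.comp i x)‖ ≤ ε * ‖D.comp i x‖) : ‖T x‖ ≤ ε * ‖x‖ := by
  refine (abs_le_of_sq_le_sq' ?_ (by positivity)).2
  rw [mul_pow]
  refine hasSum_le (fun i => ?_) (D.hasSum_norm_comp (T x))
    ((D.hasSum_norm_comp x).mul_left (ε ^ 2))
  rw [hT, ← mul_pow]
  exact pow_le_pow_left₀ (norm_nonneg _) (h i) 2

variable (D) in
theorem exists_isDiag (B : ∀ i, D.W i →L[ℂ] D.W i) {M : ℝ} (hB : ∀ i, ‖B i‖ ≤ M) :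
    ∃ T, D.IsDiag T B := by
  have hM : ∀ i x, ‖B i x‖ ^ 2 ≤ M ^ 2 * ‖x‖ ^ 2 := fun i x => by
    rw [← mul_pow]
    exact pow_le_pow_left₀ (norm_nonneg _) (((B i).le_opNorm x).trans
      (mul_le_mul_of_nonneg_right (hB i) (norm_nonneg _))) 2
  have hex : ∀ x, ∃ y, ∀ i, D.comp i y = B i (D.comp i x) := fun x =>
    D.exists_comp_eq _ (Summable.of_nonneg_of_le (fun _ => by positivity) (fun i => hM i _)
      ((D.hasSum_norm_comp x).summable.mul_left _))
  choose F hF using hex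
  let L : H →ₗ[ℂ] H :=
    { toFun := F
      map_add' := fun x y => ext_comp (D := D) fun i => by simp only [hF, map_add]
      map_smul' := fun c x => ext_comp (D := D) fun i => by simp only [hF, map_smul, RingHom.id_apply] }
  refine ⟨L.mkContinuous |M| fun x => ?_, fun x i => hF x i⟩
  refine (abs_le_of_sq_le_sq' ?_ (by positivity)).2
  rw [mul_pow, sq_abs]
  refine hasSum_le (fun i => ?_) (D.hasSum_norm_comp (F x))
    ((D.hasSum_norm_comp x).mul_left (M ^ 2))
  rw [hF]
  exact hM i _

namespace IsDiag

variable {T T' : H →L[ℂ] H} {B B' : ∀ i, D.W i →L[ℂ] D.W i}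

theorem unique (h : D.IsDiag T B) (h' : D.IsDiag T' B) : T = T' :=
  ContinuousLinearMap.ext fun x => ext_comp fun i => by rw [h, h']

theorem apply_coe (h : D.IsDiag T B) (i : D.ι) (x : D.W i) : T x = B i x :=
  ext_comp fun j => by
    rw [h]
    by_cases hij : j = i
    · subst hij; rw [comp_coe, comp_coe]
    · rw [comp_coe_of_ne _ hij, comp_coe_of_ne _ hij, map_zero]

theorem mul (h : D.IsDiag T B) (h' : D.IsDiag T' B') :
    D.IsDiag (T * T') (fun i => B i * B' i) := fun x i => by
  change D.comp i (T (T' x)) = B i (B' i _)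
  rw [h, h']

theorem add (h : D.IsDiag T B) (h' : D.IsDiag T' B') :
    D.IsDiag (T + T') (fun i => B i + B' i) := fun x i => by
  simp only [_root_.add_apply, map_add, h x i, h' x i]

theorem sub (h : D.IsDiag T B) (h' : D.IsDiag T' B') :
    D.IsDiag (T - T') (fun i => B i - B' i) := fun x i => by
  simp only [_root_.sub_apply, map_sub, h x i, h' x i]

theorem smul (c : ℂ) (h : D.IsDiag T B) : D.IsDiag (c • T) (fun i => c • B i) := fun x i => by
  simp only [_root_.smul_apply, map_smul, h x i]

theorem star (h : D.IsDiag T B) : D.IsDiag (star T) (fun i => star (B i)) := fun x i => by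
  refine ext_inner_left ℂ fun y => ?_
  beta_reduce
  rw [inner_comp, ContinuousLinearMap.star_eq_adjoint, ContinuousLinearMap.adjoint_inner_right,
    ContinuousLinearMap.star_eq_adjoint, ContinuousLinearMap.adjoint_inner_right, h.apply_coe,
    inner_comp]

end IsDiag

/-! #### Unbounded block diagonal operators -/

variable (D) in
/-- The graph of the maximal operator acting by `B i` on the blocks. -/
def diagGraph (B : ∀ i, D.W i →L[ℂ] D.W i) : Submodule ℂ (H × H) where
  carrier := {p | ∀ i, D.comp i p.2 = B i (D.comp i p.1)}
  zero_mem' i := by simp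
  add_mem' h h' i := by simp only [Prod.fst_add, Prod.snd_add, map_add, h i, h' i]
  smul_mem' c p h i := by simp only [Prod.smul_fst, Prod.smul_snd, map_smul, h i]

variable (D) in
/-- The maximal operator acting by `B i` on the blocks. -/
def pmap (B : ∀ i, D.W i →L[ℂ] D.W i) : H →ₗ.[ℂ] H := (D.diagGraph B).toLinearPMap

variable {B C : ∀ i, D.W i →L[ℂ] D.W i}

theorem graph_pmap : (D.pmap B).graph = D.diagGraph B :=
  Submodule.toLinearPMap_graph_eq _ fun p hp h0 => ext_comp fun i => by
    rw [hp i, h0, map_zero, map_zero]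

theorem mem_graph_pmap {x y : H} :
    (x, y) ∈ (D.pmap B).graph ↔ ∀ i, D.comp i y = B i (D.comp i x) := by
  rw [graph_pmap]; rfl

theorem coe_mem_graph_pmap (B : ∀ i, D.W i →L[ℂ] D.W i) (i : D.ι) (x : D.W i) :
    ((x : H), (B i x : H)) ∈ (D.pmap B).graph := by
  rw [mem_graph_pmap]
  intro j
  by_cases hij : j = i
  · subst hij; rw [comp_coe, comp_coe]
  · rw [comp_coe_of_ne _ hij, comp_coe_of_ne _ hij, map_zero]

theorem isClosed_pmap : (D.pmap B).IsClosed := by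
  rw [LinearPMap.IsClosed, graph_pmap]
  have : ((D.diagGraph B : Submodule ℂ (H × H)) : Set (H × H)) =
      ⋂ i, {p | D.comp i p.2 = B i (D.comp i p.1)} := by
    ext p; simp only [Set.mem_iInter]; rfl
  rw [this]
  exact isClosed_iInter fun i => isClosed_eq (by fun_prop) (by fun_prop)

variable (D) in
theorem dense_iSup : Dense ((⨆ i, D.W i : Submodule ℂ H) : Set H) := by
  rw [Submodule.dense_iff_topologicalClosure_eq_top, ← Submodule.orthogonal_orthogonal_eq_closure,
    D.total, Submodule.bot_orthogonal_eq_top]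

theorem dense_domain_pmap : Dense ((D.pmap B).domain : Set H) := by
  refine D.dense_iSup.mono ?_
  have : (⨆ i, D.W i) ≤ (D.pmap B).domain := iSup_le fun i x hx =>
    LinearPMap.mem_domain_of_mem_graph (coe_mem_graph_pmap B i ⟨x, hx⟩)
  exact this

/-- An operator whose graph is contained in the graph of a block diagonal operator and contains
all blocks has the maximal block diagonal operator as its closure. -/
theorem closure_eq_pmap {T : H →ₗ.[ℂ] H} (h : T.graph ≤ D.diagGraph B)
    (h' : ∀ i (x : D.W i), ((x : H), (B i x : H)) ∈ T.graph) : T.closure = D.pmap B := by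
  have hcl : T.graph.topologicalClosure = (D.pmap B).graph := by
    apply le_antisymm
    · refine Submodule.topologicalClosure_minimal _ (by rwa [graph_pmap]) isClosed_pmap
    · rintro ⟨x, y⟩ hxy
      rw [mem_graph_pmap] at hxy
      -- Finite partial sums over blocks lie in the graph of `T` and converge to `(x, y)` in both
      -- coordinates at once: the algebraic sum of the blocks is a core.
      have hs : HasSum (fun i => ((D.comp i x : H), (D.comp i y : H))) (x, y) :=
        (D.hasSum_comp x).prodMk (D.hasSum_comp y)
      refine mem_closure_of_tendsto hs (Filter.Eventually.of_forall fun s => ?_)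
      refine Submodule.sum_mem _ fun i _ => ?_
      rw [hxy i]
      exact h' i _
  have hcb : T.IsClosable := ⟨_, hcl⟩
  exact LinearPMap.eq_of_eq_graph (by rw [← hcb.graph_closure_eq_closure_graph, hcl])

/-- Testing the adjoint relation on vectors of one block forces the blockwise formula. Conversely
the blockwise formula gives the relation termwise in the orthogonal expansion of the inner product.
-/
theorem adjoint_pmap : (D.pmap B).adjoint = D.pmap (fun i => star (B i)) := by
  refine LinearPMap.eq_of_eq_graph ?_
  rw [LinearPMap.adjoint_graph_eq_graph_adjoint dense_domain_pmap]
  ext ⟨x, y⟩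
  rw [Submodule.mem_adjoint_iff, mem_graph_pmap]
  constructor
  · intro h i
    refine ext_inner_left ℂ fun w => ?_
    have := h _ _ (coe_mem_graph_pmap B i w)
    rw [sub_eq_zero] at this
    rw [inner_comp, ContinuousLinearMap.star_eq_adjoint, ContinuousLinearMap.adjoint_inner_right,
      inner_comp]
    exact this.symm
  · intro h a b hab
    rw [mem_graph_pmap] at hab
    rw [sub_eq_zero]
    refine (D.hasSum_inner_comp b x).unique ?_
    have := D.hasSum_inner_comp a y
    refine this.congr_fun fun i => ?_
    rw [h, hab, ContinuousLinearMap.star_eq_adjoint, ContinuousLinearMap.adjoint_inner_right]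

end Blocks

/-- Unbounded operators are composed as relations, so that equality of domains and of values is
checked in one statement about graphs. -/
theorem mem_graph_pcomp {g f : H →ₗ.[ℂ] H} {x z : H} :
    (x, z) ∈ (pcomp g f).graph ↔ ∃ y, (x, y) ∈ f.graph ∧ (y, z) ∈ g.graph := by
  constructor
  · intro h
    rw [LinearPMap.mem_graph_iff] at h
    obtain ⟨⟨_, ⟨a, ha, rfl⟩, hd⟩, rfl, rfl⟩ := h
    refine ⟨f a, LinearPMap.mem_graph f a, ?_⟩
    exact LinearPMap.mem_graph g ⟨f a, ha⟩
  · rintro ⟨y, hxy, hyz⟩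
    rw [LinearPMap.mem_graph_iff] at hxy hyz ⊢
    obtain ⟨a, rfl, rfl⟩ := hxy
    obtain ⟨b, hb, rfl⟩ := hyz
    have ha : f a ∈ g.domain := by have := b.2; rwa [hb] at this
    refine ⟨⟨a, ⟨a, ha, rfl⟩, a.2⟩, rfl, ?_⟩
    have : b = ⟨f a, ha⟩ := Subtype.ext hb
    rw [this]
    rfl

theorem mem_graph_compPMap {V : H →L[ℂ] H} {f : H →ₗ.[ℂ] H} {x z : H} :
    (x, z) ∈ ((V : H →ₗ[ℂ] H).compPMap f).graph ↔ ∃ y, (x, y) ∈ f.graph ∧ V y = z := by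
  simp only [LinearPMap.mem_graph_iff]
  constructor
  · rintro ⟨a, rfl, rfl⟩
    exact ⟨f a, ⟨a, rfl, rfl⟩, rfl⟩
  · rintro ⟨_, ⟨a, rfl, rfl⟩, rfl⟩
    exact ⟨a, rfl, rfl⟩

end Blocks

end HarmonicSU3
end

noncomputable section

namespace HarmonicSU3

/-! ### The phase of a block diagonal operator -/

section Phase

variable {H : Type u} [NormedAddCommGroup H] [InnerProductSpace ℂ H] [CompleteSpace H]
  {D : Blocks H}

namespace Blocks

/-- The point is that `|Z|²` and `Z* Z` have the same domain. The intermediate vectors `|Z| x` and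
`Z x` determine each other through the bounded operators `V* (Z x) = |Z| x` and `V (|Z| x) = Z x`,
so one lies in `H` exactly when the other does. -/
theorem isModulus_pmap (Z : ∀ i, D.W i →L[ℂ] D.W i) {V : H →L[ℂ] H}
    (hV : D.IsDiag V fun i => phase (Z i)) :
    IsModulus (D.pmap Z) (D.pmap fun i => modulus (Z i)) := by
  refine ⟨?_, fun x => ?_, ?_⟩
  · rw [LinearPMap.isSelfAdjoint_def, adjoint_pmap]
    simp only [star_modulus]
  · have hx := mem_graph_pmap.1 (LinearPMap.mem_graph (D.pmap fun i => modulus (Z i)) x)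
    have h := (D.hasSum_inner_comp (D.pmap (fun i => modulus (Z i)) x) (x : H)).mapL
      Complex.reCLM
    refine h.nonneg fun i => ?_
    rw [hx]
    exact inner_modulus_nonneg _ _
  · refine LinearPMap.eq_of_eq_graph (SetLike.ext fun p => ?_)
    obtain ⟨x, z⟩ := p
    rw [mem_graph_pcomp, mem_graph_pcomp, adjoint_pmap]
    simp only [mem_graph_pmap]
    have happ : ∀ i {S T S' T' : D.W i →L[ℂ] D.W i}, S * T = S' * T' → ∀ x, S (T x) = S' (T' x) :=
      fun i S T S' T' h x => congrArg (fun k => k x) h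
    constructor
    · rintro ⟨y, h1, h2⟩
      refine ⟨V y, fun i => ?_, fun i => ?_⟩
      · rw [hV, h1]
        exact congrArg (fun k => k (D.comp i x)) (phase_mul_modulus (Z i))
      · rw [h2, hV, h1, happ i (modulus_mul_self (Z i))]
        congr 1
        exact congrArg (fun k => k (D.comp i x)) (phase_mul_modulus (Z i)).symm
    · rintro ⟨y, h1, h2⟩
      refine ⟨star V y, fun i => ?_, fun i => ?_⟩
      · rw [hV.star, h1]
        exact congrArg (fun k => k (D.comp i x)) (star_phase_mul (Z i))
      · rw [h2, hV.star, h1, happ i (modulus_mul_self (Z i)).symm]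
        congr 1
        exact congrArg (fun k => k (D.comp i x)) (star_phase_mul (Z i)).symm

theorem isPhase_pmap (Z : ∀ i, D.W i →L[ℂ] D.W i) {V : H →L[ℂ] H}
    (hV : D.IsDiag V fun i => phase (Z i)) : IsPhase (D.pmap Z) V := by
  refine ⟨isClosed_pmap, dense_domain_pmap, ⟨_, isModulus_pmap Z hV, ?_⟩, fun v => ?_, ?_⟩
  · refine LinearPMap.eq_of_eq_graph (SetLike.ext fun p => ?_)
    obtain ⟨x, z⟩ := p
    rw [mem_graph_compPMap]
    simp only [mem_graph_pmap]
    constructor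
    · intro h
      -- `V* z` is the candidate for `|Z| x`; that it is a vector of `H` shows that `x` lies in the
      -- domain of the modulus.
      have h1 : ∀ i, D.comp i (star V z) = modulus (Z i) (D.comp i x) := fun i => by
        rw [hV.star, h]
        exact congrArg (fun k => k (D.comp i x)) (star_phase_mul (Z i))
      refine ⟨star V z, h1, ext_comp (D := D) fun i => ?_⟩
      rw [hV, h1, h]
      exact congrArg (fun k => k (D.comp i x)) (phase_mul_modulus (Z i))
    · rintro ⟨y, h1, rfl⟩ i
      rw [hV, h1]
      exact congrArg (fun k => k (D.comp i x)) (phase_mul_modulus (Z i))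
  · have h1 : (∃ x : (D.pmap Z).domain, (x : H) = v ∧ D.pmap Z x = 0) ↔
        (v, (0 : H)) ∈ (D.pmap Z).graph := by
      rw [LinearPMap.mem_graph_iff]
    rw [h1, mem_graph_pmap]
    have h2 : V v = 0 ↔ ∀ i, D.comp i (V v) = 0 :=
      ⟨fun h i => by rw [h, map_zero], fun h => ext_comp (D := D) fun i => by rw [h, map_zero]⟩
    rw [h2]
    refine forall_congr' fun i => ?_
    rw [hV, phase_apply_eq_zero_iff, map_zero, eq_comm]
  · intro v hv
    -- By `V V* V = V` the vector `v - V* V v` lies in the kernel, so orthogonality of `v` to the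
    -- kernel yields `‖v‖² = ‖V v‖²`.
    have h1 : V * star V * V = V :=
      ((hV.mul hV.star).mul hV).unique (by simpa only [phase_mul_star_mul_phase] using hV)
    have h2 : v - star V (V v) ∈ LinearMap.ker (V : H →ₗ[ℂ] H) := by
      rw [LinearMap.mem_ker]
      change V (v - star V (V v)) = 0
      rw [map_sub, sub_eq_zero]
      exact congrArg (fun k => k v) h1.symm
    have h3 := Submodule.inner_right_of_mem_orthogonal h2 hv
    rw [inner_sub_left, sub_eq_zero, ContinuousLinearMap.star_eq_adjoint,
      ContinuousLinearMap.adjoint_inner_left, inner_self_eq_norm_sq_to_K,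
      inner_self_eq_norm_sq_to_K] at h3
    have h4 : ‖v‖ ^ 2 = ‖V v‖ ^ 2 := Complex.ofReal_injective (by
      rw [Complex.ofReal_pow, Complex.ofReal_pow]; exact h3)
    exact ((sq_eq_sq₀ (norm_nonneg _) (norm_nonneg _)).1 h4).symm

end Blocks

/-- A modulus of `T` acts on an eigenvector of `T* T` by the square root of the eigenvalue. -/
theorem IsModulus.mem_graph_of_eigen {T P : H →ₗ.[ℂ] H} (hP : IsModulus T P) {e : H} {s : ℝ}
    (hs : 0 ≤ s) (he : (e, ((s ^ 2 : ℝ) : ℂ) • e) ∈ (pcomp T.adjoint T).graph) :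
    (e, (s : ℂ) • e) ∈ P.graph := by
  obtain ⟨hsa, hpos, hsq⟩ := hP
  rw [← hsq, mem_graph_pcomp] at he
  obtain ⟨y, h1, h2⟩ := he
  suffices h : y = (s : ℂ) • e by rwa [← h]
  rcases hs.eq_or_lt with rfl | hs'
  · have hadj : P.graph = P.graph.adjoint := by
      conv_lhs => rw [← LinearPMap.isSelfAdjoint_def.1 hsa]
      exact LinearPMap.adjoint_graph_eq_graph_adjoint hsa.dense_domain
    have h3 := h2
    rw [hadj, Submodule.mem_adjoint_iff] at h3
    have h4 := h3 _ _ h1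
    simpa using h4
  · have h3 := P.graph.sub_mem h2 (P.graph.smul_mem (s : ℂ) h1)
    have h4 := P.graph.sub_mem h1 (P.graph.smul_mem (s : ℂ) (show (e, y) ∈ P.graph from h1))
    -- Factor `P² - s² = (P + s)(P - s)`: the vector `(P - s) e` would be an eigenvector of the
    -- positive operator `P` with eigenvalue `-s < 0`, so it vanishes.
    have h5 : (y - (s : ℂ) • e, -((s : ℂ) • (y - (s : ℂ) • e))) ∈ P.graph := by
      convert h3 using 1
      simp only [Prod.smul_mk, Prod.mk_sub_mk, smul_sub, neg_sub, smul_smul]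
      push_cast
      rw [sq]
    rw [LinearPMap.mem_graph_iff] at h5
    obtain ⟨x, hx1, hx2⟩ := h5
    simp only at hx1 hx2
    have h6 := hpos x
    rw [hx2, hx1, inner_neg_left, inner_smul_left, inner_self_eq_norm_sq_to_K,
      Complex.conj_ofReal] at h6
    have h7 : 0 ≤ -(s * ‖y - (s : ℂ) • e‖ ^ 2) := by
      simpa [← Complex.ofReal_pow] using h6
    have h8 : ‖y - (s : ℂ) • e‖ ^ 2 = 0 := by
      nlinarith [sq_nonneg ‖y - (s : ℂ) • e‖]
    rw [← sub_eq_zero, ← norm_eq_zero]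
    exact pow_eq_zero_iff two_ne_zero |>.1 h8

/-- Any modulus acts on an eigenvector `x` of `Z* Z` in a block by `√μ`, so the polar equation
determines `W x` when `μ > 0`. When `μ = 0` the kernel condition gives `W x = 0`. The blocks span a
dense subspace. -/
theorem Blocks.eq_of_isPhase_pmap {Z : ∀ i, D.W i →L[ℂ] D.W i} {V W : H →L[ℂ] H}
    (hV : D.IsDiag V fun i => phase (Z i)) (hW : IsPhase (D.pmap Z) W) : W = V := by
  obtain ⟨-, -, ⟨P, hP, hWP⟩, hker, -⟩ := hW
  have hblock : ∀ i (x : D.W i), W x = V x := fun i => by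
    have key : W ∘L (D.W i).subtypeL = V ∘L (D.W i).subtypeL := by
      refine eq_of_eigen (Z i) fun μ x h0 hx => ?_
      change W x = V x
      have hgr : ((x : H), (star (Z i) (Z i x) : H)) ∈
          (pcomp (D.pmap Z).adjoint (D.pmap Z)).graph :=
        mem_graph_pcomp.2 ⟨_, Blocks.coe_mem_graph_pmap Z i x, by
          rw [Blocks.adjoint_pmap]
          exact Blocks.coe_mem_graph_pmap (fun i => star (Z i)) i (Z i x)⟩
      have hx' : (star (Z i) (Z i x) : H) = (((√μ) ^ 2 : ℝ) : ℂ) • (x : H) := by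
        rw [Real.sq_sqrt h0]
        exact congrArg Subtype.val hx
      rw [hx'] at hgr
      have h1 := hP.mem_graph_of_eigen (Real.sqrt_nonneg μ) hgr
      have h2 : ((x : H), W ((√μ : ℂ) • (x : H))) ∈ (D.pmap Z).graph := by
        rw [hWP, mem_graph_compPMap]
        exact ⟨_, h1, rfl⟩
      have h3 : W ((√μ : ℂ) • (x : H)) = (Z i x : H) :=
        LinearPMap.mem_graph_snd_inj _ h2 (Blocks.coe_mem_graph_pmap Z i x) rfl
      have h4 : V ((√μ : ℂ) • (x : H)) = (Z i x : H) := by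
        rw [map_smul, hV.apply_coe]
        have h5 := congrArg (fun k => (k x : H)) (phase_mul_modulus (Z i))
        change ((phase (Z i)) (gramFun (Z i) Real.sqrt x) : H) = _ at h5
        rw [gramFun_apply _ hx, map_smul] at h5
        exact h5
      rcases h0.eq_or_lt with rfl | hμ
      · have h6 : Z i x = 0 := by
          rw [Real.sqrt_zero, Complex.ofReal_zero, zero_smul, map_zero] at h3
          exact Subtype.ext h3.symm
        have h7 := LinearPMap.mem_graph_iff _ |>.1 (Blocks.coe_mem_graph_pmap Z i x)
        have h8 : W x = 0 := by
          rw [hker]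
          obtain ⟨w, hw1, hw2⟩ := h7
          exact ⟨w, hw1, hw2.trans (congrArg Subtype.val h6)⟩
        rw [h8, hV.apply_coe, (phase_apply_eq_zero_iff _ _).2 h6]
        rfl
      · have hne : (√μ : ℂ) ≠ 0 := by exact_mod_cast (Real.sqrt_pos.2 hμ).ne'
        have h9 := h3.trans h4.symm
        rw [map_smul, map_smul] at h9
        exact smul_right_injective H hne h9
    exact fun x => congrArg (fun k => k x) key
  have hle : (⨆ i, D.W i) ≤ LinearMap.eqLocus (W : H →ₗ[ℂ] H) (V : H →ₗ[ℂ] H) :=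
    iSup_le fun i x hx => hblock i ⟨x, hx⟩
  exact ContinuousLinearMap.ext_on (D.dense_iSup.mono (fun x hx => Submodule.subset_span hx))
    (fun x hx => hle hx)

end Phase

/-! ### The closed operator of an element of `𝔰𝔩(3)` -/

section ClosedOp

set_option linter.unusedSectionVars false

variable {H : Type u} [NormedAddCommGroup H] [InnerProductSpace ℂ H] [CompleteSpace H]

/-- The representation on a block. -/
abbrev Blocks.rep (D : Blocks H) (π : UnitaryRep SU3 H) (hD : ∀ i, π.IsInvariant (D.W i))
    (i : D.ι) : UnitaryRep SU3 (D.W i) := π.sub (D.W i) (hD i)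

theorem Blocks.intertwines_comp (D : Blocks H) {G : Type*} [Group G] [TopologicalSpace G]
    (π : UnitaryRep G H) (hD : ∀ i, π.IsInvariant (D.W i)) (i : D.ι) :
    UnitaryRep.Intertwines π (π.sub (D.W i) (hD i)) (D.comp i) := fun g x => by
  refine ext_inner_left ℂ fun y => ?_
  rw [Blocks.inner_comp, UnitaryRep.inner_toHom_right, UnitaryRep.inner_toHom_right]
  exact (D.inner_comp i ((π.sub (D.W i) (hD i)).toHom g⁻¹ y) x).symm

variable {D : Blocks H} {π : UnitaryRep SU3 H} (hD : ∀ i, π.IsInvariant (D.W i))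

/-- Projection onto a block is a bounded intertwiner, so it may be applied to the difference
quotient. -/
theorem UnitaryRep.HasLieDeriv.comp_eq {A : su3} {x w : H} (h : π.HasLieDeriv A x w) (i : D.ι) :
    D.comp i w = (D.rep π hD i).deriv A (D.comp i x) := by
  have h1 := (D.comp i).hasFDerivAt.restrictScalars ℝ |>.comp_hasDerivAt (0 : ℝ) h
  have h2 := (D.rep π hD i).hasLieDeriv A (D.comp i x)
  refine HasDerivAt.unique (h1.congr_of_eventuallyEq (Filter.Eventually.of_forall fun t => ?_)) h2
  exact (D.intertwines_comp π hD i _ _).symm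

theorem UnitaryRep.lieAction_eq {A : su3} {x : π.smoothVectors} {w : H}
    (h : π.HasLieDeriv A x w) : π.lieAction A x = w := HasDerivAt.deriv h

theorem UnitaryRep.hasLieDeriv_coe (A : su3) (i : D.ι) (x : D.W i) :
    π.HasLieDeriv A x ((D.rep π hD i).deriv A x : H) := by
  have h := (D.rep π hD i).hasLieDeriv A x
  exact (D.W i).subtypeL.hasFDerivAt.restrictScalars ℝ |>.comp_hasDerivAt (0 : ℝ) h

include hD in
theorem UnitaryRep.block_le_smoothVectors (i : D.ι) : D.W i ≤ π.smoothVectors :=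
  le_sSup fun A v hv => ⟨_, ((D.rep π hD i).deriv A ⟨v, hv⟩).2, hasLieDeriv_coe hD A i ⟨v, hv⟩⟩

/-- Components of smooth vectors are differentiated blockwise, which bounds the graph from above;
finite-dimensional blocks consist of smooth vectors, which makes the operator large enough for
`Blocks.closure_eq_pmap`. -/
theorem UnitaryRep.closedOp_eq_pmap (Z : Matrix (Fin 3) (Fin 3) ℂ) (hZ : Z.trace = 0) :
    π.closedOp Z hZ = D.pmap fun i => (D.rep π hD i).op Z := by
  refine Blocks.closure_eq_pmap ?_ fun i x => ?_
  · rintro ⟨x, y⟩ hxy i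
    rw [LinearPMap.mem_graph_iff] at hxy
    obtain ⟨a, rfl, rfl⟩ := hxy
    obtain ⟨w, -, hw⟩ := π.exists_hasLieDeriv (skewPart Z hZ) a.2
    obtain ⟨w', -, hw'⟩ := π.exists_hasLieDeriv (skewPart' Z hZ) a.2
    have h1 : π.smoothOp Z hZ a = w + Complex.I • w' := by
      rw [← lieAction_eq hw, ← lieAction_eq hw']
      rfl
    simp only [h1, map_add, map_smul]
    rw [hw.comp_eq hD, hw'.comp_eq hD, op_eq_of_trace_eq_zero _ _ hZ]
    rfl
  · have hx := block_le_smoothVectors hD i x.2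
    rw [LinearPMap.mem_graph_iff]
    refine ⟨⟨x, hx⟩, rfl, ?_⟩
    have h1 : π.smoothOp Z hZ ⟨x, hx⟩ = ((D.rep π hD i).deriv (skewPart Z hZ) x : H) +
        Complex.I • ((D.rep π hD i).deriv (skewPart' Z hZ) x : H) := by
      have h := fun A => lieAction_eq (x := (⟨x, hx⟩ : π.smoothVectors))
        (hasLieDeriv_coe (D := D) hD A i x)
      rw [← h, ← h]
      rfl
    rw [h1, op_eq_of_trace_eq_zero _ _ hZ]
    rfl

end ClosedOp

end HarmonicSU3
end

noncomputable section

namespace HarmonicSU3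

/-! ### The adjoint representation on matrices -/

section Adjoint

open scoped Kronecker

/-- The unitary matrix `g ⊗ ḡ` of the conjugation action on matrices. -/
def conjMatrix : SU3 →* unitary (Matrix (Fin 3 × Fin 3) (Fin 3 × Fin 3) ℂ) where
  toFun g := ⟨g.1 ⊗ₖ g.1.map (starRingEnd ℂ), by
    have h := (Matrix.mem_specialUnitaryGroup_iff.1 g.2).1
    refine Matrix.kronecker_mem_unitary h ?_
    have h2 := Matrix.mem_unitaryGroup_iff.1 h
    refine Matrix.mem_unitaryGroup_iff.2 ?_
    have h3 : star (g.1.map (starRingEnd ℂ)) = (star g.1).map (starRingEnd ℂ) := by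
      ext a b; simp
    rw [h3, ← RingHom.mapMatrix_apply, ← RingHom.mapMatrix_apply, ← map_mul, h2, map_one]⟩
  map_one' := by
    refine Subtype.ext ?_
    change (1 : Matrix (Fin 3) (Fin 3) ℂ) ⊗ₖ (1 : Matrix (Fin 3) (Fin 3) ℂ).map _ = 1
    rw [← RingHom.mapMatrix_apply, map_one, Matrix.one_kronecker_one]
  map_mul' g h := by
    refine Subtype.ext ?_
    change (g.1 * h.1) ⊗ₖ (g.1 * h.1).map _ = (g.1 ⊗ₖ g.1.map _) * (h.1 ⊗ₖ h.1.map _)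
    rw [← RingHom.mapMatrix_apply, map_mul, Matrix.mul_kronecker_mul]
    rfl

/-- The conjugation action of `SU(3)` on `3 × 3` matrices. -/
def adjointRep : UnitaryRep SU3 (EuclideanSpace ℂ (Fin 3 × Fin 3)) where
  toHom := (Unitary.linearIsometryEquiv.toMonoidHom.comp
    (Unitary.map (StarMonoidHom.ofClass
      (Matrix.toEuclideanCLM (n := Fin 3 × Fin 3) (𝕜 := ℂ)))).toMonoidHom).comp conjMatrix
  continuous_orbit v := by
    refine (PiLp.continuous_toLp 2 _).comp (continuous_pi fun p => ?_)
    change Continuous fun g : SU3 => ∑ q, (g.1 p.1 q.1 * (starRingEnd ℂ) (g.1 p.2 q.2)) * v q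
    have h : ∀ a b, Continuous fun g : SU3 => g.1 a b := fun a b =>
      (continuous_apply_apply a b).comp continuous_subtype_val
    exact continuous_finsetSum _ fun q _ =>
      ((h _ _).mul (Complex.continuous_conj.comp (h _ _))).mul continuous_const

/-- The matrix of an element of the adjoint representation. -/
def entries : EuclideanSpace ℂ (Fin 3 × Fin 3) →ₗ[ℂ] Matrix (Fin 3) (Fin 3) ℂ where
  toFun e := Matrix.of fun a b => e (a, b)
  map_add' _ _ := rfl
  map_smul' _ _ := rfl

theorem entries_adjointRep (g : SU3) (e : EuclideanSpace ℂ (Fin 3 × Fin 3)) :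
    entries (adjointRep.toHom g e) = g.1 * entries e * (g⁻¹ : SU3).1 := by
  ext a b
  change ∑ q : Fin 3 × Fin 3, (g.1 a q.1 * (starRingEnd ℂ) (g.1 b q.2)) * e q = _
  rw [coe_inv_SU3, Matrix.mul_apply, Fintype.sum_prod_type_right]
  refine Finset.sum_congr rfl fun d _ => ?_
  rw [Matrix.mul_apply, Finset.sum_mul]
  refine Finset.sum_congr rfl fun c _ => ?_
  rw [Matrix.star_apply]
  change _ = g.1 a c * e (c, d) * (starRingEnd ℂ) (g.1 b d)
  ring

theorem entries_single (a b : Fin 3) :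
    entries (EuclideanSpace.single (a, b) 1) = Matrix.single a b 1 := by
  ext c d
  change (EuclideanSpace.single (a, b) (1 : ℂ)) (c, d) = _
  rw [PiLp.single_apply, Matrix.single_apply]
  simp only [Prod.mk.injEq, eq_comm]

end Adjoint

/-! ### Infinitesimal action of the block subgroups -/

section BlockSubgroups

open scoped Matrix.Norms.L2Operator in
theorem exp_apply_eq_zero {S : Set (Fin 2)} {A : Matrix (Fin 3) (Fin 3) ℂ}
    (hA : ∀ a b, ¬ SameBlock S a b → A a b = 0) {a b : Fin 3} (hab : ¬ SameBlock S a b) :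
    (NormedSpace.exp A) a b = 0 := by
  have hrefl : ∀ a, SameBlock S a a := fun a i h1 h2 => by omega
  have hpow : ∀ n : ℕ, ∀ a b, ¬ SameBlock S a b → (A ^ n) a b = 0 := by
    intro n
    induction n with
    | zero =>
      intro a b h
      rw [pow_zero, Matrix.one_apply_ne]
      rintro rfl
      exact h (hrefl a)
    | succ n ih =>
      intro a b h
      rw [pow_succ, Matrix.mul_apply]
      refine Finset.sum_eq_zero fun c _ => ?_
      by_cases hac : SameBlock S a c
      · rw [hA c b fun hcb => h (hac.trans hcb), mul_zero]
      · rw [ih a c hac, zero_mul]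
  have h := NormedSpace.exp_series_hasSum_exp' (𝕂 := ℂ) A
  have h1 : HasSum (fun n : ℕ => ((n.factorial : ℂ)⁻¹ • A ^ n) a b) ((NormedSpace.exp A) a b) :=
    (Pi.hasSum.1 (Pi.hasSum.1 h a)) b
  refine h1.unique ?_
  convert hasSum_zero using 2 with n
  rw [Matrix.smul_apply, hpow n a b hab, smul_zero]

theorem expSU_mem_KS {S : Set (Fin 2)} {A : su3}
    (hA : ∀ a b, ¬ SameBlock S a b → (A : Matrix (Fin 3) (Fin 3) ℂ) a b = 0) (t : ℝ) :
    expSU (t • A) ∈ KS S := fun a b hab => by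
  refine exp_apply_eq_zero (fun a b h => ?_) hab
  change (t • (A : Matrix (Fin 3) (Fin 3) ℂ)) a b = 0
  rw [Matrix.smul_apply, hA a b h, smul_zero]

theorem skew_apply_eq_zero {S : Set (Fin 2)} {Z : Matrix (Fin 3) (Fin 3) ℂ}
    (hZ : ∀ a b, ¬ SameBlock S a b → Z a b = 0) {a b : Fin 3} (hab : ¬ SameBlock S a b) :
    (skew Z : Matrix (Fin 3) (Fin 3) ℂ) a b = 0 := by
  have hne : ∀ {a b}, ¬ SameBlock S a b → a ≠ b := by
    rintro a _ h rfl
    exact h fun i h1 h2 => by omega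
  have h : ∀ {a b}, ¬ SameBlock S a b → traceless Z a b = 0 := fun {a b} hab => by
    rw [traceless, Matrix.sub_apply, hZ a b hab, Matrix.smul_apply, Matrix.one_apply_ne (hne hab),
      smul_zero, sub_zero]
  rw [coe_skew, Matrix.smul_apply, Matrix.sub_apply, Matrix.conjTranspose_apply, h hab,
    h fun h' => hab h'.symm, star_zero, sub_zero, smul_zero]

theorem eq_of_sameBlock_empty {a b : Fin 3} (h : SameBlock ∅ a b) : a = b := by
  by_contra hab
  have hab' : (a : ℕ) ≠ b := fun h => hab (Fin.ext h)
  exact h ⟨min (a : ℕ) b, by omega⟩ le_rfl (by simp only; omega)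

variable {W : Type*} [NormedAddCommGroup W] [InnerProductSpace ℂ W] [FiniteDimensional ℂ W]

/-- An operator commuting with `K_S` commutes with the infinitesimal action of block diagonal
matrices. -/
theorem commute_op_of_commute_KS (ρ : UnitaryRep SU3 W) {S : Set (Fin 2)} {T : W →L[ℂ] W}
    (hT : ∀ k ∈ KS S, T * ρ.toCLM k = ρ.toCLM k * T) {Z : Matrix (Fin 3) (Fin 3) ℂ}
    (hZ : ∀ a b, ¬ SameBlock S a b → Z a b = 0) : T * ρ.op Z = ρ.op Z * T := by
  have hd : ∀ A : su3, (∀ a b, ¬ SameBlock S a b → (A : Matrix (Fin 3) (Fin 3) ℂ) a b = 0) →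
      T * ρ.deriv A = ρ.deriv A * T := fun A hA => by
    have h := ρ.hasDerivAt A
    refine HasDerivAt.unique (h.const_mul T) ((h.mul_const T).congr_of_eventuallyEq
      (Filter.Eventually.of_forall fun t => hT _ (expSU_mem_KS hA t)))
  have h1 := hd (skew Z) fun a b => skew_apply_eq_zero hZ
  have h2 := hd (skew (Complex.I • Z)) fun a b => skew_apply_eq_zero fun a b h => by
    rw [Matrix.smul_apply, hZ a b h, smul_zero]
  rw [UnitaryRep.op_apply, mul_sub, sub_mul, h1, mul_smul_comm, smul_mul_assoc, h2]

end BlockSubgroups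

/-! ### Block diagonal operators and isotypical projections -/

section BlockProj

variable {G : Type*} [Group G] [TopologicalSpace G]
variable {H : Type u} [NormedAddCommGroup H] [InnerProductSpace ℂ H] [CompleteSpace H]
variable {D : Blocks H}

theorem Blocks.isDiag_proj {π : UnitaryRep G H} (hD : ∀ i, π.IsInvariant (D.W i)) (σ : Types G) :
    D.IsDiag (π.proj σ) fun i => (π.sub (D.W i) (hD i)).proj σ := fun x i =>
  (D.intertwines_comp π hD i).proj_comm σ x

theorem Blocks.isComplete {π : UnitaryRep G H} (hD : ∀ i, π.IsInvariant (D.W i)) : π.IsComplete :=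
  π.isComplete_of_forall_finiteDimensional D.W hD D.total

end BlockProj

/-! ### Phases inside the block of `S`, and phases for the diagonal torus. -/

section Equivariant

variable {H : Type u} [NormedAddCommGroup H] [InnerProductSpace ℂ H] [CompleteSpace H]
variable {D : Blocks H} {π : UnitaryRep SU3 H}

theorem commute_phase {W : Type*} [NormedAddCommGroup W] [InnerProductSpace ℂ W]
    [FiniteDimensional ℂ W] [CompleteSpace W] {T Z : W →L[ℂ] W} (h : T * Z = Z * T)
    (h' : T * star Z = star Z * T) : T * phase Z = phase Z * T := by
  have h1 : T * (star Z * Z) = star Z * Z * T := by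
    rw [← mul_assoc, h', mul_assoc, h, mul_assoc]
  rw [phase, ← mul_assoc, h, mul_assoc, gramFun_intertwine h1, mul_assoc]

/-- If `α_i ∈ S` then the phase of the corresponding root vector is `K_S`-harmonically proper. -/
theorem harmonicallyProper_phase_of_sameBlock (hD : ∀ i, π.IsInvariant (D.W i)) {S : Set (Fin 2)}
    {a b : Fin 3} (hab : SameBlock S a b) {V : H →L[ℂ] H}
    (hV : D.IsDiag V fun i => phase ((D.rep π hD i).unit a b)) :
    HarmonicallyProper (π.restrict (KS S)) (π.restrict (KS S)) V := by
  refine harmonicallyProper_of_forall_commute fun σ x => ?_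
  have hD' : ∀ i, (π.restrict (KS S)).IsInvariant (D.W i) := fun i => (hD i).restrict (KS S)
  have hp := D.isDiag_proj hD' σ
  have hc : ∀ i, ∀ c d, SameBlock S c d →
      ((π.restrict (KS S)).sub (D.W i) (hD' i)).proj σ * (D.rep π hD i).unit c d =
      (D.rep π hD i).unit c d * ((π.restrict (KS S)).sub (D.W i) (hD' i)).proj σ :=
    fun i c d hcd => commute_op_of_commute_KS _ (fun k hk => by
      ext x
      exact congrArg Subtype.val
        (UnitaryRep.intertwines_proj ((π.restrict (KS S)).sub (D.W i) (hD' i)) σ ⟨k, hk⟩ x))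
      fun a' b' h => by
        rw [Matrix.single_apply, if_neg]
        rintro ⟨rfl, rfl⟩
        exact h hcd
  have h1 := hp.mul hV
  have h2 := hV.mul hp
  have h3 : ∀ i, phase ((D.rep π hD i).unit a b) *
      ((π.restrict (KS S)).sub (D.W i) (hD' i)).proj σ =
      ((π.restrict (KS S)).sub (D.W i) (hD' i)).proj σ * phase ((D.rep π hD i).unit a b) :=
    fun i => (commute_phase (hc i a b hab) (by
      rw [UnitaryRep.star_unit]; exact hc i b a hab.symm)).symm
  simp only [h3] at h2
  exact congrArg (fun k => k x) (h2.unique h1)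

/-- The two scalars cancel in `Z* Z`, so `T` commutes with its functional calculus and the phase
inherits the scalar of `Z`. -/
theorem semiconj_phase {W : Type*} [NormedAddCommGroup W] [InnerProductSpace ℂ W]
    [FiniteDimensional ℂ W] [CompleteSpace W] {T Z : W →L[ℂ] W} {c c' : ℂ} (hc : c' * c = 1)
    (h : T * Z = c • (Z * T)) (h' : T * star Z = c' • (star Z * T)) :
    T * phase Z = c • (phase Z * T) := by
  have h1 : T * (star Z * Z) = star Z * Z * T := by
    rw [← mul_assoc, h', smul_mul_assoc, mul_assoc, h, mul_smul_comm, smul_smul, hc, one_smul,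
      mul_assoc]
  rw [phase, ← mul_assoc, h, smul_mul_assoc, mul_assoc, gramFun_intertwine h1, mul_assoc]

theorem coe_mul_single_mul_inv {g : SU3} (hg : g ∈ KS ∅) (a b : Fin 3) :
    g.1 * Matrix.single a b 1 * (g⁻¹ : SU3).1 =
      (g.1 a a * (starRingEnd ℂ) (g.1 b b)) • Matrix.single a b 1 := by
  have hd : ∀ a b, a ≠ b → g.1 a b = 0 := fun a b h =>
    hg a b fun h' => h (eq_of_sameBlock_empty h')
  ext c d
  rw [coe_inv_SU3, Matrix.mul_apply, Finset.sum_eq_single b, Matrix.mul_apply,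
    Finset.sum_eq_single a, Matrix.single_apply_same, Matrix.star_apply, Matrix.smul_apply,
    Matrix.single_apply, mul_one]
  · by_cases hc : a = c
    · by_cases hd' : b = d
      · subst hc hd'; simp
      · rw [hd d b (Ne.symm hd'), if_neg (by tauto)]; simp
    · rw [hd c a (Ne.symm hc), if_neg (by tauto)]; simp
  · intro e _ he
    rw [Matrix.single_apply_of_row_ne (Ne.symm he), mul_zero]
  · simp
  · intro e _ he
    rw [Matrix.mul_apply, Finset.sum_eq_zero, zero_mul]
    intro f _
    rw [Matrix.single_apply_of_col_ne _ _ (Ne.symm he), mul_zero]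
  · simp

theorem norm_diag_of_mem_KS_empty {g : SU3} (hg : g ∈ KS ∅) (a : Fin 3) :
    (starRingEnd ℂ) (g.1 a a) * g.1 a a = 1 := by
  have hd : ∀ a b, a ≠ b → g.1 a b = 0 := fun a b h =>
    hg a b fun h' => h (eq_of_sameBlock_empty h')
  have h1 : g.1 * (g⁻¹ : SU3).1 = 1 := by rw [← coe_mul_SU3, mul_inv_cancel, coe_one_SU3]
  have h2 := congrFun (congrFun h1 a) a
  rw [Matrix.mul_apply, Finset.sum_eq_single a, Matrix.one_apply_eq, coe_inv_SU3,
    Matrix.star_apply, mul_comm] at h2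
  · exact h2
  · intro b _ hb
    rw [hd a b (Ne.symm hb), zero_mul]
  · simp

/-- The phase of a root vector is harmonically proper for the diagonal torus. -/
theorem columnFinite_phase_of_empty (hD : ∀ i, π.IsInvariant (D.W i))
    {a b : Fin 3} {V : H →L[ℂ] H}
    (hV : D.IsDiag V fun i => phase ((D.rep π hD i).unit a b)) :
    ColumnFinite (π.restrict (KS ∅)) (π.restrict (KS ∅)) V := by
  -- Under the torus `E_ab` spans an invariant line, and `V` transforms by the same character as
  -- `E_ab`. Reading off the entry `(a, b)` thus gives an equivariant family whose value at `E_ab`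
  -- is `V`.
  let Φ : EuclideanSpace ℂ (Fin 3 × Fin 3) →ₗ[ℂ] (H →L[ℂ] H) :=
    { toFun := fun e => e (a, b) • V
      map_add' := fun e e' => add_smul _ _ _
      map_smul' := fun c e => mul_smul _ _ _ }
  have h := columnFinite_of_equivariant (π := π.restrict (KS ∅)) (π' := π.restrict (KS ∅))
    (adjointRep.restrict (KS ∅)) Φ ?_ (EuclideanSpace.single (a, b) 1)
  · have h1 : Φ (EuclideanSpace.single (a, b) 1) = V := by
      change (EuclideanSpace.single (a, b) (1 : ℂ)) (a, b) • V = V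
      simp
    rwa [h1] at h
  · rintro ⟨g, hg⟩ e x
    have hd : ∀ a b, a ≠ b → g.1 a b = 0 := fun a b h =>
      hg a b fun h' => h (eq_of_sameBlock_empty h')
    have he : entries (adjointRep.toHom g e) a b =
        g.1 a a * (starRingEnd ℂ) (g.1 b b) * e (a, b) := by
      rw [entries_adjointRep, coe_inv_SU3, Matrix.mul_apply, Finset.sum_eq_single b,
        Matrix.mul_apply, Finset.sum_eq_single a, Matrix.star_apply]
      · change g.1 a a * e (a, b) * (starRingEnd ℂ) (g.1 b b) = _
        ring
      · intro c _ hc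
        rw [hd a c (Ne.symm hc), zero_mul]
      · simp
      · intro c _ hc
        rw [Matrix.star_apply, hd b c (Ne.symm hc), star_zero, mul_zero]
      · simp
    change entries (adjointRep.toHom g e) a b • V (π.toHom g x) = π.toHom g (e (a, b) • V x)
    rw [he, map_smul, mul_comm, mul_smul]
    congr 1
    refine Blocks.ext_comp (D := D) fun i => ?_
    have hρ : ∀ a b, (D.rep π hD i).toCLM g * (D.rep π hD i).unit a b =
        (g.1 a a * (starRingEnd ℂ) (g.1 b b)) •
          ((D.rep π hD i).unit a b * (D.rep π hD i).toCLM g) := fun a b => by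
      have h1 := (D.rep π hD i).toCLM_mul_op_mul g (Matrix.single a b 1)
      rw [coe_mul_single_mul_inv hg, map_smul] at h1
      rw [← smul_mul_assoc]
      change _ = (_ • (D.rep π hD i).op (Matrix.single a b 1)) * _
      rw [← h1, mul_assoc, UnitaryRep.toCLM_inv_mul, mul_one]
      rfl
    have h2 := semiconj_phase (c' := g.1 b b * (starRingEnd ℂ) (g.1 a a)) (by
      rw [mul_comm (g.1 b b), mul_mul_mul_comm, norm_diag_of_mem_KS_empty hg, mul_comm (g.1 b b),
        norm_diag_of_mem_KS_empty hg, one_mul]) (hρ a b) (by rw [UnitaryRep.star_unit, hρ b a])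
    have h3 := congrArg (fun k => k (D.comp i x)) h2
    rw [map_smul, hV, D.intertwines_comp π hD i, D.intertwines_comp π hD i, hV]
    exact h3.symm

end Equivariant

end HarmonicSU3
end

noncomputable section

namespace HarmonicSU3

/-! ### Integrality of the spectrum of `Z* Z` for a root vector `Z` -/

section Gap

variable {W : Type*} [AddCommGroup W] [Module ℂ W] [FiniteDimensional ℂ W]

/-- In a finite-dimensional representation of `𝔰𝔩₂` the eigenvalues of `f e` are integers. -/
theorem exists_int_of_sl2 {e f h : Module.End ℂ W} (hef : e * f - f * e = h)
    (he : h * e - e * h = (2 : ℂ) • e) (hf : h * f - f * h = -((2 : ℂ) • f)) {μ : ℂ}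
    (hμ : (f * e).HasEigenvalue μ) : ∃ z : ℤ, μ = z := by
  -- An `𝔰𝔩₂` triple is required to have `h ≠ 0`; in the degenerate case `e = 0` and the only
  -- eigenvalue is `0`.
  by_cases hh : h = 0
  · have he0 : e = 0 := by
      rw [hh, zero_mul, mul_zero, sub_zero] at he
      exact (smul_eq_zero.1 he.symm).resolve_left two_ne_zero
    rw [he0, mul_zero] at hμ
    obtain ⟨v, hv⟩ := hμ.exists_hasEigenvector
    have := hv.apply_eq_smul
    rw [LinearMap.zero_apply] at this
    refine ⟨0, ?_⟩
    rw [Int.cast_zero]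
    exact (smul_eq_zero.1 this.symm).resolve_right hv.2
  have happ : ∀ {S T U : Module.End ℂ W}, S * T - T * S = U → ∀ x, S (T x) = T (S x) + U x :=
    fun {S T U} h x => by
      have := congrArg (fun k => k x) h
      simp only [LinearMap.sub_apply, Module.End.mul_apply] at this
      rw [← this, add_sub_cancel]
  have hcomm : ∀ x, h (f (e x)) = f (e (h x)) := fun x => by
    rw [happ hf, happ he]
    simp
  -- a common eigenvector of `f e` and `h`
  obtain ⟨v, hv0, hfe, c, hhv⟩ : ∃ v ≠ 0, f (e v) = μ • v ∧ ∃ c : ℂ, h v = c • v := by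
    have hmaps : ∀ x ∈ (f * e).eigenspace μ, h x ∈ (f * e).eigenspace μ := fun x hx => by
      rw [Module.End.mem_eigenspace_iff] at hx ⊢
      change f (e (h x)) = _
      rw [← hcomm, show f (e x) = μ • x from hx, map_smul]
    have : Nontrivial ((f * e).eigenspace μ) := Submodule.nontrivial_iff_ne_bot.2 hμ
    obtain ⟨c, hc⟩ := Module.End.exists_eigenvalue (h.restrict hmaps)
    obtain ⟨w, hw⟩ := hc.exists_hasEigenvector
    refine ⟨w, fun h0 => hw.2 (Subtype.ext h0), Module.End.mem_eigenspace_iff.1 w.2, c, ?_⟩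
    exact congrArg Subtype.val hw.apply_eq_smul
  -- Climbing the ladder by `e` keeps track of the weight and of the eigenvalue of `f e`. At the
  -- last nonzero vector `e^n v` that eigenvalue is zero, so `μ = n (c + n + 1)`.
  have hk : ∀ k : ℕ, h ((e ^ k) v) = (c + 2 * k) • (e ^ k) v ∧
      f (e ((e ^ k) v)) = (μ - k * (c + k + 1)) • (e ^ k) v := by
    intro k
    induction k with
    | zero => simpa using ⟨hhv, hfe⟩
    | succ k ih =>
      obtain ⟨ih1, ih2⟩ := ih
      have h1 : h (e ((e ^ k) v)) = (c + 2 * (k + 1 : ℕ)) • e ((e ^ k) v) := by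
        rw [happ he, ih1, map_smul, LinearMap.smul_apply, ← add_smul]
        congr 1; push_cast; ring
      refine ⟨by rw [pow_succ']; exact h1, ?_⟩
      rw [pow_succ', Module.End.mul_apply]
      have h2 : ∀ x, f (e x) = e (f x) - h x := fun x => by rw [happ hef, add_sub_cancel_right]
      rw [h2, ih2, map_smul, h1, ← sub_smul]
      congr 1; push_cast; ring
  have hex : ∃ k, (e ^ k) v = 0 := by
    by_contra! hne
    refine Set.infinite_of_injective_forall_mem (f := fun k : ℕ => c + 2 * k)
      (s := {x | h.HasEigenvalue x}) ?_ (fun k => ?_) (Module.End.finite_hasEigenvalue h)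
    · intro k l hkl
      simpa using hkl
    · exact Module.End.hasEigenvalue_of_hasEigenvector
        ⟨Module.End.mem_eigenspace_iff.2 (hk k).1, hne k⟩
  obtain ⟨n, hn1, hn2⟩ := Nat.exists_not_and_succ_of_not_zero_of_exists (p := fun k => (e ^ k) v = 0)
    (by simpa using hv0) hex
  have hn2' : e ((e ^ n) v) = 0 := by rw [← hn2, pow_succ']; rfl
  have h0 := (hk n).2
  rw [hn2', map_zero] at h0
  have hμn := (smul_eq_zero.1 h0.symm).resolve_right hn1
  let _ := LieRing.ofAssociativeRing (A := Module.End ℂ W)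
  have ht : IsSl2Triple h e f := ⟨hh, hef, by rw [← Nat.cast_smul_eq_nsmul ℂ]; exact he,
    by rw [← Nat.cast_smul_eq_nsmul ℂ]; exact hf⟩
  -- The highest weight `t = c + 2n` is a natural number, so `c = t - 2n` and `μ = n (t - n + 1)` is
  -- an integer.
  have hP : ht.HasPrimitiveVectorWith ((e ^ n) v) (c + 2 * n) := ⟨hn1, (hk n).1, hn2'⟩
  obtain ⟨t, ht'⟩ := hP.exists_nat
  refine ⟨n * (t - n + 1), ?_⟩
  rw [sub_eq_zero] at hμn
  rw [hμn, eq_sub_of_add_eq ht']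
  push_cast; ring

end Gap

/-- `E_ab`, `E_ba` and `E_aa - E_bb` form an `𝔰𝔩₂` triple, and a positive integer is at least one.
This spectral gap replaces the concentration estimate on blocks with bounded Casimir eigenvalue. -/
theorem UnitaryRep.one_le_of_eigen {W : Type*} [NormedAddCommGroup W] [InnerProductSpace ℂ W]
    [FiniteDimensional ℂ W] [CompleteSpace W] (ρ : UnitaryRep SU3 W) {a b : Fin 3} (hab : a ≠ b)
    {μ : ℝ} {x : W} (hx : x ≠ 0)
    (h : (star (ρ.unit a b) * ρ.unit a b) x = (μ : ℂ) • x) (hμ : 0 < μ) : 1 ≤ μ := by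
  rw [star_unit] at h
  have h1 := ρ.unit_commutator a b b a
  rw [if_pos rfl, if_pos rfl] at h1
  have h2 : (ρ.unit a a - ρ.unit b b) * ρ.unit a b - ρ.unit a b * (ρ.unit a a - ρ.unit b b) =
      (2 : ℂ) • ρ.unit a b := by
    have e1 := ρ.unit_commutator a a a b
    have e2 := ρ.unit_commutator b b a b
    rw [if_pos rfl, if_neg hab.symm, sub_zero] at e1
    rw [if_neg hab.symm, if_pos rfl, zero_sub] at e2
    rw [sub_mul, mul_sub, sub_sub_sub_comm, e1, e2, sub_neg_eq_add, two_smul]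
  have h3 : (ρ.unit a a - ρ.unit b b) * ρ.unit b a - ρ.unit b a * (ρ.unit a a - ρ.unit b b) =
      -((2 : ℂ) • ρ.unit b a) := by
    have e1 := ρ.unit_commutator a a b a
    have e2 := ρ.unit_commutator b b b a
    rw [if_neg hab, if_pos rfl, zero_sub] at e1
    rw [if_pos rfl, if_neg hab, sub_zero] at e2
    rw [sub_mul, mul_sub, sub_sub_sub_comm, e1, e2, two_smul]
    abel
  obtain ⟨z, hz⟩ := exists_int_of_sl2 (e := (ρ.unit a b).toLinearMap) (f := (ρ.unit b a).toLinearMap)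
    (h := (ρ.unit a a - ρ.unit b b).toLinearMap) (congrArg ContinuousLinearMap.toLinearMap h1)
    (congrArg ContinuousLinearMap.toLinearMap h2) (congrArg ContinuousLinearMap.toLinearMap h3)
    (Module.End.hasEigenvalue_of_hasEigenvector ⟨Module.End.mem_eigenspace_iff.2 h, hx⟩)
  have hz' : μ = z := by exact_mod_cast hz
  rw [hz'] at hμ ⊢
  exact_mod_cast hμ

end HarmonicSU3
end

noncomputable section

namespace HarmonicSU3

/-! ### Boundedness of the infinitesimal action on isotypical subspaces -/

section IsotypicBound

variable {S : Set (Fin 2)}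

theorem apply_eq_of_hasDerivAt {W E : Type*} [NormedAddCommGroup W] [NormedSpace ℂ W]
    [NormedAddCommGroup E] [NormedSpace ℂ E] {f : ℝ → W →L[ℂ] W} {g : ℝ → E →L[ℂ] E}
    {a : W →L[ℂ] W} {b : E →L[ℂ] E} (hf : HasDerivAt f a 0) (hg : HasDerivAt g b 0)
    (T : W →L[ℂ] E) (h : ∀ t z, T (f t z) = g t (T z)) (z : W) : T (a z) = b (T z) := by
  have h1 : HasDerivAt (fun t => T (f t z)) (T (a z)) 0 :=
    ((T ∘L (ContinuousLinearMap.apply ℂ W z)).restrictScalars ℝ).hasFDerivAt.comp_hasDerivAt 0 hf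
  have h2 : HasDerivAt (fun t => g t (T z)) (b (T z)) 0 :=
    ((ContinuousLinearMap.apply ℂ E (T z)).restrictScalars ℝ).hasFDerivAt.comp_hasDerivAt 0 hg
  simp only [h] at h1
  exact h1.unique h2

theorem single_apply_eq_zero {a b : Fin 3} (hab : SameBlock S a b) (c d : Fin 3)
    (h : ¬ SameBlock S c d) : Matrix.single a b (1 : ℂ) c d = 0 := by
  rw [Matrix.single_apply, if_neg]
  rintro ⟨rfl, rfl⟩
  exact h hab

theorem commute_proj_op {W : Type*} [NormedAddCommGroup W] [InnerProductSpace ℂ W]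
    [FiniteDimensional ℂ W] [CompleteSpace W] (ρ : UnitaryRep SU3 W) (σ : Types (KS S))
    {Z : Matrix (Fin 3) (Fin 3) ℂ} (hZ : ∀ a b, ¬ SameBlock S a b → Z a b = 0) :
    (ρ.restrict (KS S)).proj σ * ρ.op Z = ρ.op Z * (ρ.restrict (KS S)).proj σ :=
  commute_op_of_commute_KS ρ (fun k hk => by
    ext x
    exact (ρ.restrict (KS S)).intertwines_proj σ ⟨k, hk⟩ x) hZ

/-- On a multiple of `τ` the element `A` acts as the fixed matrix `b` by which it acts on `τ`, so
`‖b‖` serves for all `W` at once. The isotypical subspace is not decomposed: an eigenvector of `-a²`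
in it is mapped to a nonzero vector of `τ` by the adjoint of some intertwiner, and there becomes an
eigenvector of `-b²`. -/
theorem exists_norm_deriv_le (σ : Types (KS S)) {A : su3}
    (hA : ∀ a b, ¬ SameBlock S a b → (A : Matrix (Fin 3) (Fin 3) ℂ) a b = 0) :
    ∃ m : ℝ, 0 ≤ m ∧ ∀ (W : Type u) [NormedAddCommGroup W] [InnerProductSpace ℂ W]
      [FiniteDimensional ℂ W] [CompleteSpace W] (ρ : UnitaryRep SU3 W),
      ∀ v ∈ (ρ.restrict (KS S)).isotypic σ, ‖ρ.op A v‖ ≤ m * ‖v‖ := by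
  let γ : ℝ → KS S := fun t => ⟨expSU (t • A), expSU_mem_KS hA t⟩
  have hγ : Continuous γ := (continuous_expSU_smul A).subtype_mk _
  have hγ0 : γ 0 = 1 := Subtype.ext (expSU_zero_smul A)
  have hγadd : ∀ s t, γ (s + t) = γ s * γ t := fun s t => Subtype.ext (expSU_add_smul s t A)
  obtain ⟨τ, hτ⟩ := Quotient.exists_rep σ
  have hder : ∀ τ : ConcreteIrrep (KS S), ∃ b, HasDerivAt (fun t => τ.2.1.toCLM (γ t)) b 0 :=
    fun τ => τ.2.1.exists_hasDerivAt_toCLM hγ hγ0 hγadd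
  obtain ⟨b, hb⟩ := hder τ
  refine ⟨‖b‖, norm_nonneg _, fun W _ _ _ _ ρ v hv => ?_⟩
  set a := ρ.op A with ha
  have hda : HasDerivAt (fun t : ℝ => ρ.toCLM (expSU (t • A))) a 0 := by
    rw [ha, UnitaryRep.op_coe]; exact ρ.hasDerivAt A
  obtain ⟨p, hp⟩ : ∃ p, p = (ρ.restrict (KS S)).proj σ := ⟨_, rfl⟩
  have hpa : p * a = a * p := by rw [hp]; exact commute_proj_op ρ σ hA
  have hsa : star a = -a := by
    rw [ha, UnitaryRep.star_op, A.2.1, map_neg]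
  have hps : star p = p := by
    rw [hp, ContinuousLinearMap.star_eq_adjoint]; exact UnitaryRep.adjoint_proj _ _
  have hpp : p * p = p := by rw [hp]; exact UnitaryRep.proj_comp_self _ _
  have hZZ : star (a * p) * (a * p) = -(a * a) * p := by
    rw [star_mul, hps, hsa, mul_assoc, ← mul_assoc (-a), neg_mul, neg_mul, mul_neg, ← mul_assoc p,
      ← mul_assoc p, hpa, mul_assoc a p, hpa, mul_assoc, mul_assoc a p, hpp, mul_assoc]
  have key : ∀ (μ : ℝ) (x : W), x ≠ 0 → (star (a * p) * (a * p)) x = (μ : ℂ) • x →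
      |√μ| ≤ ‖b‖ := fun μ x hx hμ => by
    have hμ0 := nonneg_of_eigen hμ hx
    rw [abs_of_nonneg (Real.sqrt_nonneg μ)]
    rcases hμ0.eq_or_lt with rfl | hμpos
    · rw [Real.sqrt_zero]; exact norm_nonneg b
    have hμne : (μ : ℂ) ≠ 0 := by exact_mod_cast hμpos.ne'
    -- The operator `(a p)* (a p) = -a² p` has range in the isotypical subspace, so its eigenvectors
    -- for nonzero eigenvalues already lie there.
    have hpx : p x = x := by
      have h1 : p * (star (a * p) * (a * p)) = star (a * p) * (a * p) := by
        rw [star_mul, hps, mul_assoc p, ← mul_assoc p p, hpp]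
      have h2 : p ((star (a * p) * (a * p)) x) = (star (a * p) * (a * p)) x :=
        congrArg (fun k => k x) h1
      rw [hμ, map_smul] at h2
      exact smul_right_injective W hμne h2
    have hxmem : x ∈ (ρ.restrict (KS S)).isotypic σ := by
      rw [← hpx, hp]; exact UnitaryRep.proj_mem _ _ _
    have haa : -(a (a x)) = (μ : ℂ) • x := by
      rw [← hμ, hZZ]
      change _ = -(a (a (p x)))
      rw [hpx]
    obtain ⟨T, hT, hTx⟩ : ∃ T : EuclideanSpace ℂ (Fin τ.1) →L[ℂ] W,
        UnitaryRep.Intertwines τ.2.1 (ρ.restrict (KS S)) T ∧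
        ContinuousLinearMap.adjoint T x ≠ 0 := by
      by_contra! hcon
      refine hx (inner_self_eq_zero (𝕜 := ℂ) |>.1 ?_)
      refine UnitaryRep.eq_zero_of_mem_isotypic (innerSL ℂ x) (fun τ' hτ' T hT y => ?_) hxmem
      obtain ⟨U, hU⟩ := Quotient.exact (hτ.trans hτ'.symm)
      have h1 := hcon (T ∘L (U : EuclideanSpace ℂ (Fin τ.1) →L[ℂ] EuclideanSpace ℂ (Fin τ'.1)))
        (fun g z => (congrArg T (hU g z)).trans (hT g (U z)))
      have h2 := congrArg (fun z => inner ℂ z (U.symm y)) h1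
      simp only [ContinuousLinearMap.adjoint_inner_left, inner_zero_left] at h2
      rw [← U.apply_symm_apply y]
      exact h2
    have hTa : ∀ z, ContinuousLinearMap.adjoint T (a z) = b (ContinuousLinearMap.adjoint T z) :=
      apply_eq_of_hasDerivAt hda hb _ fun t z => hT.adjoint (γ t) z
    have h1 := congrArg (fun z => ‖ContinuousLinearMap.adjoint T z‖) haa
    simp only [map_neg, map_smul, hTa, norm_neg, norm_smul, Complex.norm_real, Real.norm_eq_abs,
      abs_of_pos hμpos] at h1
    have h2 := (b.le_opNorm (b (ContinuousLinearMap.adjoint T x))).trans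
      (mul_le_mul_of_nonneg_left (b.le_opNorm _) (norm_nonneg b))
    rw [h1, ← mul_assoc] at h2
    have h3 := le_of_mul_le_mul_right h2 (norm_pos_iff.2 hTx)
    rw [← sq] at h3
    exact Real.sqrt_le_iff.2 ⟨norm_nonneg b, h3⟩
  have hpv : p v = v := by rw [hp]; exact UnitaryRep.proj_apply_of_mem _ hv
  have h1 := norm_modulus_apply (a * p) v
  have h2 := norm_gramFun_apply_le_const (norm_nonneg b) key v
  have h3 : (a * p) v = a v := congrArg a hpv
  rw [← h3, ← h1]
  exact h2

/-- The matrix units in the blocks of `S` act on the `σ`-isotypical subspaces with a bound that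
depends only on `σ`. -/
theorem exists_norm_unit_le (σ : Types (KS S)) :
    ∃ M : ℝ, 0 ≤ M ∧ ∀ (W : Type u) [NormedAddCommGroup W] [InnerProductSpace ℂ W]
      [FiniteDimensional ℂ W] [CompleteSpace W] (ρ : UnitaryRep SU3 W) (a b : Fin 3),
      SameBlock S a b → ∀ v ∈ (ρ.restrict (KS S)).isotypic σ,
      ρ.unit a b v ∈ (ρ.restrict (KS S)).isotypic σ ∧ ‖ρ.unit a b v‖ ≤ M * ‖v‖ := by
  have hex : ∀ a b, ∃ m : ℝ, 0 ≤ m ∧ (SameBlock S a b → ∀ (W : Type u) [NormedAddCommGroup W]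
      [InnerProductSpace ℂ W] [FiniteDimensional ℂ W] [CompleteSpace W] (ρ : UnitaryRep SU3 W),
      ∀ v ∈ (ρ.restrict (KS S)).isotypic σ, ‖ρ.unit a b v‖ ≤ m * ‖v‖) := fun a b => by
    by_cases hab : SameBlock S a b
    · obtain ⟨m, hm0, hm⟩ := exists_norm_deriv_le.{u} σ
        (fun c d => skew_apply_eq_zero (single_apply_eq_zero hab))
      obtain ⟨m', hm0', hm'⟩ := exists_norm_deriv_le.{u} σ
        (fun c d => skew_apply_eq_zero (Z := Complex.I • Matrix.single a b 1) fun a' b' h => by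
          rw [Matrix.smul_apply, single_apply_eq_zero hab a' b' h, smul_zero])
      refine ⟨m + m', by positivity, fun _ W _ _ _ _ ρ v hv => ?_⟩
      rw [UnitaryRep.unit, UnitaryRep.op_apply, ← UnitaryRep.op_coe, ← UnitaryRep.op_coe,
        _root_.sub_apply, _root_.smul_apply, add_mul]
      refine (norm_sub_le _ _).trans (add_le_add (hm W ρ v hv) ?_)
      rw [norm_smul, Complex.norm_I, one_mul]
      exact hm' W ρ v hv
    · exact ⟨0, le_rfl, fun h => absurd h hab⟩
  choose m hm0 hm using hex
  refine ⟨∑ a, ∑ b, m a b, Finset.sum_nonneg fun _ _ => Finset.sum_nonneg fun _ _ => hm0 _ _,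
    fun W _ _ _ _ ρ a b hab v hv => ⟨?_, ?_⟩⟩
  · have h := congrArg (fun k => k v) (commute_proj_op ρ σ (single_apply_eq_zero hab))
    have h1 : (ρ.restrict (KS S)).proj σ (ρ.unit a b v) = ρ.unit a b v := by
      have h2 := (ρ.restrict (KS S)).proj_apply_of_mem hv
      generalize (ρ.restrict (KS S)).proj σ = p at *
      exact h.trans (congrArg (ρ.unit a b) h2)
    rw [← h1]
    exact UnitaryRep.proj_mem _ _ _
  · refine (hm a b hab W ρ v hv).trans (mul_le_mul_of_nonneg_right ?_ (norm_nonneg v))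
    refine le_trans ?_ (Finset.single_le_sum (f := fun a => ∑ b, m a b)
      (fun _ _ => Finset.sum_nonneg fun _ _ => hm0 _ _) (Finset.mem_univ a))
    exact Finset.single_le_sum (f := fun b => m a b) (fun _ _ => hm0 _ _) (Finset.mem_univ b)

end IsotypicBound

end HarmonicSU3
end

noncomputable section

namespace HarmonicSU3

/-! ### Resolvent identities -/

section Resolvent

variable {A : Type*} [Ring A] {X₁ X₂ X₃ Y₁ Y₃ H₁ R R' d : A}

/-- `R` and `R'` invert `Y₁X₁ + d` and `X₁Y₁ + d`. If `P` intertwines `Y₁X₁` with `X₁Y₁` up to `Q`,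
moving the resolvent across `P` costs `R' Q R`. -/
theorem resolvent_mul_eq (hd : ∀ x, d * x = x * d) (hR : (Y₁ * X₁ + d) * R = 1)
    (hR' : R' * (X₁ * Y₁ + d) = 1) {P Q : A}
    (h : P * (Y₁ * X₁) - X₁ * Y₁ * P = Q) : R' * P = P * R + R' * Q * R := by
  have h1 : R' * P = R' * (P * (Y₁ * X₁) + P * d) * R := by
    rw [← mul_add, mul_assoc, mul_assoc, hR, mul_one]
  have h2 : P * R = R' * (X₁ * Y₁ * P + P * d) * R := by
    rw [← hd, ← add_mul, ← mul_assoc R', hR', one_mul]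
  rw [h1, h2, ← h]
  noncomm_ring

/-- The commutator of `X₂` with `Y₃ X₁ R`. -/
theorem commutator_resolvent (hd : ∀ x, d * x = x * d) (hR : (Y₁ * X₁ + d) * R = 1)
    (hR' : R' * (X₁ * Y₁ + d) = 1) (h12 : X₂ * X₁ = X₁ * X₂ - X₃)
    (h23 : X₂ * Y₃ = Y₃ * X₂ + Y₁) (h21 : X₂ * Y₁ = Y₁ * X₂) :
    X₂ * (Y₃ * X₁ * R) - Y₃ * X₁ * R * X₂ = Y₁ * X₁ * R - d * (Y₃ * R' * X₃ * R) := by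
  have e1 : R' * X₁ = X₁ * R := by
    rw [resolvent_mul_eq hd hR hR' (P := X₁) (Q := 0) (by noncomm_ring)]
    simp
  have e2 : R' * (X₁ * X₂) = X₁ * X₂ * R + R' * (-(X₁ * Y₁ * X₃)) * R :=
    resolvent_mul_eq hd hR hR' (by
      have : X₁ * X₂ * (Y₁ * X₁) = X₁ * Y₁ * (X₂ * X₁) := by
        rw [mul_assoc, ← mul_assoc X₂, h21]; noncomm_ring
      rw [this, h12]; noncomm_ring)
  have e3 : R' * (X₁ * Y₁) = 1 - R' * d := by
    rw [← hR']; noncomm_ring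
  have e4 : X₂ * (Y₃ * X₁ * R) = Y₃ * (X₁ * X₂ - X₃) * R + Y₁ * X₁ * R := by
    rw [← h12, ← mul_assoc, ← mul_assoc, h23]; noncomm_ring
  have e5 : Y₃ * X₁ * R * X₂ = Y₃ * (X₁ * X₂ * R - (1 - R' * d) * X₃ * R) := by
    rw [← e3, mul_assoc Y₃, ← e1, mul_assoc Y₃, mul_assoc R', e2]; noncomm_ring
  rw [e4, e5, hd]
  have e6 : Y₃ * R' * X₃ * R * d = Y₃ * (R' * d * X₃ * R) := by
    rw [← hd, ← hd R']
    simp only [← mul_assoc, hd Y₃]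
  rw [e6]
  noncomm_ring

/-- The commutator identity for `X₂` contains `R' X₃`. This exchanges it for `X₃ R`, with an error
carrying one more resolvent and hence of lower order in `k`. -/
theorem resolvent_commutator (hd : ∀ x, d * x = x * d) (hR : (Y₁ * X₁ + d) * R = 1)
    (hR' : R' * (X₁ * Y₁ + d) = 1) (h31 : X₃ * Y₁ = Y₁ * X₃ - X₂) (h13 : X₃ * X₁ = X₁ * X₃)
    (hH : X₁ * Y₁ = Y₁ * X₁ + H₁) :
    X₃ * R = R' * X₃ + R' * (X₂ * X₁ + H₁ * X₃) * R := by
  have h : X₃ * (Y₁ * X₁) - X₁ * Y₁ * X₃ = -(X₂ * X₁ + H₁ * X₃) := by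
    have : X₃ * (Y₁ * X₁) = Y₁ * (X₃ * X₁) - X₂ * X₁ := by
      rw [← mul_assoc, h31]; noncomm_ring
    rw [this, h13, hH]; noncomm_ring
  rw [resolvent_mul_eq hd hR hR' h]
  noncomm_ring

end Resolvent

/-! ### The mass of isotypical vectors near the kernel of a root vector -/

section Mass

set_option linter.unusedSectionVars false

variable {W : Type*} [NormedAddCommGroup W] [InnerProductSpace ℂ W] [FiniteDimensional ℂ W]
  [CompleteSpace W]

/-- The resolvent `(Z* Z + d)⁻¹`. -/
def resolv (Z : W →L[ℂ] W) (d : ℝ) : W →L[ℂ] W := gramFun Z fun x => (x + d)⁻¹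

theorem mul_resolv (Z : W →L[ℂ] W) {d : ℝ} (hd : 0 < d) :
    (star Z * Z + (d : ℂ) • 1) * resolv Z d = 1 := by
  rw [← gramFun_id, ← gramFun_const, ← gramFun_add, resolv, gramFun_mul]
  refine (gramFun_congr (g := fun _ => 1) fun x hx => mul_inv_cancel₀ (by positivity)).trans ?_
  rw [gramFun_const, Complex.ofReal_one, one_smul]

theorem resolv_mul (Z : W →L[ℂ] W) {d : ℝ} (hd : 0 < d) :
    resolv Z d * (star Z * Z + (d : ℂ) • 1) = 1 := by
  rw [← gramFun_id, ← gramFun_const, ← gramFun_add, resolv, gramFun_mul]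
  refine (gramFun_congr (g := fun _ => 1) fun x hx => inv_mul_cancel₀ (by positivity)).trans ?_
  rw [gramFun_const, Complex.ofReal_one, one_smul]

theorem norm_resolv_apply_le (Z : W →L[ℂ] W) {d : ℝ} (hd : 0 < d) (x : W) :
    ‖resolv Z d x‖ ≤ d⁻¹ * ‖x‖ :=
  norm_gramFun_apply_le_const (by positivity) (fun μ y hy h => by
    have := nonneg_of_eigen h hy
    rw [abs_of_nonneg (by positivity)]
    exact inv_anti₀ hd (by linarith)) x

theorem norm_gram_resolv_apply_le (Z : W →L[ℂ] W) {d : ℝ} (hd : 0 < d) (x : W) :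
    ‖(star Z * Z) (resolv Z d x)‖ ≤ ‖x‖ := by
  have h : star Z * Z * resolv Z d = gramFun Z fun x => x * (x + d)⁻¹ := by
    rw [resolv, ← gramFun_mul, gramFun_id]
  have h1 := norm_gramFun_apply_le_const (Z := Z) (f := fun x => x * (x + d)⁻¹) zero_le_one
    (fun μ y hy h => by
      have := nonneg_of_eigen h hy
      rw [abs_of_nonneg (by positivity), ← div_eq_mul_inv]
      exact div_le_one_of_le₀ (by linarith) (by positivity)) x
  rw [← h, one_mul] at h1
  exact h1

theorem norm_mul_resolv_apply_le (Z : W →L[ℂ] W) {d : ℝ} (hd : 0 < d) (x : W) :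
    ‖Z (resolv Z d x)‖ ≤ (√d)⁻¹ * ‖x‖ := by
  have h := norm_mul_gramFun_apply Z (fun x => (x + d)⁻¹) x
  change ‖Z (resolv Z d x)‖ = _ at h
  rw [h]
  refine norm_gramFun_apply_le_const (by positivity) (fun μ y hy h => ?_) x
  have := nonneg_of_eigen h hy
  have h1 := Real.sqrt_pos.2 hd
  have h2 := Real.sq_sqrt hd.le
  have h3 := Real.sq_sqrt this
  rw [abs_of_nonneg (by positivity), ← div_eq_mul_inv, div_le_iff₀ (by positivity),
    ← mul_le_mul_iff_right₀ h1, mul_inv_cancel_left₀ h1.ne']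
  nlinarith [sq_nonneg (√d - √μ)]

theorem norm_inner_le_of_norm_le {x v : W} {c : ℝ} (h : ‖x‖ ≤ c * ‖v‖) :
    ‖inner ℂ x v‖ ≤ c * ‖v‖ ^ 2 := by
  refine (norm_inner_le_norm x v).trans ?_
  rw [sq, ← mul_assoc]
  exact mul_le_mul_of_nonneg_right h (norm_nonneg v)

/-- Pair the Casimir identity `hC` with `d R² v`. The term with `X₁* X₁` is bounded because `d R`
and `X₁* X₁ R` are contractions. The term with `X₃* X₃` is traded, through the commutator of `X₂`
with `B = X₃* X₁ R`, for terms in which `X₂` or its adjoint meets `v` directly, where the bound `M`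
applies instead of `k`. Here `e` measures the spectral window `d = e² k²`, and only terms small in
`e` or in `1/k` remain. -/
theorem mass_estimate {X₁ X₂ X₃ H₁ : W →L[ℂ] W} {k e M M₂ : ℝ} (hk : 0 < k) (he : 0 < e)
    (h12 : X₂ * X₁ = X₁ * X₂ - X₃) (h23 : X₂ * star X₃ = star X₃ * X₂ + star X₁)
    (h21 : X₂ * star X₁ = star X₁ * X₂) (h31 : X₃ * star X₁ = star X₁ * X₃ - X₂)
    (h13 : X₃ * X₁ = X₁ * X₃) (hH : X₁ * star X₁ = star X₁ * X₁ + H₁)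
    (n2 : ‖X₂‖ ≤ k) (n3 : ‖X₃‖ ≤ k) (nH : ‖H₁‖ ≤ 2 * k) {v c : W}
    (hC : ((k ^ 2 : ℝ) : ℂ) • v =
      (2 : ℂ) • (star X₁ * X₁) v + (2 : ℂ) • (star X₃ * X₃) v + c)
    (hc : ‖c‖ ≤ M₂ * ‖v‖) (hv : ‖X₂ v‖ ≤ M * ‖v‖) (hv' : ‖star X₂ v‖ ≤ M * ‖v‖) :
    (e ^ 2 * k ^ 2) ^ 2 * ‖resolv X₁ (e ^ 2 * k ^ 2) v‖ ^ 2 ≤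
      (4 * e ^ 2 + 4 * M * e + (2 / k) * (1 / e + 2 / e ^ 2) + M₂ / k ^ 2) * ‖v‖ ^ 2 := by
  obtain ⟨d, hd⟩ : ∃ d, d = e ^ 2 * k ^ 2 := ⟨_, rfl⟩
  have hd0 : 0 < d := by rw [hd]; positivity
  have hsd : √d = e * k := by rw [hd, ← mul_pow, Real.sqrt_sq (by positivity)]
  rw [← hd]
  obtain ⟨R, hRdef⟩ : ∃ R, R = resolv X₁ d := ⟨_, rfl⟩
  obtain ⟨R', hRdef'⟩ : ∃ R', R' = resolv (star X₁) d := ⟨_, rfl⟩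
  have hdc : ∀ x : W →L[ℂ] W, ((d : ℂ) • (1 : W →L[ℂ] W)) * x = x * ((d : ℂ) • 1) := fun x => by
    rw [smul_one_mul, mul_smul_one]
  have hR : (star X₁ * X₁ + (d : ℂ) • 1) * R = 1 := by rw [hRdef]; exact mul_resolv _ hd0
  have hR' : R' * (X₁ * star X₁ + (d : ℂ) • 1) = 1 := by
    have := resolv_mul (star X₁) hd0
    rwa [star_star, ← hRdef'] at this
  have i1 := commutator_resolvent hdc hR hR' h12 h23 h21
  have i2 := resolvent_commutator hdc hR hR' h31 h13 hH
  have bR : ∀ x, ‖R x‖ ≤ d⁻¹ * ‖x‖ := fun x => by rw [hRdef]; exact norm_resolv_apply_le _ hd0 x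
  have bR' : ∀ x, ‖R' x‖ ≤ d⁻¹ * ‖x‖ := fun x => by
    rw [hRdef']; exact norm_resolv_apply_le _ hd0 x
  have bAR : ∀ x, ‖(star X₁ * X₁) (R x)‖ ≤ ‖x‖ := fun x => by
    rw [hRdef]; exact norm_gram_resolv_apply_le _ hd0 x
  have bXR : ∀ x, ‖X₁ (R x)‖ ≤ (e * k)⁻¹ * ‖x‖ := fun x => by
    rw [hRdef, ← hsd]; exact norm_mul_resolv_apply_le _ hd0 x
  have b3 : ∀ x, ‖star X₃ x‖ ≤ k * ‖x‖ := fun x =>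
    ((star X₃).le_opNorm x).trans (mul_le_mul_of_nonneg_right (by rwa [norm_star]) (norm_nonneg x))
  have hsR : ∀ x y, inner ℂ (R x) y = inner ℂ x (R y) := fun x y => by
    rw [← ContinuousLinearMap.adjoint_inner_right, ← ContinuousLinearMap.star_eq_adjoint, hRdef,
      resolv, star_gramFun]
  rw [← hRdef]
  set B := star X₃ * X₁ * R with hB
  -- The factor `k` from `X₃*` is cancelled by `‖X₁ R‖ ≤ d^(-1/2) = (e k)⁻¹`, so `B` is bounded
  -- independently of `k`.
  have bB : ∀ x, ‖B x‖ ≤ e⁻¹ * ‖x‖ := fun x => by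
    change ‖star X₃ (X₁ (R x))‖ ≤ _
    refine (b3 _).trans ((mul_le_mul_of_nonneg_left (bXR x) hk.le).trans_eq ?_)
    field_simp
  -- the remainder term
  set Q := star X₃ (R' ((X₂ * X₁ + H₁ * X₃) (R (R v)))) with hQ
  have bQ : ‖Q‖ ≤ k * d⁻¹ * (1 / e + 2 / e ^ 2) * d⁻¹ * ‖v‖ := by
    have q1 : ‖(X₂ * X₁ + H₁ * X₃) (R (R v))‖ ≤ (1 / e + 2 / e ^ 2) * ‖R v‖ := by
      have q2 : ‖X₂ (X₁ (R (R v)))‖ ≤ k * ((e * k)⁻¹ * ‖R v‖) :=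
        (X₂.le_opNorm _).trans (mul_le_mul n2 (bXR _) (norm_nonneg _) hk.le)
      have q3 : ‖H₁ (X₃ (R (R v)))‖ ≤ (2 * k) * (k * (d⁻¹ * ‖R v‖)) :=
        (H₁.le_opNorm _).trans (mul_le_mul nH ((X₃.le_opNorm _).trans
          (mul_le_mul n3 (bR _) (norm_nonneg _) hk.le)) (norm_nonneg _) (by positivity))
      refine (norm_add_le _ _).trans ((add_le_add q2 q3).trans_eq ?_)
      rw [hd]
      field_simp
    have q4 : 0 ≤ 1 / e + 2 / e ^ 2 := by positivity
    calc ‖Q‖ ≤ k * (d⁻¹ * ((1 / e + 2 / e ^ 2) * (d⁻¹ * ‖v‖))) :=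
          (b3 _).trans (mul_le_mul_of_nonneg_left ((bR' _).trans (mul_le_mul_of_nonneg_left
            (q1.trans (mul_le_mul_of_nonneg_left (bR v) q4)) (by positivity))) hk.le)
      _ = _ := by ring
  -- The commutator identity applied to `v`, with `R' X₃ R v` replaced by `X₃ R R v` at the cost of
  -- `Q`.
  have hY3 : (d : ℂ) • (star X₃ * X₃) (R (R v)) =
      (star X₁ * X₁) (R v) - X₂ (B v) + B (X₂ v) + (d : ℂ) • Q := by
    have j1 := congrArg (fun T => T v) i1
    have j2 := congrArg (fun T => T (R v)) i2
    change X₂ (B v) - B (X₂ v) = (star X₁ * X₁) (R v) -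
      ((d : ℂ) • (1 : W →L[ℂ] W)) (star X₃ (R' (X₃ (R v)))) at j1
    rw [_root_.smul_apply, one_apply_eq_self] at j1
    change X₃ (R (R v)) = R' (X₃ (R v)) + R' ((X₂ * X₁ + H₁ * X₃) (R (R v))) at j2
    change (d : ℂ) • star X₃ (X₃ (R (R v))) = _
    rw [j2, map_add, smul_add, hQ]
    congr 1
    rw [sub_add, j1, sub_sub_cancel]
  -- the main identity
  have hmain : ((d * k ^ 2 * ‖R v‖ ^ 2 : ℝ) : ℂ) =
      2 * (inner ℂ ((star X₁ * X₁) (R ((d : ℂ) • R v))) v + inner ℂ ((star X₁ * X₁) (R v)) v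
        - inner ℂ (B v) (star X₂ v) + inner ℂ (B (X₂ v)) v + inner ℂ ((d : ℂ) • Q) v)
        + inner ℂ (R ((d : ℂ) • R v)) c := by
    have m1 : ((d * k ^ 2 * ‖R v‖ ^ 2 : ℝ) : ℂ) = d * inner ℂ (R (R v)) (((k ^ 2 : ℝ) : ℂ) • v) := by
      rw [inner_smul_right, hsR, inner_self_eq_norm_sq_to_K]
      push_cast
      rw [mul_assoc]
      rfl
    have m2 : ∀ (T : W →L[ℂ] W) (x y : W),
        inner ℂ x ((star T * T) y) = inner ℂ ((star T * T) x) y := fun T x y =>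
      ((isSymmetric_star_mul_self T) x y).symm
    have m3 : ∀ x y : W, inner ℂ ((d : ℂ) • x) y = d * inner ℂ x y := fun x y => by
      rw [inner_smul_left, Complex.conj_ofReal]
    have m4 : inner ℂ (B v) (star X₂ v) = inner ℂ (X₂ (B v)) v := by
      rw [ContinuousLinearMap.star_eq_adjoint, ContinuousLinearMap.adjoint_inner_right]
    have m5 : d * inner ℂ (R (R v)) ((star X₃ * X₃) v) = inner ℂ ((star X₁ * X₁) (R v)) v
        - inner ℂ (B v) (star X₂ v) + inner ℂ (B (X₂ v)) v + inner ℂ ((d : ℂ) • Q) v := by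
      rw [m2, ← m3, hY3, inner_add_left, inner_add_left, inner_sub_left, m4]
    have m6 : d * inner ℂ (R (R v)) ((star X₁ * X₁) v) =
        inner ℂ ((star X₁ * X₁) (R ((d : ℂ) • R v))) v := by
      rw [m2, ← m3, map_smul, map_smul]
    have m7 : d * inner ℂ (R (R v)) c = inner ℂ (R ((d : ℂ) • R v)) c := by
      rw [← m3, map_smul]
    rw [m1, hC, inner_add_right, inner_add_right, inner_smul_right, inner_smul_right, ← m7, ← m6]
    linear_combination 2 * m5
  have bdR : ‖(d : ℂ) • R v‖ ≤ ‖v‖ := by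
    rw [norm_smul, Complex.norm_real, Real.norm_eq_abs, abs_of_pos hd0]
    refine (mul_le_mul_of_nonneg_left (bR v) hd0.le).trans_eq ?_
    rw [mul_inv_cancel_left₀ hd0.ne']
  have t1 : ‖inner ℂ ((star X₁ * X₁) (R ((d : ℂ) • R v))) v‖ ≤ 1 * ‖v‖ ^ 2 :=
    norm_inner_le_of_norm_le (((bAR _).trans bdR).trans_eq (one_mul _).symm)
  have t2 : ‖inner ℂ ((star X₁ * X₁) (R v)) v‖ ≤ 1 * ‖v‖ ^ 2 :=
    norm_inner_le_of_norm_le ((bAR _).trans_eq (one_mul _).symm)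
  have t3 : ‖inner ℂ (B v) (star X₂ v)‖ ≤ e⁻¹ * M * ‖v‖ ^ 2 := by
    refine (norm_inner_le_norm _ _).trans ((mul_le_mul (bB v) hv' (norm_nonneg _)
      (by positivity)).trans_eq ?_)
    ring
  have t4 : ‖inner ℂ (B (X₂ v)) v‖ ≤ e⁻¹ * M * ‖v‖ ^ 2 := by
    refine norm_inner_le_of_norm_le ((bB _).trans ?_)
    rw [mul_assoc]
    exact mul_le_mul_of_nonneg_left hv (by positivity)
  have t5 : ‖inner ℂ ((d : ℂ) • Q) v‖ ≤ k * d⁻¹ * (1 / e + 2 / e ^ 2) * ‖v‖ ^ 2 := by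
    refine norm_inner_le_of_norm_le ?_
    rw [norm_smul, Complex.norm_real, Real.norm_eq_abs, abs_of_pos hd0]
    refine (mul_le_mul_of_nonneg_left bQ hd0.le).trans_eq ?_
    field_simp
  have t6 : ‖inner ℂ (R ((d : ℂ) • R v)) c‖ ≤ d⁻¹ * M₂ * ‖v‖ ^ 2 := by
    refine (norm_inner_le_norm _ _).trans ((mul_le_mul ((bR _).trans
      (mul_le_mul_of_nonneg_left bdR (by positivity))) hc (norm_nonneg _)
      (by positivity)).trans_eq ?_)
    ring
  have hle : d * k ^ 2 * ‖R v‖ ^ 2 ≤ 2 * (1 * ‖v‖ ^ 2 + 1 * ‖v‖ ^ 2 + e⁻¹ * M * ‖v‖ ^ 2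
      + e⁻¹ * M * ‖v‖ ^ 2 + k * d⁻¹ * (1 / e + 2 / e ^ 2) * ‖v‖ ^ 2) + d⁻¹ * M₂ * ‖v‖ ^ 2 := by
    have hn := congrArg norm hmain
    rw [Complex.norm_real, Real.norm_eq_abs, abs_of_nonneg (by positivity)] at hn
    rw [hn]
    refine (norm_add_le _ _).trans (add_le_add ?_ t6)
    rw [norm_mul, Complex.norm_two]
    refine mul_le_mul_of_nonneg_left ?_ zero_le_two
    exact (norm_add_le _ _).trans (add_le_add ((norm_add_le _ _).trans (add_le_add
      ((norm_sub_le _ _).trans (add_le_add ((norm_add_le _ _).trans (add_le_add t1 t2)) t3)) t4))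
      t5)
  -- The gain: `d² = e² · d k²`, so a bound of order `1 + M/e` becomes one of order `e² + M e`.
  calc d ^ 2 * ‖R v‖ ^ 2 = e ^ 2 * (d * k ^ 2 * ‖R v‖ ^ 2) := by rw [hd]; ring
    _ ≤ e ^ 2 * _ := mul_le_mul_of_nonneg_left hle (by positivity)
    _ = _ := by rw [hd]; field_simp; ring

end Mass

end HarmonicSU3
end

noncomputable section

namespace HarmonicSU3

/-! ### Concentration of isotypical vectors away from the kernel of a root vector -/

section Concentration

theorem sum_eq_of_distinct {M : Type*} [AddCommMonoid M] {s p r : Fin 3} (hsp : s ≠ p)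
    (hsr : s ≠ r) (hpr : p ≠ r) (f : Fin 3 → M) : ∑ a, f a = f s + f p + f r := by
  have h : (Finset.univ : Finset (Fin 3)) = {s, p, r} := by
    revert s p r; decide
  rw [h, Finset.sum_insert (by simp [hsp, hsr]), Finset.sum_insert (by simp [hpr]),
    Finset.sum_singleton, add_assoc]

section Estimate

variable {W : Type*} [NormedAddCommGroup W] [InnerProductSpace ℂ W] [FiniteDimensional ℂ W]
  [CompleteSpace W] {ρ : UnitaryRep SU3 W} {s p r : Fin 3} {k e M : ℝ}

/-- With `X₁ = E_sp`, `X₂ = E_pr`, `X₃ = E_sr`, the vectors of `I` feel the diagonal and the block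
of `p, r` only with size `M`. Thus the Casimir operator is dominated by the four products that
involve the index `s` off the diagonal. -/
theorem mass_estimate_unit (hsp : s ≠ p) (hsr : s ≠ r) (hpr : p ≠ r) (hk : 0 < k) (he : 0 < e)
    (hM : 0 ≤ M) (hκ : ρ.casimir = ((k ^ 2 : ℝ) : ℂ) • 1) {I : Submodule ℂ W}
    (hI : ∀ a b, (a = b ∨ a ≠ s ∧ b ≠ s) → ∀ v ∈ I, ρ.unit a b v ∈ I ∧ ‖ρ.unit a b v‖ ≤ M * ‖v‖)
    {v : W} (hv : v ∈ I) :
    (e ^ 2 * k ^ 2) ^ 2 * ‖resolv (ρ.unit s p) (e ^ 2 * k ^ 2) v‖ ^ 2 ≤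
      (4 * e ^ 2 + 4 * M * e + (2 / k) * (1 / e + 2 / e ^ 2) + (5 * M ^ 2 + 4 * M) / k ^ 2) *
        ‖v‖ ^ 2 := by
  have comm := ρ.unit_commutator
  have hn : ∀ a b, ‖ρ.unit a b‖ ≤ k := fun a b => by
    have := UnitaryRep.norm_unit_le hκ a b
    rwa [Real.sqrt_sq hk.le] at this
  have hsw : ∀ {a b c d : Fin 3} {Q : W →L[ℂ] W},
      ((if b = c then ρ.unit a d else 0) - (if d = a then ρ.unit c b else 0)) = Q →
      ρ.unit a b * ρ.unit c d = ρ.unit c d * ρ.unit a b + Q := fun {a b c d Q} h => by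
    rw [← h, ← comm, add_sub_cancel]
  have hbd : ∀ a b, (a = b ∨ a ≠ s ∧ b ≠ s) → ‖ρ.unit a b v‖ ≤ M * ‖v‖ := fun a b h =>
    (hI a b h v hv).2
  have hbd2 : ∀ a b, (a = b ∨ a ≠ s ∧ b ≠ s) → ‖ρ.unit a b (ρ.unit b a v)‖ ≤ M ^ 2 * ‖v‖ :=
    fun a b h => by
      have h' : b = a ∨ b ≠ s ∧ a ≠ s := h.imp Eq.symm And.symm
      have h1 := (hI a b h _ (hI b a h' v hv).1).2
      refine h1.trans ((mul_le_mul_of_nonneg_left (hbd b a h') hM).trans_eq ?_)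
      ring
  refine mass_estimate (X₁ := ρ.unit s p) (X₂ := ρ.unit p r) (X₃ := ρ.unit s r)
    (H₁ := ρ.unit s s - ρ.unit p p)
    -- `E_sa E_as = E_as E_sa + E_ss - E_aa` for `a = p, r` doubles the two main terms. What is left
    -- has five quadratic and four linear terms, whence `5 M² + 4 M`.
    (c := ρ.unit s s (ρ.unit s s v) + ρ.unit p p (ρ.unit p p v) + ρ.unit r r (ρ.unit r r v)
      + ρ.unit p r (ρ.unit r p v) + ρ.unit r p (ρ.unit p r v)
      + (ρ.unit s s v - ρ.unit p p v) + (ρ.unit s s v - ρ.unit r r v))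
    hk he ?_ ?_ ?_ ?_ ?_ ?_ (hn _ _) (hn _ _) ?_ ?_ ?_ (hbd _ _ (Or.inr ⟨hsp.symm, hsr.symm⟩)) ?_
  · rw [sub_eq_add_neg]
    exact hsw (by rw [if_neg hsr.symm, if_pos rfl, zero_sub])
  · rw [UnitaryRep.star_unit, UnitaryRep.star_unit]
    exact hsw (by rw [if_pos rfl, if_neg hsp, sub_zero])
  · rw [UnitaryRep.star_unit, ← add_zero (ρ.unit p s * ρ.unit p r)]
    exact hsw (by rw [if_neg hpr.symm, if_neg hsp, sub_zero])
  · rw [UnitaryRep.star_unit, sub_eq_add_neg]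
    exact hsw (by rw [if_neg hpr.symm, if_pos rfl, zero_sub])
  · rw [← add_zero (ρ.unit s p * ρ.unit s r)]
    exact hsw (by rw [if_neg hsr.symm, if_neg hsp.symm, sub_zero])
  · rw [UnitaryRep.star_unit]
    exact hsw (by rw [if_pos rfl, if_pos rfl])
  · exact (norm_sub_le _ _).trans ((add_le_add (hn _ _) (hn _ _)).trans_eq (by ring))
  · have h1 : ((k ^ 2 : ℝ) : ℂ) • v = ρ.casimir v := by rw [hκ]; rfl
    have h2 : ρ.casimir v = ∑ a, ∑ b, ρ.unit a b (ρ.unit b a v) := by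
      rw [UnitaryRep.casimir, _root_.sum_apply]
      refine Finset.sum_congr rfl fun a _ => ?_
      rw [_root_.sum_apply]
      rfl
    have h3 : ∀ a, ρ.unit s a (ρ.unit a s v) =
        ρ.unit a s (ρ.unit s a v) + (ρ.unit s s v - ρ.unit a a v) := fun a =>
      congrArg (fun T => T v) (hsw (a := s) (b := a) (c := a) (d := s) (by
        rw [if_pos rfl, if_pos rfl]))
    rw [h1, h2]
    simp only [sum_eq_of_distinct hsp hsr hpr]
    rw [UnitaryRep.star_unit, UnitaryRep.star_unit, h3 p, h3 r, two_smul, two_smul]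
    change _ = ρ.unit p s (ρ.unit s p v) + ρ.unit p s (ρ.unit s p v) +
      (ρ.unit r s (ρ.unit s r v) + ρ.unit r s (ρ.unit s r v)) + _
    abel
  · have a1 := hbd2 s s (Or.inl rfl)
    have a2 := hbd2 p p (Or.inl rfl)
    have a3 := hbd2 r r (Or.inl rfl)
    have a4 := hbd2 p r (Or.inr ⟨hsp.symm, hsr.symm⟩)
    have a5 := hbd2 r p (Or.inr ⟨hsr.symm, hsp.symm⟩)
    have b1 := hbd s s (Or.inl rfl)
    have b2 := hbd p p (Or.inl rfl)
    have b3 := hbd r r (Or.inl rfl)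
    have n : ∀ {x y : W} {α β : ℝ}, ‖x‖ ≤ α → ‖y‖ ≤ β → ‖x + y‖ ≤ α + β := fun h h' =>
      (norm_add_le _ _).trans (add_le_add h h')
    have n' : ∀ {x y : W} {α β : ℝ}, ‖x‖ ≤ α → ‖y‖ ≤ β → ‖x - y‖ ≤ α + β := fun h h' =>
      (norm_sub_le _ _).trans (add_le_add h h')
    refine (n (n (n (n (n (n a1 a2) a3) a4) a5) (n' b1 b2)) (n' b1 b3)).trans_eq ?_
    ring
  · rw [UnitaryRep.star_unit]
    exact hbd _ _ (Or.inr ⟨hsr.symm, hsp.symm⟩)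

/-- Comparison of the resolvents of `X* X` and `X X*` for a root vector `X`. -/
theorem norm_resolv_unit_swap_le {d : ℝ} (hd : 0 < d) {v : W} (hsp : s ≠ p)
    (h1 : ‖ρ.unit s s v‖ ≤ M * ‖v‖) (h2 : ‖ρ.unit p p v‖ ≤ M * ‖v‖) :
    d * ‖resolv (ρ.unit p s) d v‖ ≤ d * ‖resolv (ρ.unit s p) d v‖ + 2 * M * d⁻¹ * ‖v‖ := by
  obtain ⟨R, hR⟩ : ∃ R, R = resolv (ρ.unit s p) d := ⟨_, rfl⟩
  obtain ⟨R', hR'⟩ : ∃ R', R' = resolv (ρ.unit p s) d := ⟨_, rfl⟩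
  have comm := ρ.unit_commutator
  set H := ρ.unit s s - ρ.unit p p with hH
  have e1 : ρ.unit s p * ρ.unit p s = ρ.unit p s * ρ.unit s p + H := by
    have := comm s p p s
    rw [if_pos rfl, if_pos rfl] at this
    rw [hH, ← this, add_sub_cancel]
  have e2 : H * (ρ.unit p s * ρ.unit s p) = ρ.unit p s * ρ.unit s p * H := by
    have c1 := comm s s p s
    have c2 := comm s s s p
    have c3 := comm p p p s
    have c4 := comm p p s p
    rw [if_neg hsp, if_pos rfl, zero_sub] at c1
    rw [if_pos rfl, if_neg hsp.symm, sub_zero] at c2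
    rw [if_pos rfl, if_neg hsp, sub_zero] at c3
    rw [if_neg hsp.symm, if_pos rfl, zero_sub] at c4
    have c5 : H * ρ.unit p s = ρ.unit p s * H - (ρ.unit p s + ρ.unit p s) := by
      rw [hH, sub_mul, mul_sub, sub_eq_iff_eq_add.1 c1, sub_eq_iff_eq_add.1 c3]; abel
    have c6 : H * ρ.unit s p = ρ.unit s p * H + (ρ.unit s p + ρ.unit s p) := by
      rw [hH, sub_mul, mul_sub, sub_eq_iff_eq_add.1 c2, sub_eq_iff_eq_add.1 c4]; abel
    rw [← mul_assoc, c5, sub_mul, mul_assoc, c6]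
    noncomm_ring
  have e3 : H * R = R * H := by
    rw [hR]
    exact gramFun_intertwine (by rw [UnitaryRep.star_unit]; exact e2) _
  have e4 : R' * (ρ.unit s p * ρ.unit p s + (d : ℂ) • 1) = 1 := by
    rw [hR', ← ρ.star_unit p s]; exact resolv_mul _ hd
  have e5 : (ρ.unit p s * ρ.unit s p + (d : ℂ) • 1) * R = 1 := by
    rw [hR, ← ρ.star_unit s p]; exact mul_resolv _ hd
  have e6 : R' = R - R' * (R * H) := by
    have f1 : R' = R' * (ρ.unit p s * ρ.unit s p + (d : ℂ) • 1) * R := by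
      rw [mul_assoc, e5, mul_one]
    have f2 : R = R' * (ρ.unit p s * ρ.unit s p + (d : ℂ) • 1) * R + R' * (R * H) := by
      rw [e1] at e4
      rw [← e3, ← mul_assoc, ← add_mul, ← mul_add, add_right_comm, e4, one_mul]
    rw [eq_sub_iff_add_eq]
    exact (congrArg (· + R' * (R * H)) f1).trans f2.symm
  have e7 : R' v = R v - R' (R (H v)) := congrArg (fun T => T v) e6
  have b1 : ‖H v‖ ≤ 2 * M * ‖v‖ :=
    (norm_sub_le _ _).trans ((add_le_add h1 h2).trans_eq (by ring))
  have b2 : ‖R' (R (H v))‖ ≤ d⁻¹ * (d⁻¹ * (2 * M * ‖v‖)) := by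
    rw [hR, hR']
    exact (norm_resolv_apply_le _ hd _).trans (mul_le_mul_of_nonneg_left
      ((norm_resolv_apply_le _ hd _).trans (mul_le_mul_of_nonneg_left b1 (by positivity)))
      (by positivity))
  rw [← hR, ← hR', e7]
  refine (mul_le_mul_of_nonneg_left ((norm_sub_le _ _).trans (add_le_add le_rfl b2))
    hd.le).trans_eq ?_
  field_simp

end Estimate

/-- The quantity `d (Z* Z + d)⁻¹` is at least `1/2` on the spectral part `Z* Z ≤ d`, so its
smallness on `v` says that `v` has little mass there. The constants depend on `σ` and `ε` but not on
the irreducible representation. -/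
theorem exists_concentration {S : Set (Fin 2)} (σ : Types (KS S)) {s p r : Fin 3} (hsp : s ≠ p)
    (hsr : s ≠ r) (hpr : p ≠ r) (hS : SameBlock S p r) {ε : ℝ} (hε : 0 < ε) :
    ∃ δ > 0, ∃ κ₀ > 0, ∀ (W : Type u) [NormedAddCommGroup W] [InnerProductSpace ℂ W]
      [FiniteDimensional ℂ W] [CompleteSpace W] (ρ : UnitaryRep SU3 W) (κ : ℝ), κ₀ ≤ κ →
      ρ.casimir = (κ : ℂ) • 1 → ∀ v ∈ (ρ.restrict (KS S)).isotypic σ,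
      δ * κ * ‖resolv (ρ.unit s p) (δ * κ) v‖ ≤ ε * ‖v‖ ∧
      δ * κ * ‖resolv (ρ.unit p s) (δ * κ) v‖ ≤ ε * ‖v‖ := by
  obtain ⟨M, hM0, hM⟩ := exists_norm_unit_le.{u} σ
  -- Order of choices: `M` from `σ`, then the window `e`, then the threshold for `k` depending on
  -- both. Each of the two groups of terms takes half of `(ε / 2)²`; the other `ε / 2` pays for
  -- passing from `E_sp` to `E_ps`.
  obtain ⟨e, he0, he⟩ : ∃ e : ℝ, 0 < e ∧ 4 * e ^ 2 + 4 * M * e ≤ (ε / 2) ^ 2 / 2 := by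
    have ht : Filter.Tendsto (fun e : ℝ => 4 * e ^ 2 + 4 * M * e) (nhdsWithin 0 (Set.Ioi 0))
        (nhds 0) := by
      have : Continuous fun e : ℝ => 4 * e ^ 2 + 4 * M * e := by fun_prop
      have h := this.tendsto 0
      simp only [ne_eq, OfNat.ofNat_ne_zero, not_false_eq_true, zero_pow, mul_zero, add_zero] at h
      exact h.mono_left nhdsWithin_le_nhds
    have h1 := ht.eventually_le_const (show (0 : ℝ) < (ε / 2) ^ 2 / 2 by positivity)
    obtain ⟨e, h2, h3⟩ := (h1.and self_mem_nhdsWithin).exists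
    exact ⟨e, h3, h2⟩
  obtain ⟨K, hK⟩ : ∃ K : ℝ, ∀ k ≥ K, 0 < k ∧
      (2 / k) * (1 / e + 2 / e ^ 2) + (5 * M ^ 2 + 4 * M) / k ^ 2 ≤ (ε / 2) ^ 2 / 2 ∧
      2 * M * (e ^ 2 * k ^ 2)⁻¹ ≤ ε / 2 := by
    have ht : ∀ g : ℝ → ℝ, Continuous g → g 0 = 0 → ∀ η > 0,
        ∀ᶠ k : ℝ in Filter.atTop, g k⁻¹ ≤ η := fun g hg h0 η hη => by
      have h := (hg.tendsto 0).comp tendsto_inv_atTop_zero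
      rw [h0] at h
      exact h.eventually_le_const hη
    have h1 := ht (fun t => 2 * t * (1 / e + 2 / e ^ 2) + (5 * M ^ 2 + 4 * M) * t ^ 2)
      (by fun_prop) (by simp) ((ε / 2) ^ 2 / 2) (by positivity)
    have h2 := ht (fun t => 2 * M * ((e ^ 2)⁻¹ * t ^ 2)) (by fun_prop) (by simp) (ε / 2)
      (by positivity)
    obtain ⟨K, hK⟩ := Filter.eventually_atTop.1 ((h1.and h2).and (Filter.eventually_gt_atTop 0))
    refine ⟨K, fun k hk => ⟨(hK k hk).2, ?_, ?_⟩⟩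
    · simpa only [div_eq_mul_inv, inv_pow] using (hK k hk).1.1
    · simpa only [mul_inv, inv_pow] using (hK k hk).1.2
  refine ⟨e ^ 2, by positivity, (max K 1) ^ 2, by positivity,
    fun W _ _ _ _ ρ κ hκ hρ v hv => ?_⟩
  obtain ⟨k, hk⟩ : ∃ k, k = √κ := ⟨_, rfl⟩
  have hκ0 : 0 ≤ κ := (sq_nonneg _).trans hκ
  have hkκ : κ = k ^ 2 := by rw [hk, Real.sq_sqrt hκ0]
  have hkK : K ≤ k := by
    rw [hk]
    exact (le_max_left K 1).trans (Real.le_sqrt_of_sq_le hκ)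
  obtain ⟨hk0, hk1, hk2⟩ := hK k hkK
  rw [hkκ] at hρ ⊢
  have hrefl : ∀ a, SameBlock S a a := fun a i h1 h2 => by omega
  have hblock : ∀ a b, (a = b ∨ a ≠ s ∧ b ≠ s) → SameBlock S a b := by
    intro a b hab
    rcases hab with rfl | ⟨ha, hb⟩
    · exact hrefl _
    · have hcase : ∀ a : Fin 3, a ≠ s → a = p ∨ a = r := fun a ha => by omega
      rcases hcase a ha with rfl | rfl <;> rcases hcase b hb with rfl | rfl
      exacts [hrefl _, hS, hS.symm, hrefl _]
  have hI := fun a b h => hM W ρ a b (hblock a b h)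
  have h1 := mass_estimate_unit hsp hsr hpr hk0 he0 hM0 hρ hI hv
  have hd : 0 < e ^ 2 * k ^ 2 := by positivity
  have h2 : e ^ 2 * k ^ 2 * ‖resolv (ρ.unit s p) (e ^ 2 * k ^ 2) v‖ ≤ ε / 2 * ‖v‖ := by
    refine (abs_le_of_sq_le_sq' ?_ (by positivity)).2
    rw [mul_pow, mul_pow (ε / 2)]
    refine h1.trans (mul_le_mul_of_nonneg_right ?_ (by positivity))
    linarith
  refine ⟨h2.trans (mul_le_mul_of_nonneg_right (by linarith) (norm_nonneg v)), ?_⟩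
  refine (norm_resolv_unit_swap_le hd hsp (hI s s (Or.inl rfl) v hv).2
    (hI p p (Or.inl rfl) v hv).2).trans ?_
  have h3 := mul_le_mul_of_nonneg_right hk2 (norm_nonneg v)
  linarith

end Concentration

end HarmonicSU3
end

noncomputable section

namespace HarmonicSU3

/-! ### Polynomial approximation of the phase -/

section Scalar

/-- A polynomial close to `u ↦ max(u, δ)^{-1/2}` on `[0, 1]`. -/
theorem exists_polynomial_near_inv_sqrt {δ η : ℝ} (hδ : 0 < δ) (hη : 0 < η) :
    ∃ g : Polynomial ℝ, ∀ u ∈ Set.Icc (0 : ℝ) 1, |g.eval u - (√(max u δ))⁻¹| < η := by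
  refine exists_polynomial_near_of_continuousOn 0 1 (fun u => (√(max u δ))⁻¹) ?_ η hη
  refine Continuous.continuousOn (Continuous.inv₀ (by fun_prop) fun u => ?_)
  exact (Real.sqrt_pos.2 (lt_max_of_lt_right hδ)).ne'

/-- At `x = 0` the factor `√x` annihilates the error, and for `x ≥ δ κ` the cutoff in the maximum is
inactive. The remaining factor `√(x/κ)` is at most one. -/
theorem abs_phase_sub_le_of_le {δ η κ x y : ℝ} (hη : 0 ≤ η) (hx : 0 ≤ x) (hxκ : x ≤ κ)
    (hg : |y - (√(max (x * κ⁻¹) δ))⁻¹| ≤ η) (h : x = 0 ∨ δ * κ ≤ x) :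
    |√x * ((√x)⁻¹ - (√κ)⁻¹ * y)| ≤ η := by
  rcases hx.eq_or_lt with rfl | hx0
  · simpa using hη
  have hκ : 0 < κ := hx0.trans_le hxκ
  have h1 : δ * κ ≤ x := h.resolve_left hx0.ne'
  have h2 : max (x * κ⁻¹) δ = x * κ⁻¹ := max_eq_left (by
    rw [← div_eq_mul_inv, le_div_iff₀ hκ]; exact h1)
  rw [h2, Real.sqrt_mul hx, Real.sqrt_inv] at hg
  have hsx := Real.sqrt_pos.2 hx0
  have hsκ := Real.sqrt_pos.2 hκ
  have h3 : √x * ((√x)⁻¹ - (√κ)⁻¹ * y) = -(√x * (√κ)⁻¹ * (y - (√x * (√κ)⁻¹)⁻¹)) := by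
    field_simp; ring
  rw [h3, abs_neg, abs_mul, abs_of_nonneg (by positivity)]
  have h4 : √x * (√κ)⁻¹ ≤ 1 := by
    rw [← div_eq_mul_inv]
    exact div_le_one_of_le₀ (Real.sqrt_le_sqrt hxκ) hsκ.le
  exact (mul_le_of_le_one_left (abs_nonneg _) h4).trans hg

/-- For `0 < x < δ κ` the error is below `3`, and `δ κ / (x + δ κ)` exceeds `1/2`, which explains
the factor `6`. The resolvent form of the bound matches the concentration estimate. -/
theorem abs_phase_sub_le {δ η κ x y : ℝ} (hδ : 0 < δ) (hη : 0 ≤ η) (hη1 : η ≤ 1) (hx : 0 ≤ x)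
    (hxκ : x ≤ κ) (hκ : 0 < κ) (hg : |y - (√(max (x * κ⁻¹) δ))⁻¹| ≤ η) :
    |√x * ((√x)⁻¹ - (√κ)⁻¹ * y)| ≤ η + 6 * (δ * κ) * (x + δ * κ)⁻¹ := by
  by_cases h : x = 0 ∨ δ * κ ≤ x
  · exact (abs_phase_sub_le_of_le hη hx hxκ hg h).trans (le_add_of_nonneg_right (by positivity))
  · push Not at h
    obtain ⟨hx0, hxd⟩ := h
    have hx0' : 0 < x := lt_of_le_of_ne hx (Ne.symm hx0)
    have h2 : max (x * κ⁻¹) δ = δ := max_eq_right (by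
      rw [← div_eq_mul_inv, div_le_iff₀ hκ]; exact hxd.le)
    rw [h2] at hg
    have hsx := Real.sqrt_pos.2 hx0'
    have hsκ := Real.sqrt_pos.2 hκ
    have hsδ := Real.sqrt_pos.2 hδ
    have h5 : 3 ≤ 6 * (δ * κ) * (x + δ * κ)⁻¹ := by
      rw [← div_eq_mul_inv, le_div_iff₀ (by positivity)]
      linarith
    have h6 : √x ≤ √δ * √κ := by
      rw [← Real.sqrt_mul hδ.le]; exact Real.sqrt_le_sqrt hxd.le
    have h7 : √x * (√κ)⁻¹ ≤ 1 := by
      rw [← div_eq_mul_inv]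
      exact div_le_one_of_le₀ (Real.sqrt_le_sqrt hxκ) hsκ.le
    have h8 : √x * (√κ)⁻¹ * (√δ)⁻¹ ≤ 1 := by
      rw [mul_assoc, ← mul_inv, ← div_eq_mul_inv, mul_comm (√κ)]
      exact div_le_one_of_le₀ h6 (by positivity)
    have h9 : √x * ((√x)⁻¹ - (√κ)⁻¹ * y) =
        1 - √x * (√κ)⁻¹ * (√δ)⁻¹ - √x * (√κ)⁻¹ * (y - (√δ)⁻¹) := by
      rw [mul_sub, mul_inv_cancel₀ hsx.ne']; ring
    have h10 : |√x * (√κ)⁻¹ * (y - (√δ)⁻¹)| ≤ 1 := by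
      rw [abs_mul, abs_of_nonneg (by positivity)]
      exact (mul_le_of_le_one_left (abs_nonneg _) h7).trans (hg.trans hη1)
    have h11 : 0 ≤ √x * (√κ)⁻¹ * (√δ)⁻¹ := by positivity
    rw [h9]
    rw [abs_le] at h10 ⊢
    constructor <;> linarith [h10.1, h10.2]

end Scalar

/-! ### Matrix units scaled by the Casimir eigenvalue. -/

section Normalized

variable {W : Type*} [NormedAddCommGroup W] [InnerProductSpace ℂ W] [FiniteDimensional ℂ W]
  [CompleteSpace W] {ρ : UnitaryRep SU3 W} {κ : ℝ}

theorem norm_smul_unit_le_one (hκ : ρ.casimir = (κ : ℂ) • 1) (a b : Fin 3) :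
    ‖(((√κ)⁻¹ : ℝ) : ℂ) • ρ.unit a b‖ ≤ 1 := by
  rw [norm_smul, Complex.norm_real, Real.norm_eq_abs, abs_of_nonneg (by positivity)]
  have h := UnitaryRep.norm_unit_le hκ a b
  rw [inv_mul_eq_div]
  exact div_le_one_of_le₀ h (Real.sqrt_nonneg _)

theorem smul_unit_mul_smul_unit (hκ0 : 0 ≤ κ) (a b : Fin 3) :
    ((((√κ)⁻¹ : ℝ) : ℂ) • ρ.unit b a) * ((((√κ)⁻¹ : ℝ) : ℂ) • ρ.unit a b) =
      gramFun (ρ.unit a b) fun x => x * κ⁻¹ := by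
  rw [smul_mul_smul_comm, ← ρ.star_unit a b, ← gramFun_id, ← Complex.ofReal_mul,
    ← gramFun_const_mul]
  refine gramFun_congr fun x _ => ?_
  rw [← mul_inv, Real.mul_self_sqrt hκ0, mul_comm]

theorem smul_mul_gramFun (Z : W →L[ℂ] W) (c : ℝ) (f₁ f₂ : ℝ → ℝ) (P : Prop) [Decidable P] :
    ((c : ℂ) • Z) * (gramFun Z f₁ * (if P then 1 else 0) +
      gramFun Z f₂ * (if ¬ P then 1 else 0)) =
      Z * gramFun Z fun x => c * if P then f₁ x else f₂ x := by
  rw [gramFun_const_mul, mul_smul_comm, smul_mul_assoc]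
  by_cases h : P <;> simp [h]

omit [FiniteDimensional ℂ W] [CompleteSpace W] in
theorem norm_ite_le_one (P : Prop) [Decidable P] :
    ‖(if P then 1 else 0 : W →L[ℂ] W)‖ ≤ 1 := by
  split_ifs
  · exact ContinuousLinearMap.norm_id_le
  · simp

end Normalized

/-! ### Column-finite approximants of the phase. -/

section Approximant

variable {H : Type u} [NormedAddCommGroup H] [InnerProductSpace ℂ H] [CompleteSpace H]
variable {D : Blocks H} {π : UnitaryRep SU3 H} (hD : ∀ i, π.IsInvariant (D.W i))
  {κ : D.ι → ℝ} (hκ0 : ∀ i, 0 ≤ κ i)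
  (hκ : ∀ i, (D.rep π hD i).casimir = (κ i : ℂ) • 1) (L : Subgroup SU3)

include hκ

theorem exists_normalized_unit (a b : Fin 3) :
    ∃ U, D.IsDiag U fun i => (((√(κ i))⁻¹ : ℝ) : ℂ) • (D.rep π hD i).unit a b := by
  exact D.exists_isDiag _ (M := 1) fun i => norm_smul_unit_le_one (hκ i) a b

/-- A single `E_ab` is not equivariant, but all nine together form a family equivariant for the
adjoint action. The scaling is constant on each block and does not disturb this. -/
theorem columnFinite_normalized_unit {a b : Fin 3} {U : H →L[ℂ] H}
    (hU : D.IsDiag U fun i => (((√(κ i))⁻¹ : ℝ) : ℂ) • (D.rep π hD i).unit a b) :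
    ColumnFinite (π.restrict L) (π.restrict L) U := by
  choose F hF using exists_normalized_unit hD hκ
  let Φ : EuclideanSpace ℂ (Fin 3 × Fin 3) →ₗ[ℂ] (H →L[ℂ] H) :=
    { toFun := fun e => ∑ a, ∑ b, e (a, b) • F a b
      map_add' := fun e e' => by
        simp only [PiLp.add_apply, add_smul, Finset.sum_add_distrib]
      map_smul' := fun c e => by
        simp only [PiLp.smul_apply, smul_eq_mul, mul_smul, Finset.smul_sum, RingHom.id_apply] }
  have hΦ : ∀ e, D.IsDiag (Φ e)
      fun i => (((√(κ i))⁻¹ : ℝ) : ℂ) • (D.rep π hD i).op (entries e) := fun e x i => by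
    change D.comp i ((∑ a, ∑ b, e (a, b) • F a b : H →L[ℂ] H) x) = _
    beta_reduce
    rw [UnitaryRep.op_eq_sum_unit]
    simp only [_root_.sum_apply, map_sum, _root_.smul_apply, map_smul, Finset.smul_sum]
    refine Finset.sum_congr rfl fun a _ => Finset.sum_congr rfl fun b _ => ?_
    rw [hF a b x i, _root_.smul_apply, smul_comm]
    rfl
  have h := columnFinite_of_equivariant (π := π.restrict L) (π' := π.restrict L)
    (adjointRep.restrict L) Φ ?_ (EuclideanSpace.single (a, b) 1)
  · have h1 : Φ (EuclideanSpace.single (a, b) 1) = U := by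
      refine (hΦ _).unique ?_
      rw [entries_single]
      exact hU
    rwa [h1] at h
  · rintro ⟨g, hg⟩ e x
    refine Blocks.ext_comp (D := D) fun i => ?_
    change D.comp i (Φ (adjointRep.toHom g e) (π.toHom g x)) = D.comp i (π.toHom g (Φ e x))
    rw [hΦ, D.intertwines_comp π hD i, D.intertwines_comp π hD i, hΦ]
    beta_reduce
    rw [entries_adjointRep,
      ← UnitaryRep.toCLM_mul_op_mul, _root_.smul_apply, _root_.smul_apply, map_smul]
    congr 1
    change (D.rep π hD i).toHom g ((D.rep π hD i).op (entries e) ((D.rep π hD i).toHom g⁻¹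
      ((D.rep π hD i).toHom g (D.comp i x)))) = _
    rw [UnitaryRep.toHom_inv_apply_self]

-- The projection onto a set of blocks commutes with the group, hence with all isotypical
-- projections. It allows different polynomials for small and large Casimir eigenvalues.
omit hκ in
include hD in
theorem exists_columnFinite_indicator (P : D.ι → Prop) [DecidablePred P] :
    ∃ E, ColumnFinite (π.restrict L) (π.restrict L) E ∧
      D.IsDiag E fun i => if P i then 1 else 0 := by
  obtain ⟨E, hE⟩ := D.exists_isDiag (fun i => if P i then 1 else 0) (M := 1) fun i =>
    norm_ite_le_one (P i)
  refine ⟨E, ?_, hE⟩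
  have hD' : ∀ i, (π.restrict L).IsInvariant (D.W i) := fun i => (hD i).restrict L
  refine (harmonicallyProper_of_forall_commute fun σ x => ?_).columnFinite
  have hp := D.isDiag_proj hD' σ
  refine Blocks.ext_comp (D := D) fun i => ?_
  rw [hE, hp, hp, hE]
  beta_reduce
  split_ifs
  · rfl
  · rw [_root_.zero_apply, _root_.zero_apply, map_zero]

include hκ0

/-- Column-finite operators are closed under sums and products, so a polynomial in the scaled `Z* Z`
is column-finite. A general continuous function would not be. -/
theorem exists_columnFinite_polynomial (a b : Fin 3) (g : Polynomial ℝ) :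
    ∃ T, ColumnFinite (π.restrict L) (π.restrict L) T ∧
      D.IsDiag T fun i => gramFun ((D.rep π hD i).unit a b) fun x => g.eval (x * (κ i)⁻¹) := by
  have hD' : ∀ i, (π.restrict L).IsInvariant (D.W i) := fun i => (hD i).restrict L
  have hcomp : (π.restrict L).IsComplete := Blocks.isComplete hD'
  obtain ⟨U, hU⟩ := exists_normalized_unit hD hκ a b
  obtain ⟨U', hU'⟩ := exists_normalized_unit hD hκ b a
  have hN : D.IsDiag (U' * U) fun i =>
      gramFun ((D.rep π hD i).unit a b) fun x => x * (κ i)⁻¹ := by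
    simpa only [smul_unit_mul_smul_unit (hκ0 _)] using hU'.mul hU
  have hNc : ColumnFinite (π.restrict L) (π.restrict L) (U' * U) :=
    ColumnFinite.comp hcomp (columnFinite_normalized_unit hD hκ L hU')
      (columnFinite_normalized_unit hD hκ L hU)
  have hone : ∀ c : ℝ, ∃ T, ColumnFinite (π.restrict L) (π.restrict L) T ∧
      D.IsDiag T fun i => gramFun ((D.rep π hD i).unit a b) fun _ => c := fun c => by
    obtain ⟨E, hE, hE'⟩ := exists_columnFinite_indicator hD L (fun _ => True)
    refine ⟨(c : ℂ) • E, hE.smul _, ?_⟩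
    simpa only [if_true, gramFun_const] using hE'.smul (c : ℂ)
  induction g using Polynomial.induction_on with
  | C c => simpa only [Polynomial.eval_C] using hone c
  | add p q hp hq =>
    obtain ⟨T, hT, hT'⟩ := hp
    obtain ⟨T₂, hT₂, hT₂'⟩ := hq
    refine ⟨T + T₂, hT.add hT₂, ?_⟩
    simpa only [Polynomial.eval_add, gramFun_add] using hT'.add hT₂'
  | monomial n c h =>
    obtain ⟨T, hT, hT'⟩ := h
    refine ⟨T * (U' * U), ColumnFinite.comp hcomp hT hNc, ?_⟩
    simpa only [gramFun_mul, Polynomial.eval_mul, Polynomial.eval_C, Polynomial.eval_pow,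
      Polynomial.eval_X, pow_succ, mul_assoc] using hT'.mul hN

/-- Block diagonal approximants of the phase, built from two polynomials used below and above a
threshold for the Casimir eigenvalue. -/
theorem exists_columnFinite_approximant (a b : Fin 3) (κ₀ : ℝ) (g₁ g₂ : Polynomial ℝ) :
    ∃ B, ColumnFinite (π.restrict L) (π.restrict L) B ∧
      D.IsDiag B fun i => (D.rep π hD i).unit a b * gramFun ((D.rep π hD i).unit a b) fun x =>
        (√(κ i))⁻¹ * (if κ i < κ₀ then g₁ else g₂).eval (x * (κ i)⁻¹) := by
  classical
  have hD' : ∀ i, (π.restrict L).IsInvariant (D.W i) := fun i => (hD i).restrict L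
  have hcomp : (π.restrict L).IsComplete := Blocks.isComplete hD'
  obtain ⟨U, hU⟩ := exists_normalized_unit hD hκ a b
  obtain ⟨T₁, hT₁, hT₁'⟩ := exists_columnFinite_polynomial hD hκ0 hκ L a b g₁
  obtain ⟨T₂, hT₂, hT₂'⟩ := exists_columnFinite_polynomial hD hκ0 hκ L a b g₂
  obtain ⟨E₁, hE₁, hE₁'⟩ := exists_columnFinite_indicator hD L (fun i => κ i < κ₀)
  obtain ⟨E₂, hE₂, hE₂'⟩ := exists_columnFinite_indicator hD L (fun i => ¬ κ i < κ₀)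
  refine ⟨U * (T₁ * E₁ + T₂ * E₂), ColumnFinite.comp hcomp
    (columnFinite_normalized_unit hD hκ L hU) ((ColumnFinite.comp hcomp hT₁ hE₁).add
      (ColumnFinite.comp hcomp hT₂ hE₂)), ?_⟩
  convert hU.mul ((hT₁'.mul hE₁').add (hT₂'.mul hE₂')) using 2 with i
  rw [smul_mul_gramFun]
  congr 2 with x
  split_ifs <;> rfl

end Approximant

/-! ### Approximation of one column of the phase. -/

section Column

variable {H : Type u} [NormedAddCommGroup H] [InnerProductSpace ℂ H] [CompleteSpace H]
variable {D : Blocks H} {π : UnitaryRep SU3 H} (hD : ∀ i, π.IsInvariant (D.W i))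
  {κ : D.ι → ℝ} (hκ0 : ∀ i, 0 ≤ κ i)
  (hκ : ∀ i, (D.rep π hD i).casimir = (κ i : ℂ) • 1)

include hκ hκ0

/-- The difference `V - B` acts on each block, so it suffices to bound the scalar error on the
spectrum of `Z* Z`, weighted by the components of a vector of type `σ`. Small Casimir eigenvalues
use the integral gap, large ones the concentration estimate. -/
theorem exists_columnFinite_near_phase {S : Set (Fin 2)} {s p r : Fin 3} (hsp : s ≠ p)
    (hsr : s ≠ r) (hpr : p ≠ r) (hS : SameBlock S p r) {a b : Fin 3}
    (hab : a = s ∧ b = p ∨ a = p ∧ b = s) {V : H →L[ℂ] H}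
    (hV : D.IsDiag V fun i => phase ((D.rep π hD i).unit a b)) (σ : Types (KS S)) {ε : ℝ}
    (hε : 0 < ε) :
    ∃ B, ColumnFinite (π.restrict (KS S)) (π.restrict (KS S)) B ∧
      ‖(V - B) ∘L (π.restrict (KS S)).proj σ‖ ≤ ε := by
  -- The factor `6` of the scalar bound turns `ε / 12` into `ε / 2`; the polynomial error `η` takes
  -- the other half.
  obtain ⟨δ, hδ, κ₀, hκ₀, hconc⟩ := exists_concentration.{u} σ hsp hsr hpr hS
    (show 0 < ε / 12 by positivity)
  obtain ⟨η, hη, hη1, hηε⟩ : ∃ η : ℝ, 0 < η ∧ η ≤ 1 ∧ η ≤ ε / 2 :=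
    ⟨min 1 (ε / 2), by positivity, min_le_left _ _, min_le_right _ _⟩
  -- With cutoff `1/κ₀`, a nonzero eigenvalue `μ ≥ 1` on a block with `κ < κ₀` satisfies `μ/κ ≥
  -- 1/κ₀`, so the cutoff is never felt.
  obtain ⟨g₁, hg₁⟩ := exists_polynomial_near_inv_sqrt (inv_pos.2 hκ₀) hη
  obtain ⟨g₂, hg₂⟩ := exists_polynomial_near_inv_sqrt hδ hη
  obtain ⟨B, hB, hB'⟩ := exists_columnFinite_approximant hD hκ0 hκ (KS S) a b κ₀ g₁ g₂
  refine ⟨B, hB, ContinuousLinearMap.opNorm_le_bound _ hε.le fun x => ?_⟩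
  have hab' : a ≠ b := by
    rcases hab with ⟨rfl, rfl⟩ | ⟨rfl, rfl⟩
    exacts [hsp, hsp.symm]
  have hD' : ∀ i, (π.restrict (KS S)).IsInvariant (D.W i) := fun i => (hD i).restrict (KS S)
  have hp := D.isDiag_proj hD' σ
  change ‖(V - B) ((π.restrict (KS S)).proj σ x)‖ ≤ _
  refine (Blocks.norm_apply_le_of_isDiag (hV.sub hB') hε.le fun i => ?_).trans
    (mul_le_mul_of_nonneg_left (UnitaryRep.norm_proj_apply_le _ _ _) hε.le)
  have hv : D.comp i ((π.restrict (KS S)).proj σ x) ∈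
      ((D.rep π hD i).restrict (KS S)).isotypic σ := by
    rw [hp]; exact UnitaryRep.proj_mem _ _ _
  generalize D.comp i ((π.restrict (KS S)).proj σ x) = v at hv
  set Z := (D.rep π hD i).unit a b with hZ
  rw [phase, ← mul_sub, ← gramFun_sub, norm_mul_gramFun_apply]
  have hle : ∀ (μ : ℝ) (x : D.W i), x ≠ 0 → (star Z * Z) x = (μ : ℂ) • x →
      0 ≤ μ ∧ μ ≤ κ i ∧ μ * (κ i)⁻¹ ∈ Set.Icc (0 : ℝ) 1 := fun μ x hx h => by
    have h0 := nonneg_of_eigen h hx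
    have h1 : μ ≤ κ i := by
      have h2 := inner_star_mul_self Z x x
      rw [h, inner_smul_right, inner_self_eq_norm_sq_to_K, inner_self_eq_norm_sq_to_K] at h2
      have h3 : μ * ‖x‖ ^ 2 = ‖Z x‖ ^ 2 := Complex.ofReal_injective (by
        rw [Complex.ofReal_mul, Complex.ofReal_pow, Complex.ofReal_pow]; exact h2)
      have h4 : ‖Z x‖ ≤ √(κ i) * ‖x‖ := (Z.le_opNorm x).trans
        (mul_le_mul_of_nonneg_right (UnitaryRep.norm_unit_le (hκ i) a b) (norm_nonneg x))
      have h5 := pow_le_pow_left₀ (norm_nonneg _) h4 2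
      rw [mul_pow, Real.sq_sqrt (hκ0 i), ← h3] at h5
      exact le_of_mul_le_mul_right h5 (by positivity)
    refine ⟨h0, h1, mul_nonneg h0 (inv_nonneg.2 (hκ0 i)), ?_⟩
    rw [← div_eq_mul_inv]
    exact div_le_one_of_le₀ h1 (hκ0 i)
  by_cases hi : κ i < κ₀
  · simp only [if_pos hi]
    refine (norm_gramFun_apply_le_const hη.le (fun μ y hy h => ?_) v).trans
      (mul_le_mul_of_nonneg_right (by linarith) (norm_nonneg v))
    obtain ⟨h0, h1, h2⟩ := hle μ y hy h
    refine abs_phase_sub_le_of_le hη.le h0 h1 (hg₁ _ h2).le ?_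
    rcases h0.eq_or_lt with h3 | h3
    · exact Or.inl h3.symm
    · right
      have h4 := (D.rep π hD i).one_le_of_eigen hab' hy h h3
      refine le_trans ?_ h4
      rw [inv_mul_le_one₀ hκ₀]
      exact hi.le
  · simp only [if_neg hi]
    push Not at hi
    have hκpos : 0 < κ i := hκ₀.trans_le hi
    have h1 := norm_gramFun_apply_le (Z := Z)
      (f := fun x => √x * ((√x)⁻¹ - (√(κ i))⁻¹ * g₂.eval (x * (κ i)⁻¹)))
      (g := fun x => η + 6 * (δ * κ i) * (x + δ * κ i)⁻¹) (fun μ y hy h => by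
        obtain ⟨h0, h1, h2⟩ := hle μ y hy h
        exact (abs_phase_sub_le hδ hη.le hη1 h0 h1 hκpos (hg₂ _ h2).le).trans (le_abs_self _)) v
    refine h1.trans ?_
    rw [gramFun_add, gramFun_const, gramFun_const_mul]
    have h2 : δ * κ i * ‖resolv Z (δ * κ i) v‖ ≤ ε / 12 * ‖v‖ := by
      have h3 := hconc (D.W i) (D.rep π hD i) (κ i) hi (hκ i) v hv
      rcases hab with ⟨rfl, rfl⟩ | ⟨rfl, rfl⟩
      exacts [h3.1, h3.2]
    have h4 : ‖((η : ℂ) • (1 : D.W i →L[ℂ] D.W i)) v‖ ≤ ε / 2 * ‖v‖ := by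
      rw [_root_.smul_apply, one_apply_eq_self, norm_smul, Complex.norm_real, Real.norm_eq_abs,
        abs_of_pos hη]
      exact mul_le_mul_of_nonneg_right hηε (norm_nonneg v)
    have h5 : ‖(((6 * (δ * κ i) : ℝ) : ℂ) • gramFun Z fun x => (x + δ * κ i)⁻¹) v‖ ≤
        ε / 2 * ‖v‖ := by
      rw [_root_.smul_apply, norm_smul, Complex.norm_real, Real.norm_eq_abs,
        abs_of_nonneg (by positivity)]
      have : ‖(gramFun Z fun x => (x + δ * κ i)⁻¹) v‖ = ‖resolv Z (δ * κ i) v‖ := rfl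
      rw [this]
      linarith
    rw [_root_.add_apply]
    exact (norm_add_le _ _).trans ((add_le_add h4 h5).trans_eq (by ring))

end Column

end HarmonicSU3
end

noncomputable section

namespace HarmonicSU3

/-! ### The phases of the simple root vectors -/

section RootPhase

instance (S : Set (Fin 2)) : SecondCountableTopology (KS S) :=
  TopologicalSpace.Subtype.secondCountableTopology (KS S : Set SU3)

theorem sameBlock_of_mem {S : Set (Fin 2)} {i : Fin 2} (hi : i ∈ S) :
    SameBlock S i.castSucc i.succ := fun j h1 h2 => by
  have : j = i := Fin.ext (by
    simp only [Fin.val_castSucc, Fin.val_succ] at h1 h2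
    omega)
  rwa [this]

variable {H : Type u} [NormedAddCommGroup H] [InnerProductSpace ℂ H] [CompleteSpace H]
variable {D : Blocks H} {π : UnitaryRep SU3 H} (hD : ∀ i, π.IsInvariant (D.W i))
  {κ : D.ι → ℝ} (hκ0 : ∀ i, 0 ≤ κ i)
  (hκ : ∀ i, (D.rep π hD i).casimir = (κ i : ℂ) • 1)

include hκ hκ0

/-- Three mechanisms: commutation when `α_i ∈ S`, a torus character when `S = ∅`, and approximation
of columns when `S` contains only the other simple root. The adjoint is the phase of the opposite
root vector, so rows need no separate argument. -/
theorem phase_mem_opAS {i : Fin 2} {a b : Fin 3}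
    (hab : a = i.castSucc ∧ b = i.succ ∨ a = i.succ ∧ b = i.castSucc) {V : H →L[ℂ] H}
    (hV : D.IsDiag V fun i => phase ((D.rep π hD i).unit a b)) (S : Set (Fin 2)) :
    V ∈ opAS S π π := by
  have hV' : D.IsDiag (ContinuousLinearMap.adjoint V)
      fun i => phase ((D.rep π hD i).unit b a) := by
    have h := hV.star
    simp only [star_phase, UnitaryRep.star_unit] at h
    exact h
  by_cases hi : i ∈ S
  · refine subset_closure (harmonicallyProper_phase_of_sameBlock hD ?_ hV)
    rcases hab with ⟨rfl, rfl⟩ | ⟨rfl, rfl⟩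
    exacts [sameBlock_of_mem hi, (sameBlock_of_mem hi).symm]
  by_cases hS : S = ∅
  · subst hS
    exact subset_closure (harmonicallyProper_iff.2
      ⟨columnFinite_phase_of_empty hD hV, columnFinite_phase_of_empty hD hV'⟩)
  obtain ⟨j, hj⟩ := Set.nonempty_iff_ne_empty.2 hS
  have hji : j ≠ i := fun h => hi (h ▸ hj)
  -- `{p, r}` is the block of the root in `S`, `s` the isolated index, and `p` the index shared by
  -- the two simple roots; the root vector is `E_sp` or `E_ps`.
  obtain ⟨s, p, r, hsp, hsr, hpr, hblock, hspi⟩ : ∃ s p r : Fin 3, s ≠ p ∧ s ≠ r ∧ p ≠ r ∧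
      SameBlock S p r ∧ (s = i.castSucc ∧ p = i.succ ∨ s = i.succ ∧ p = i.castSucc) := by
    have hb := sameBlock_of_mem hj
    fin_cases i <;> fin_cases j
    · exact absurd rfl hji
    · exact ⟨0, 1, 2, by decide, by decide, by decide, hb, Or.inl ⟨rfl, rfl⟩⟩
    · exact ⟨2, 1, 0, by decide, by decide, by decide, hb.symm, Or.inr ⟨rfl, rfl⟩⟩
    · exact absurd rfl hji
  have hab1 : a = s ∧ b = p ∨ a = p ∧ b = s := by
    rcases hab with ⟨rfl, rfl⟩ | ⟨rfl, rfl⟩ <;> rcases hspi with ⟨rfl, rfl⟩ | ⟨rfl, rfl⟩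
    exacts [Or.inl ⟨rfl, rfl⟩, Or.inr ⟨rfl, rfl⟩, Or.inr ⟨rfl, rfl⟩, Or.inl ⟨rfl, rfl⟩]
  have hab2 : b = s ∧ a = p ∨ b = p ∧ a = s := hab1.symm.imp And.symm And.symm
  exact mem_closure_harmonicallyProper
    (Blocks.isComplete fun i => (hD i).restrict (KS S))
    (fun σ ε hε => exists_columnFinite_near_phase hD hκ0 hκ hsp hsr hpr hblock hab1 hV σ hε)
    (fun σ ε hε => exists_columnFinite_near_phase hD hκ0 hκ hsp hsr hpr hblock hab2 hV' σ hε)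

end RootPhase

/-- The phase of a simple root vector exists, is unique, and belongs to all the algebras `𝒜_S`. -/
theorem exists_phase {H : Type u} [NormedAddCommGroup H] [InnerProductSpace ℂ H]
    [CompleteSpace H] (π : UnitaryRep SU3 H) {i : Fin 2} {a b : Fin 3}
    (hab : a = i.castSucc ∧ b = i.succ ∨ a = i.succ ∧ b = i.castSucc)
    {Z : Matrix (Fin 3) (Fin 3) ℂ} (hZ : Z.trace = 0) (hZab : Z = Matrix.single a b 1) :
    ∃ V : H →L[ℂ] H, IsPhase (π.closedOp Z hZ) V ∧
      (∀ W, IsPhase (π.closedOp Z hZ) W → W = V) ∧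
      V ∈ opA π π ∧ ∀ S : Set (Fin 2), IsMultiplier.{u, v} S π V := by
  obtain ⟨ι, W, hfin, hmin, horth, htot⟩ := exists_orthogonal_minimalInvariant π
  let D : Blocks H := ⟨ι, W, hfin, horth, htot⟩
  have hD : ∀ i, π.IsInvariant (D.W i) := fun i => (hmin i).invariant
  have hex : ∀ i, ∃ κ : ℝ, 0 ≤ κ ∧ (D.rep π hD i).casimir = (κ : ℂ) • 1 := fun i =>
    (D.rep π hD i).exists_casimir_eq_smul (hmin i).sub
  choose κ hκ0 hκ using hex
  obtain ⟨V, hV⟩ := D.exists_isDiag (fun i => phase ((D.rep π hD i).unit a b)) (M := 1) fun i =>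
    ContinuousLinearMap.opNorm_le_bound _ zero_le_one fun x => by
      rw [one_mul]; exact norm_phase_apply_le _ x
  have hmem := phase_mem_opAS hD hκ0 hκ hab hV
  subst hZab
  rw [UnitaryRep.closedOp_eq_pmap hD]
  refine ⟨V, Blocks.isPhase_pmap _ hV, fun W hW => Blocks.eq_of_isPhase_pmap hV hW,
    Set.mem_iInter.2 hmem, fun S H' _ _ _ π' => ?_⟩
  exact comp_mem_closure_harmonicallyFinite
    (Blocks.isComplete fun i => (hD i).restrict (KS S)) (hmem S)

end HarmonicSU3
end

open HarmonicSU3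
theorem theoremA {H : Type u} [NormedAddCommGroup H] [InnerProductSpace ℂ H]
    [CompleteSpace H] (π : UnitaryRep SU3 H) (i : Fin 2) :
    (∃ V : H →L[ℂ] H, IsPhase (π.closedOp (rootX i) (trace_rootX i)) V ∧
      (∀ W, IsPhase (π.closedOp (rootX i) (trace_rootX i)) W → W = V) ∧
      V ∈ opA π π ∧ ∀ S : Set (Fin 2), IsMultiplier.{u, v} S π V) ∧
    (∃ V : H →L[ℂ] H, IsPhase (π.closedOp (rootY i) (trace_rootY i)) V ∧
      (∀ W, IsPhase (π.closedOp (rootY i) (trace_rootY i)) W → W = V) ∧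
      V ∈ opA π π ∧ ∀ S : Set (Fin 2), IsMultiplier.{u, v} S π V) :=
  ⟨exists_phase π (Or.inl ⟨rfl, rfl⟩) _ rfl,
    exists_phase π (Or.inr ⟨rfl, rfl⟩) _ (Matrix.transpose_single _ _ _)⟩
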